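/- Let $W$ be an $n\times n$ random matrix with i.i.d.\ standard complex Gaussian entries (density $\frac1\pi e^{-|w|^2}$ on $\mathbb C$), let $J$ be the $n\times n$ all-ones matrix, and put $P_n(z)=\frac1{n!}\operatorname{per}(J+zW)$. Since $P_n(0)=1$, near $0$ there is a unique holomorphic branch of $\log P_n$ with $\log P_n(0)=0$; write $\log P_n(z)=\sum_{k\ge1}b_{k,n}z^k$ for its Taylor expansion at $0$, and $T_{d,n}(z)=\sum_{k=1}^{d}b_{k,n}z^k$. (a) Let $\beta\in(0,1/3)$, let $d\ge2$ be an integer, let $\gamma\in\mathbb R$ with $\gamma<\frac{d+1}{6}+\beta(d+1)-\frac12$, and let $\delta\in(0,1)$. There is $N=N(\beta,d,\gamma,\delta)$ such that for all $n\ge N$, with probability at least $1-\delta$, the branch of $\log P_n$ determined by $\log P_n(0)=0$ is well defined (and analytic) on the disk $\{|z|\le n^{1/3-\beta}\}$ and $$\sup_{|z|\le n^{1/3-\beta}}\bigl|\log P_n(z)-T_{d,n}(z)\bigr|\le n^{-\gamma}.$$ (b) In particular, for every $\gamma>0$ the degree $d=\lceil 6\gamma+3\rceil$ suffices: for all $\beta\in(0,1/3)$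 and $\delta\in(0,1)$, and all $n\ge N(\beta,\gamma,\delta)$, the conclusion of (a) holds for this $d$ with probability at least $1-\delta$. Moreover there is an absolute constant $C>0$ such that for every $\gamma>0$ there is a deterministic algorithm which, for all sufficiently large $n\ge N(\gamma)$, given $n$, an arbitrary matrix $W\in\mathbb C^{n\times n}$ and $z\in\mathbb C$, computes the value $T_{d,n}(z)$ exactly, with $d=\lceil 6\gamma+3\rceil$, in at most $n^{C(1+\gamma)}$ steps. The algorithm is a program, depending only on $\gamma$, for a unit-cost random access machine with exact complex arithmetic; the tests and addresses in it involve natural numbers only, and the only constants are natural numbers. -/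

import Mathlib

open MeasureTheory ProbabilityTheory Set

/-! ### The random matrix -/

/-- The standard complex Gaussian law `𝒩_ℂ(0,1)`: density `(1/π) exp(-|w|²)` with respect to
Lebesgue measure on `ℂ`. -/
noncomputable def stdComplexGaussian : Measure ℂ :=
  (volume : Measure ℂ).withDensity fun w => ENNReal.ofReal (1 / Real.pi * Real.exp (-‖w‖ ^ 2))

/-- The entries of the random matrix `W` are i.i.d. standard complex Gaussians. -/
structure IsIIDComplexGaussian {Ω : Type*} [MeasurableSpace Ω] {n : ℕ}
    (W : Ω → Matrix (Fin n) (Fin n) ℂ) (P : Measure Ω) : Prop where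
  law : ∀ i j, HasLaw (fun ω => W ω i j) stdComplexGaussian P
  indep : iIndepFun (fun (e : Fin n × Fin n) (ω : Ω) => W ω e.1 e.2) P

/-! ### The normalized permanent and the Taylor polynomials of its logarithm -/

/-- `P_n(z) = (1/n!) per(J + zW)`, where `J` is the all-ones matrix. -/
noncomputable def normPer {n : ℕ} (W : Matrix (Fin n) (Fin n) ℂ) (z : ℂ) : ℂ :=
  (Matrix.of (fun _ _ => (1 : ℂ)) + z • W).permanent / (n.factorial : ℂ)

/-- The `k`-th Taylor coefficient at `0` of the branch of `log P_n` that vanishes at `0`. As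
`P_n(0) = 1`, near `0` this branch is the principal logarithm of `P_n`. -/
noncomputable def logCoeff {n : ℕ} (W : Matrix (Fin n) (Fin n) ℂ) (k : ℕ) : ℂ :=
  iteratedDeriv k (fun z => Complex.log (normPer W z)) 0 / (k.factorial : ℂ)

/-- The degree-`d` truncation `∑_{k=1}^d b_k z^k` of the Taylor expansion of `log P_n`. -/
noncomputable def logTrunc {n : ℕ} (W : Matrix (Fin n) (Fin n) ℂ) (d : ℕ) (z : ℂ) : ℂ :=
  ∑ k ∈ Finset.Icc 1 d, logCoeff W k * z ^ k

/-- There is a branch `g` of `log P_n` with `g(0) = 0`, analytic on (a neighbourhood of) the closed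
disk `|z| ≤ R`, and on this disk it is within `ε` of its degree-`d` Taylor truncation.
(By connectedness such a branch is unique on the disk.) -/
def LogBranchApprox {n : ℕ} (W : Matrix (Fin n) (Fin n) ℂ) (R : ℝ) (d : ℕ) (ε : ℝ) : Prop :=
  ∃ g : ℂ → ℂ, AnalyticOnNhd ℂ g (Metric.closedBall 0 R) ∧ g 0 = 0 ∧
    (∀ z ∈ Metric.closedBall (0 : ℂ) R, Complex.exp (g z) = normPer W z) ∧
    ∀ z ∈ Metric.closedBall (0 : ℂ) R, ‖g z - logTrunc W d z‖ ≤ ε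

/-- `Γ_{d,β} = (d+1)/6 + β(d+1) - 1/2`. -/
noncomputable def tradeoffExponent (d : ℕ) (β : ℝ) : ℝ :=
  ((d : ℝ) + 1) / 6 + β * ((d : ℝ) + 1) - 1 / 2

/-! ### Machine model

A unit-cost random access machine with exact complex arithmetic. It has two unbounded memories:
natural numbers `idx` (loop counters and addresses; addition and truncated subtraction only) and
complex numbers `num` (field operations). Every elementary instruction and every test costs one
step, and tests compare natural numbers only. The programs form a fixed finite syntax, in which the
only constants are natural numbers: a program works for all `n` and cannot depend on the input. -/

/-- The memory of the machine. -/
structure RamState where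
  idx : ℕ → ℕ
  num : ℕ → ℂ

/-- Elementary instructions; every one of them costs one step. -/
inductive RamOp where
  | skip
  /-- `idx[a] := k` -/
  | idxConst (a k : ℕ)
  /-- `idx[a] := idx[b] + idx[c]` -/
  | idxAdd (a b c : ℕ)
  /-- `idx[a] := idx[b] - idx[c]`, truncated at `0` -/
  | idxSub (a b c : ℕ)
  /-- `idx[a] := idx[idx[b]]` -/
  | idxLoad (a b : ℕ)
  /-- `idx[idx[a]] := idx[b]` -/
  | idxStore (a b : ℕ)
  /-- `num[a] := k` -/
  | numConst (a k : ℕ)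
  /-- `num[a] := idx[b]` -/
  | numOfIdx (a b : ℕ)
  /-- `num[a] := num[b] + num[c]` -/
  | numAdd (a b c : ℕ)
  /-- `num[a] := num[b] - num[c]` -/
  | numSub (a b c : ℕ)
  /-- `num[a] := num[b] * num[c]` -/
  | numMul (a b c : ℕ)
  /-- `num[a] := num[b] / num[c]`; no result if `num[c] = 0` -/
  | numDiv (a b c : ℕ)
  /-- `num[a] := num[idx[b]]` -/
  | numLoad (a b : ℕ)
  /-- `num[idx[a]] := num[b]` -/
  | numStore (a b : ℕ)
  /-- `num[a] := W[idx[b], idx[c]]` (indices from `0` to `n - 1`; no result outside the matrix) -/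
  | entry (a b c : ℕ)

namespace RamState

/-- Write a natural number to `idx[a]`. -/
def setIdx (s : RamState) (a v : ℕ) : RamState := ⟨Function.update s.idx a v, s.num⟩

/-- Write a complex number to `num[a]`. -/
def setNum (s : RamState) (a : ℕ) (v : ℂ) : RamState := ⟨s.idx, Function.update s.num a v⟩

end RamState

open Classical in
/-- The effect of an elementary instruction on the memory, with the read-only input matrix `W`;
`none` means that the machine is stuck. -/
noncomputable def RamOp.eval {n : ℕ} (W : Matrix (Fin n) (Fin n) ℂ) (s : RamState) :
    RamOp → Option RamState
  | skip => some s
  | idxConst a k => some (s.setIdx a k)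
  | idxAdd a b c => some (s.setIdx a (s.idx b + s.idx c))
  | idxSub a b c => some (s.setIdx a (s.idx b - s.idx c))
  | idxLoad a b => some (s.setIdx a (s.idx (s.idx b)))
  | idxStore a b => some (s.setIdx (s.idx a) (s.idx b))
  | numConst a k => some (s.setNum a (k : ℂ))
  | numOfIdx a b => some (s.setNum a (s.idx b : ℂ))
  | numAdd a b c => some (s.setNum a (s.num b + s.num c))
  | numSub a b c => some (s.setNum a (s.num b - s.num c))
  | numMul a b c => some (s.setNum a (s.num b * s.num c))
  | numDiv a b c => if s.num c = 0 then none else some (s.setNum a (s.num b / s.num c))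
  | numLoad a b => some (s.setNum a (s.num (s.idx b)))
  | numStore a b => some (s.setNum (s.idx a) (s.num b))
  | entry a b c =>
      if h : s.idx b < n ∧ s.idx c < n then
        some (s.setNum a (W ⟨s.idx b, h.1⟩ ⟨s.idx c, h.2⟩))
      else none

/-- Programs. -/
inductive RamProg where
  /-- an elementary instruction -/
  | op (o : RamOp)
  /-- first `p`, then `q` -/
  | seq (p q : RamProg)
  /-- if `idx[a] < idx[b]` then `p` else `q` -/
  | ite (a b : ℕ) (p q : RamProg)
  /-- while `idx[a] < idx[b]` do `p` -/
  | loop (a b : ℕ) (p : RamProg)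

/-- `RamExec W p s t s'`: with the input matrix `W`, the program `p` started in the memory state `s`
halts after exactly `t` steps in the memory state `s'`. -/
inductive RamExec {n : ℕ} (W : Matrix (Fin n) (Fin n) ℂ) :
    RamProg → RamState → ℕ → RamState → Prop where
  | op {o : RamOp} {s s' : RamState} (h : o.eval W s = some s') : RamExec W (.op o) s 1 s'
  | seq {p q : RamProg} {s₁ s₂ s₃ : RamState} {t₁ t₂ : ℕ}
      (hp : RamExec W p s₁ t₁ s₂) (hq : RamExec W q s₂ t₂ s₃) :
      RamExec W (.seq p q) s₁ (t₁ + t₂) s₃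
  | iteTrue {a b : ℕ} {p q : RamProg} {s s' : RamState} {t : ℕ}
      (hlt : s.idx a < s.idx b) (hp : RamExec W p s t s') :
      RamExec W (.ite a b p q) s (t + 1) s'
  | iteFalse {a b : ℕ} {p q : RamProg} {s s' : RamState} {t : ℕ}
      (hge : ¬ s.idx a < s.idx b) (hq : RamExec W q s t s') :
      RamExec W (.ite a b p q) s (t + 1) s'
  | loopStop {a b : ℕ} {p : RamProg} {s : RamState}
      (hge : ¬ s.idx a < s.idx b) : RamExec W (.loop a b p) s 1 s
  | loopStep {a b : ℕ} {p : RamProg} {s₁ s₂ s₃ : RamState} {t₁ t₂ : ℕ}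
      (hlt : s₁.idx a < s₁.idx b) (hp : RamExec W p s₁ t₁ s₂)
      (hr : RamExec W (.loop a b p) s₂ t₂ s₃) :
      RamExec W (.loop a b p) s₁ (t₁ + t₂ + 1) s₃

/-- The machine is deterministic: the step count and the final memory are determined by the input. -/
theorem RamExec.deterministic {n : ℕ} {W : Matrix (Fin n) (Fin n) ℂ} {p : RamProg}
    {s s₁ s₂ : RamState} {t₁ t₂ : ℕ} (h₁ : RamExec W p s t₁ s₁) (h₂ : RamExec W p s t₂ s₂) :
    t₁ = t₂ ∧ s₁ = s₂ := by
  induction h₁ generalizing t₂ s₂ with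
  | op h =>
    cases h₂ with
    | op h' => exact ⟨rfl, Option.some.inj (h.symm.trans h')⟩
  | seq _ _ ihp ihq =>
    cases h₂ with
    | seq hp' hq' =>
      obtain ⟨rfl, rfl⟩ := ihp hp'
      obtain ⟨rfl, rfl⟩ := ihq hq'
      exact ⟨rfl, rfl⟩
  | iteTrue hlt _ ih =>
    cases h₂ with
    | iteTrue _ hp' => obtain ⟨rfl, rfl⟩ := ih hp'; exact ⟨rfl, rfl⟩
    | iteFalse hge _ => exact absurd hlt hge
  | iteFalse hge _ ih =>
    cases h₂ with
    | iteTrue hlt _ => exact absurd hlt hge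
    | iteFalse _ hq' => obtain ⟨rfl, rfl⟩ := ih hq'; exact ⟨rfl, rfl⟩
  | loopStop hge =>
    cases h₂ with
    | loopStop _ => exact ⟨rfl, rfl⟩
    | loopStep hlt _ _ => exact absurd hlt hge
  | loopStep hlt _ _ ihp ihr =>
    cases h₂ with
    | loopStop hge => exact absurd hlt hge
    | loopStep _ hp' hr' =>
      obtain ⟨rfl, rfl⟩ := ihp hp'
      obtain ⟨rfl, rfl⟩ := ihr hr'
      exact ⟨rfl, rfl⟩

/-- The initial memory on input `(n, W, z)`: `idx[0] = n`, `num[0] = z`, and everything else is `0`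
(the matrix `W` is read by the instruction `entry`). -/
def ramInit (n : ℕ) (z : ℂ) : RamState := ⟨Pi.single 0 n, Pi.single 0 z⟩

/-- On input `(n, W, z)` the program `p` halts after exactly `t` steps, with output `num[0] = v`. -/
def RamOutputs {n : ℕ} (p : RamProg) (W : Matrix (Fin n) (Fin n) ℂ) (z : ℂ) (t : ℕ) (v : ℂ) :
    Prop :=
  ∃ s : RamState, RamExec W p (ramInit n z) t s ∧ s.num 0 = v

/-! The proof combines a zero-free disk for the permanent with second moment bounds for the single
Taylor coefficients of its logarithm.

Zero-free disk. Write `W i j = ρ i + c j + V i j`, where `V` has zero row and column sums and `∑ c =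
0`. Dividing `1 + z W i j` by `1 + z ρ i` and then by `1 + z m c j`, where `m` is the mean of `a i =
(1 + z ρ i)⁻¹`, leaves the matrix `1 + x i * w j + z a i b j V i j` with `∑ x = 0` and `∑ w` of
second order (`permanent_eq_mul_restPer`). The factors split off have no zeros when the means are
small, so it remains to show that the normalized permanent `Q` of this matrix is close to `1`. Given
the means, `V` may be resampled as the projection of a fresh Gaussian matrix
(`map_mix_gaussianVec`). In the expansion of `Q` in `V`, a form of degree `k` has second moment at
most `k!` times the squared `ℓ²` norm of its kernel (`integral_norm_sq_le`). The obvious kernel,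
supported on partial matchings, is too large. Since `V` sums to zero in each index, kernels that do
not depend on one of the indices contribute nothing; modulo these, the exponential generating
function of every letter can be multiplied by `exp (-x)` (`listSum_tilt`). In the generating
function of the squared norm this replaces factors like `1 + τ` by factors like `1 + O(τ²)`, and
choosing `τ` near a saddle point bounds the terms by a geometric series (`moment_bound`). With `t =
|z|` its ratio is small once `t ^ 6 / n ^ 2` is small, which is the origin of the exponent `1/3`.
Integrating over a circle, Markov's inequality and Cauchy's formula give `|Q - 1| ≤ 1/2` on a disk,
hence a branch of the logarithm bounded by `3n`.

Single coefficients. Functions on lists with the shuffle product form a commutative ring, and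
evaluation at `W` maps it to power series. There `P_n` comes from the matching weights, and `b_k`
from their shuffle logarithm, the cumulants. If `x` is one cell, the derivative of the weights at
`x` is again a matching weight, with its falling factorial shifted by one and with the row and
column of `x` removed. This gives a recursion for the cumulants in which one factor is a difference
(`der_der_log_matchWeight`); the shift is handled by the Schwarz lemma in a complex parameter, the
removal by counting the `2n` removed cells. Hence the squared norm in degree `k` is `O(n ^ (k +
1))`, and `E|b_k|² = O(n ^ (-(k - 1)))`.

Conclusion. On `|z| ≤ n ^ (1/3 - β)` the `k`-th term is of order `n ^ (-(k/6 + βk - 1/2))`, and `k =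
d + 1` gives the tradeoff exponent. Finitely many terms are treated by Chebyshev's inequality, the
remaining ones by Cauchy's estimates in the larger disk of radius `n ^ (1/3 - β/2)`.

Algorithm. The coefficients of `P_n` up to degree `d` are sums over partial matchings with at most
`d` edges, enumerated by `2d` nested loops; the recursion from `P (log P)' = P'` turns them into the
`b_k`. -/

/-! ### Sums over lists of fixed length -/

/-- The sum of `F` over all lists of length `k`. -/
def listSum {X R : Type*} [Fintype X] [AddCommMonoid R] : ℕ → (List X → R) → R
  | 0, F => F []
  | k + 1, F => ∑ x, listSum k fun L => F (x :: L)

namespace listSum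

variable {X Y R : Type*} [Fintype X] [Fintype Y]

theorem congr_of_length [AddCommMonoid R] {k : ℕ} {F G : List X → R}
    (h : ∀ L : List X, L.length = k → F L = G L) : listSum k F = listSum k G := by
  induction k generalizing F G with
  | zero => exact h [] rfl
  | succ k ih =>
    exact Finset.sum_congr rfl fun x _ => ih fun L hL => h (x :: L) (by simp [hL])

theorem sum_comm [AddCommMonoid R] {ι : Type*} (s : Finset ι) (k : ℕ) (F : ι → List X → R) :
    ∑ i ∈ s, listSum k (F i) = listSum k fun L => ∑ i ∈ s, F i L := by
  induction k generalizing F with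
  | zero => rfl
  | succ k ih =>
    simp only [listSum]
    rw [Finset.sum_comm]
    exact Finset.sum_congr rfl fun x _ => ih fun i L => F i (x :: L)

theorem add [AddCommMonoid R] (k : ℕ) (F G : List X → R) :
    listSum k (fun L => F L + G L) = listSum k F + listSum k G := by
  induction k generalizing F G with
  | zero => rfl
  | succ k ih => simp only [listSum, ih, Finset.sum_add_distrib]

theorem map_hom [AddCommMonoid R] {S : Type*} [AddCommMonoid S] (φ : R →+ S) (k : ℕ)
    (F : List X → R) : φ (listSum k F) = listSum k fun L => φ (F L) := by
  induction k generalizing F with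
  | zero => rfl
  | succ k ih => simp only [listSum, map_sum, ih]

theorem mul_left [NonUnitalNonAssocSemiring R] (k : ℕ) (c : R) (F : List X → R) :
    listSum k (fun L => c * F L) = c * listSum k F :=
  (map_hom (AddMonoidHom.mulLeft c) k F).symm

theorem mul_right [NonUnitalNonAssocSemiring R] (k : ℕ) (c : R) (F : List X → R) :
    listSum k (fun L => F L * c) = listSum k F * c :=
  (map_hom (AddMonoidHom.mulRight c) k F).symm

theorem comm [AddCommMonoid R] (k l : ℕ) (F : List X → List Y → R) :
    listSum k (fun L => listSum l fun M => F L M) =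
      listSum l fun M => listSum k fun L => F L M := by
  induction k generalizing F with
  | zero => rfl
  | succ k ih => simp only [listSum, ih, sum_comm]

theorem append [AddCommMonoid R] (k l : ℕ) (F : List X → R) :
    listSum (k + l) F = listSum k fun L => listSum l fun M => F (L ++ M) := by
  induction k generalizing F with
  | zero => simp [listSum]
  | succ k ih =>
    rw [Nat.succ_add]
    simp only [listSum, ih, List.cons_append]

theorem prod_eq [AddCommMonoid R] (k : ℕ) (F : List X → List Y → R) :
    listSum k (fun L => listSum k fun M => F L M) =
      listSum k fun e : List (X × Y) => F (e.map Prod.fst) (e.map Prod.snd) := by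
  induction k generalizing F with
  | zero => rfl
  | succ k ih =>
    simp only [listSum, List.map_cons, Fintype.sum_prod_type]
    refine Finset.sum_congr rfl fun x _ => ?_
    rw [← sum_comm]
    exact Finset.sum_congr rfl fun y _ => ih fun L M => F (x :: L) (y :: M)

theorem eq_sum_ofFn [AddCommMonoid R] (k : ℕ) (F : List X → R) :
    listSum k F = ∑ i : Fin k → X, F (List.ofFn i) := by
  induction k generalizing F with
  | zero => simp [listSum]
  | succ k ih =>
    rw [← (Fin.consEquiv fun _ => X).sum_comp, Fintype.sum_prod_type]
    simp only [listSum, ih]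
    exact Finset.sum_congr rfl fun x _ => Finset.sum_congr rfl fun i _ => by
      simp [Fin.consEquiv, List.ofFn_succ]

theorem nonneg {k : ℕ} {F : List X → ℝ} (h : ∀ L, 0 ≤ F L) : 0 ≤ listSum k F := by
  rw [eq_sum_ofFn]; exact Finset.sum_nonneg fun _ _ => h _

theorem mono {k : ℕ} {F G : List X → ℝ} (h : ∀ L, L.length = k → F L ≤ G L) :
    listSum k F ≤ listSum k G := by
  rw [eq_sum_ofFn, eq_sum_ofFn]; exact Finset.sum_le_sum fun _ _ => h _ (by simp)

end listSum

/-! ### Weights that depend on the multiplicities of a list -/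

theorem derivation_prod {X A R : Type*} [DecidableEq X] [CommSemiring A] [CommSemiring R] [Algebra R A]
    (D : Derivation R A A) (s : Finset X) (f : X → A) :
    D (∏ v ∈ s, f v) = ∑ v ∈ s, (∏ w ∈ s.erase v, f w) • D (f v) := by
  induction s using Finset.induction_on with
  | empty => simp
  | insert a s ha ih =>
    rw [Finset.prod_insert ha, D.leibniz, ih, Finset.sum_insert ha, Finset.erase_insert ha,
      add_comm, Finset.smul_sum]
    congr 1
    refine Finset.sum_congr rfl fun v hv => ?_
    have hva : a ≠ v := fun h => ha (h ▸ hv)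
    rw [Finset.erase_insert_of_ne hva, Finset.prod_insert (by simp [ha]), mul_smul]

section Profile

variable {X R K : Type*} [Fintype X] [DecidableEq X]

/-- The weight `∏ᵥ g v (multiplicity of v in L)`. -/
def profWeight [CommMonoid R] (g : X → ℕ → R) (L : List X) : R := ∏ v, g v (L.count v)

/-- Shift the weight sequence at `v`. -/
def shiftAt (v : X) (g : X → ℕ → R) : X → ℕ → R :=
  Function.update g v fun m => g v (m + 1)

theorem profWeight_cons [CommMonoid R] (g : X → ℕ → R) (v : X) (L : List X) :
    profWeight g (v :: L) = profWeight (shiftAt v g) L := by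
  refine Finset.prod_congr rfl fun w _ => ?_
  by_cases h : w = v
  · subst h; simp [shiftAt]
  · simp [shiftAt, h, Ne.symm h]

/-- The exponential generating series of a weight sequence. -/
noncomputable def expSeries [Field K] (g : ℕ → K) : PowerSeries K :=
  PowerSeries.mk fun m => g m / (m.factorial : K)

theorem derivative_expSeries [Field K] [CharZero K] (g : ℕ → K) :
    PowerSeries.derivative K (expSeries g) = expSeries fun m => g (m + 1) := by
  ext m
  rw [PowerSeries.coeff_derivative]
  simp only [expSeries, PowerSeries.coeff_mk, Nat.factorial_succ]
  push_cast
  have h1 : ((m : K) + 1) ≠ 0 := by exact_mod_cast Nat.succ_ne_zero m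
  have h2 : (m.factorial : K) ≠ 0 := by exact_mod_cast m.factorial_ne_zero
  field_simp

/-- Removing the first letter `v` shifts the weight sequence at `v`, which differentiates the `v`-th
generating function; summing over `v` is the Leibniz rule for the product. -/
theorem listSum_profWeight [Field K] [CharZero K] (k : ℕ) (g : X → ℕ → K) :
    listSum k (profWeight g) =
      (k.factorial : K) * PowerSeries.coeff k (∏ v, expSeries (g v)) := by
  induction k generalizing g with
  | zero =>
    simp [listSum, profWeight, expSeries, ← PowerSeries.coeff_zero_eq_constantCoeff_apply,
      PowerSeries.coeff_zero_eq_constantCoeff, map_prod]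
  | succ k ih =>
    have h1 : PowerSeries.coeff (k + 1) (∏ v, expSeries (g v)) * ((k : K) + 1) =
        PowerSeries.coeff k (∑ v, ∏ w, expSeries (shiftAt v g w)) := by
      rw [← PowerSeries.coeff_derivative, derivation_prod]
      congr 1
      refine Finset.sum_congr rfl fun v _ => ?_
      rw [derivative_expSeries, smul_eq_mul, ← Finset.prod_erase_mul _ _ (Finset.mem_univ v)]
      congr 1
      · refine Finset.prod_congr rfl fun w hw => ?_
        simp [shiftAt, Finset.ne_of_mem_erase hw]
      · simp [shiftAt]
    simp only [listSum, profWeight_cons]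
    rw [Finset.sum_congr rfl fun v _ => ih (shiftAt v g), ← Finset.mul_sum, ← map_sum, ← h1,
      Nat.factorial_succ]
    push_cast
    ring

end Profile

/-! ### Lists without repetition -/

section Pair

variable {X R K : Type*} [Fintype X] [DecidableEq X]

/-- The weight sequence `c, a, 0, 0, …`. -/
def pairW [Zero R] (c a : R) : ℕ → R
  | 0 => c
  | 1 => a
  | _ + 2 => 0

theorem profWeight_pairW [CommSemiring R] (c a : X → R) (L : List X) :
    profWeight (fun v => pairW (c v) (a v)) L =
      if L.Nodup then (L.map a).prod * ∏ v, (if v ∈ L then 1 else c v) else 0 := by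
  split_ifs with h
  · have h1 : (L.map a).prod = ∏ v, if v ∈ L then a v else 1 := by
      rw [← List.prod_toFinset a h, ← Finset.prod_filter]
      exact Finset.prod_congr (by ext; simp) fun _ _ => rfl
    rw [h1, ← Finset.prod_mul_distrib]
    refine Finset.prod_congr rfl fun v _ => ?_
    by_cases hv : v ∈ L
    · simp [hv, List.count_eq_one_of_mem h hv, pairW]
    · simp [hv, List.count_eq_zero_of_not_mem hv, pairW]
  · rw [List.nodup_iff_count_le_one] at h
    push Not at h
    obtain ⟨v, hv⟩ := h
    refine Finset.prod_eq_zero (Finset.mem_univ v) ?_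
    obtain ⟨m, hm⟩ := Nat.exists_eq_add_of_le hv
    rw [hm, add_comm]
    rfl

theorem coeff_prod_add_mul_X [Field K] [CharZero K] (c f : X → K) (l : ℕ) :
    (∏ v, (Polynomial.C (c v) + Polynomial.C (f v) * Polynomial.X)).coeff l =
      (l.factorial : K)⁻¹ * listSum l (profWeight fun v => pairW (c v) (f v)) := by
  have hl : (l.factorial : K) ≠ 0 := by exact_mod_cast l.factorial_ne_zero
  rw [listSum_profWeight, inv_mul_cancel_left₀ hl, ← Polynomial.coeff_coe,
    ← Polynomial.coeToPowerSeries.ringHom_apply, map_prod]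
  congr 1
  refine Finset.prod_congr rfl fun v _ => ?_
  ext m
  rw [Polynomial.coeToPowerSeries.ringHom_apply, Polynomial.coeff_coe, expSeries,
    PowerSeries.coeff_mk]
  rcases m with _ | _ | m
  · simp [pairW]
  · simp [pairW, Polynomial.coeff_C]
  · simp [pairW, Polynomial.coeff_C, Polynomial.coeff_X]

theorem natDegree_prod_add_mul_X_lt [Field K] (c f : X → K) :
    (∏ v, (Polynomial.C (c v) + Polynomial.C (f v) * Polynomial.X)).natDegree <
      Fintype.card X + 1 := by
  refine Nat.lt_succ_of_le ((Polynomial.natDegree_prod_le _ _).trans ?_)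
  refine (Finset.sum_le_sum fun v _ => (?_ : _ ≤ 1)).trans (by simp)
  rw [add_comm]
  exact Polynomial.natDegree_linear_le

/-- Subsets are listed as ordered lists without repetition, so each subset of size `k` occurs `k!`
times. -/
theorem prod_add_eq_sum_listSum [Field K] [CharZero K] (c f : X → K) :
    ∏ v, (c v + f v) = ∑ k ∈ Finset.range (Fintype.card X + 1),
      (k.factorial : K)⁻¹ * listSum k (profWeight fun v => pairW (c v) (f v)) := by
  have h := Polynomial.eval_eq_sum_range' (natDegree_prod_add_mul_X_lt c f) 1
  simp only [coeff_prod_add_mul_X, one_pow, mul_one] at h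
  rw [← h, Polynomial.eval_prod]
  simp

/-- The sum of `∏ x` over the lists of length `l` that extend `L` without repetition. -/
def slotSum [CommSemiring R] (l : ℕ) (x : X → R) (L : List X) : R :=
  listSum l fun M => if (L ++ M).Nodup then (M.map x).prod else 0

theorem prod_ite_mem_eq_of_nodup [CommSemiring R] {L : List X} (hL : L.Nodup) (x : X → R)
    (M : List X) :
    profWeight (fun v => pairW 1 (if v ∈ L then 0 else x v)) M =
      if (L ++ M).Nodup then (M.map x).prod else 0 := by
  rw [profWeight_pairW]
  simp only [ite_self, Finset.prod_const_one, mul_one, List.nodup_append, hL, true_and]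
  by_cases hM : M.Nodup
  · by_cases hd : ∀ a ∈ L, ∀ b ∈ M, a ≠ b
    · rw [if_pos hM, if_pos ⟨hM, hd⟩]
      congr 1
      refine List.map_congr_left fun b hb => if_neg fun hbL => hd b hbL b hb rfl
    · rw [if_pos hM, if_neg (by tauto)]
      push Not at hd
      obtain ⟨a, ha, b, hb, rfl⟩ := hd
      exact List.prod_eq_zero (List.mem_map.2 ⟨a, hb, if_pos ha⟩)
  · simp [hM]

/-- The generating polynomial of the slot sums, with weights `a` on the list. -/
noncomputable def slotPoly [Field K] (a x : X → K) (L : List X) : Polynomial K :=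
  profWeight (fun v => pairW (Polynomial.C 1 + Polynomial.C (x v) * Polynomial.X)
    (Polynomial.C (a v))) L

/-- The slot sum depends on the whole set of letters in `L`. A generating variable turns it into a
coefficient of a product of one-letter weights, the form that tilting and generating functions can
treat. -/
theorem coeff_slotPoly [Field K] [CharZero K] (a x : X → K) (L : List X) (l : ℕ) :
    (l.factorial : K) * (slotPoly a x L).coeff l = (L.map a).prod * slotSum l x L := by
  have hl : (l.factorial : K) ≠ 0 := by exact_mod_cast l.factorial_ne_zero
  rw [slotPoly, profWeight_pairW]
  split_ifs with h
  · have h1 : (L.map fun v => Polynomial.C (a v)).prod = Polynomial.C (L.map a).prod := by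
      rw [map_list_prod, List.map_map]; rfl
    have h2 : (∏ v, if v ∈ L then (1 : Polynomial K) else
        Polynomial.C 1 + Polynomial.C (x v) * Polynomial.X) =
        ∏ v, (Polynomial.C 1 + Polynomial.C (if v ∈ L then 0 else x v) * Polynomial.X) := by
      refine Finset.prod_congr rfl fun v _ => ?_
      split_ifs <;> simp
    rw [h1, h2, Polynomial.coeff_C_mul, coeff_prod_add_mul_X, slotSum]
    rw [show (listSum l fun M => if (L ++ M).Nodup then (M.map x).prod else 0) =
      listSum l (profWeight fun v => pairW 1 (if v ∈ L then 0 else x v)) from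
      congrArg _ (funext fun M => (prod_ite_mem_eq_of_nodup h x M).symm)]
    field_simp
  · have h0 : slotSum l x L = 0 := by
      have : ∀ M : List X, ¬ (L ++ M).Nodup := fun M hM => h (List.nodup_append.1 hM).1
      simp only [slotSum, this, if_false]
      rw [listSum.eq_sum_ofFn]; simp
    simp [h0]

end Pair

/-! ### Tilting -/

section Tilt

variable {X R : Type*} [Fintype X] [DecidableEq X] [CommRing R]

/-- The product of a weight sequence with `exp (-x)`, on exponential generating functions. -/
def tilt : ℕ → (ℕ → R) → R
  | 0, g => g 0
  | m + 1, g => tilt m (fun j => g (j + 1)) - tilt m g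

theorem tilt_zero (m : ℕ) : tilt m (fun _ => (0 : R)) = 0 := by
  induction m with
  | zero => rfl
  | succ m ih => simp [tilt, ih]

/-- These are the coefficients of `exp (-x) * (c + a * x)`. For `c = a` the value at `m = 1`
vanishes: after tilting, a letter that occurs once has almost no weight when `c` and `a` are close.
-/
theorem tilt_pairW (m : ℕ) (c a : R) : tilt m (pairW c a) = (-1) ^ m * (c - m * a) := by
  have h1 : ∀ c a : R, (fun j => pairW c a (j + 1)) = pairW a 0 := fun c a => by
    funext j; rcases j with _ | _ | j <;> rfl
  have h2 : pairW (0 : R) 0 = fun _ => 0 := by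
    funext j; rcases j with _ | _ | j <;> rfl
  have h0 : ∀ (m : ℕ) (a : R), tilt m (pairW a 0) = (-1) ^ m * a := by
    intro m a
    induction m with
    | zero => simp [tilt, pairW]
    | succ m ih => rw [tilt, h1, h2, tilt_zero, ih]; ring
  induction m with
  | zero => simp [tilt, pairW]
  | succ m ih => rw [tilt, h1, h0, ih]; push_cast; ring

/-- The weights before and after tilting differ by weights that do not depend on one of the letters,
and these are annihilated because the columns of `V` sum to zero. -/
theorem listSum_tilt (V : X → X → R) (hV : ∀ j, ∑ i, V i j = 0) (g : X → ℕ → R) (M : List X) :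
    listSum M.length (fun L => profWeight g L * (List.zipWith V L M).prod) =
      listSum M.length fun L =>
        profWeight (fun v m => tilt m (g v)) L * (List.zipWith V L M).prod := by
  induction M generalizing g with
  | nil => simp [listSum, profWeight, tilt]
  | cons j M ih =>
    simp only [List.length_cons, listSum, List.zipWith_cons_cons, List.prod_cons]
    -- By the recursion of `tilt`, the tail weight shifted at `v` is the tilted weight of `v :: L`
    -- plus that of `L`. The latter does not involve `v` and disappears on summation against `V v
    -- j`.
    have h1 : ∀ v, listSum M.length (fun L => profWeight g (v :: L) *
        (V v j * (List.zipWith V L M).prod)) =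
        V v j * (listSum M.length fun L => profWeight (fun w m => tilt m (g w)) (v :: L) *
          (List.zipWith V L M).prod) + V v j * (listSum M.length fun L =>
            profWeight (fun w m => tilt m (g w)) L * (List.zipWith V L M).prod) := by
      intro v
      have h2 := ih (shiftAt v g)
      rw [← mul_add, ← listSum.add]
      simp only [profWeight_cons, ← add_mul, mul_left_comm _ (V v j), listSum.mul_left]
      rw [h2]
      congr 2
      funext L
      congr 1
      simp only [profWeight]
      rw [← Finset.mul_prod_erase _ _ (Finset.mem_univ v),
        ← Finset.mul_prod_erase _ (fun w => shiftAt v _ w _) (Finset.mem_univ v),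
        ← Finset.mul_prod_erase _ (fun w => tilt _ (g w)) (Finset.mem_univ v)]
      have h3 : ∀ h : X → ℕ → R, (∀ w, w ≠ v → ∀ m, h w m = tilt m (g w)) →
          ∏ w ∈ Finset.univ.erase v, h w (L.count w) =
            ∏ w ∈ Finset.univ.erase v, tilt (L.count w) (g w) := fun h hh =>
        Finset.prod_congr rfl fun w hw => hh w (Finset.ne_of_mem_erase hw) _
      rw [h3 (fun w m => tilt m (shiftAt v g w)) fun w hw m => by simp [shiftAt, hw],
        h3 (shiftAt v fun w m => tilt m (g w)) fun w hw m => by simp [shiftAt, hw], ← add_mul]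
      congr 1
      simp [shiftAt, tilt]
    rw [Finset.sum_congr rfl fun v _ => h1 v, Finset.sum_add_distrib, ← Finset.sum_mul, hV,
      zero_mul, add_zero]
    simp only [mul_left_comm _ (V _ j), listSum.mul_left]

end Tilt

/-! ### Sums over permutations -/

section Perm

variable {X K : Type*} [Fintype X] [DecidableEq X]

/-- Permutations act transitively on injections of `Fin q`, so all fibres of `σ ↦ σ ∘ i` have the
same size, and they partition the `n!` permutations. -/
theorem card_perm_comp_eq {q : ℕ} {i j : Fin q → X} (hi : i.Injective) (hj : j.Injective) :
    (Finset.univ.filter fun σ : Equiv.Perm X => ∀ p, σ (i p) = j p).card =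
      (Fintype.card X - q).factorial := by
  classical
  have hq : q ≤ Fintype.card X := by simpa using Fintype.card_le_of_injective i hi
  have hconst : ∀ j' : Fin q ↪ X,
      (Finset.univ.filter fun σ : Equiv.Perm X => ∀ p, σ (i p) = j' p).card =
        (Finset.univ.filter fun σ : Equiv.Perm X => ∀ p, σ (i p) = j p).card := by
    intro j'
    obtain ⟨τ, hτ⟩ := (Equiv.Perm.isMultiplyPretransitive X q).exists_smul_eq j' ⟨j, hj⟩
    have hτ' : ∀ p, τ (j' p) = j p := fun p => DFunLike.congr_fun hτ p
    refine Finset.card_bij (fun σ _ => τ * σ) ?_ (fun _ _ _ _ h => mul_left_cancel h) ?_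
    · intro σ hσ
      simp only [Finset.mem_filter, Finset.mem_univ, true_and] at hσ ⊢
      intro p; simp [hσ p, hτ' p]
    · intro σ hσ
      simp only [Finset.mem_filter, Finset.mem_univ, true_and] at hσ
      refine ⟨τ⁻¹ * σ, ?_, by simp⟩
      simp only [Finset.mem_filter, Finset.mem_univ, true_and]
      intro p; simp [hσ p, ← hτ' p]
  have hsum : Fintype.card (Equiv.Perm X) = ∑ j' : Fin q ↪ X,
      (Finset.univ.filter fun σ : Equiv.Perm X => ∀ p, σ (i p) = j' p).card := by
    rw [← Finset.card_univ, Finset.card_eq_sum_card_fiberwise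
      (f := fun σ : Equiv.Perm X => (⟨fun p => σ (i p), σ.injective.comp hi⟩ : Fin q ↪ X))
      (t := Finset.univ) (by intro; simp)]
    refine Finset.sum_congr rfl fun j' _ => ?_
    congr 1
    ext σ
    simp [DFunLike.ext_iff]
  simp only [hconst, Finset.sum_const, Finset.card_univ, Fintype.card_perm,
    Fintype.card_embedding_eq, Fintype.card_fin, smul_eq_mul] at hsum
  have h2 := Nat.factorial_mul_descFactorial hq
  rw [hsum, mul_comm] at h2
  exact (Nat.eq_of_mul_eq_mul_left (Nat.pos_of_ne_zero fun h => by
    rw [Nat.descFactorial_eq_zero_iff_lt] at h; omega) h2).symm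

theorem sum_perm_map [CommSemiring K] {L : List X} (hL : L.Nodup) (F : List X → K) :
    ∑ σ : Equiv.Perm X, F (L.map σ) = ((Fintype.card X - L.length).factorial : K) *
      listSum L.length fun M => if M.Nodup then F M else 0 := by
  classical
  rw [listSum.eq_sum_ofFn, Finset.mul_sum]
  have hi : (fun p : Fin L.length => L.get p).Injective := List.nodup_iff_injective_get.1 hL
  have hmap : ∀ σ : Equiv.Perm X, L.map σ = List.ofFn fun p => σ (L.get p) := by
    intro σ
    conv_lhs => rw [← List.ofFn_get L, List.map_ofFn]
    rfl
  rw [← Finset.sum_fiberwise (s := Finset.univ) (g := fun σ : Equiv.Perm X =>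
    fun p => σ (L.get p))]
  refine Finset.sum_congr rfl fun j _ => ?_
  by_cases hj : j.Injective
  · rw [if_pos (List.nodup_ofFn.2 hj), ← card_perm_comp_eq hi hj, ← nsmul_eq_mul]
    have hF : ∀ σ ∈ Finset.univ.filter (fun σ : Equiv.Perm X => (fun p => σ (L.get p)) = j),
        F (L.map σ) = F (List.ofFn j) := fun σ hσ => by
      rw [hmap, (Finset.mem_filter.1 hσ).2]
    rw [Finset.sum_congr rfl hF, Finset.sum_const]
    congr 2
    ext σ
    simp [funext_iff]
  · rw [if_neg (by rwa [List.nodup_ofFn]), mul_zero]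
    refine Finset.sum_eq_zero fun σ hσ => ?_
    exact absurd ((Finset.mem_filter.1 hσ).2 ▸ σ.injective.comp hi) hj

theorem prod_map_zipWith [CommSemiring K] (Y : X → X → K) (σ : X → X) (L : List X) :
    (List.zipWith Y L (L.map σ)).prod = (L.map fun v => Y v (σ v)).prod := by
  induction L with
  | nil => rfl
  | cons x L ih => simp [ih]

theorem prod_map_mul_comp [CommSemiring K] (x w : X → K) (σ : X → X) (L : List X) :
    (L.map fun v => x v * w (σ v)).prod = (L.map x).prod * ((L.map σ).map w).prod := by
  induction L with
  | nil => simp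
  | cons y L ih => simp only [List.map_cons, List.prod_cons, ih]; ring

/-- Multiply out, with `L` the positions that take `Y` and `M` those that take `x * w`. The image of
`L ++ M` under a uniform permutation is uniform among the lists without repetition; hence row and
column positions decouple, and the slots can be summed separately on the two sides. -/
theorem sum_perm_prod_eq [Field K] [CharZero K] (Y : X → X → K) (x w : X → K) :
    ∑ σ : Equiv.Perm X, ∏ v, (1 + x v * w (σ v) + Y v (σ v)) =
      ∑ k ∈ Finset.range (Fintype.card X + 1), ∑ l ∈ Finset.range (Fintype.card X + 1),
        (k.factorial : K)⁻¹ * (l.factorial : K)⁻¹ * ((Fintype.card X - (k + l)).factorial : K) *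
          listSum k fun L => listSum k fun M => (List.zipWith Y L M).prod *
            (slotSum l x L * slotSum l w M) := by
  have hσ : ∀ σ : Equiv.Perm X, ∏ v, (1 + x v * w (σ v) + Y v (σ v)) =
      ∑ k ∈ Finset.range (Fintype.card X + 1), ∑ l ∈ Finset.range (Fintype.card X + 1),
        (k.factorial : K)⁻¹ * (l.factorial : K)⁻¹ * listSum k fun L => listSum l fun M =>
          if (L ++ M).Nodup then (L.map fun v => Y v (σ v)).prod *
            (M.map fun v => x v * w (σ v)).prod else 0 := by
    intro σ
    rw [prod_add_eq_sum_listSum]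
    refine Finset.sum_congr rfl fun k _ => ?_
    simp only [mul_assoc]
    rw [← Finset.mul_sum]
    congr 1
    simp only [← listSum.mul_left]
    rw [listSum.sum_comm]
    congr 1
    funext L
    rw [profWeight_pairW]
    split_ifs with h
    · have h2 : (∏ v, if v ∈ L then (1 : K) else 1 + x v * w (σ v)) =
          ∏ v, (1 + if v ∈ L then 0 else x v * w (σ v)) := by
        refine Finset.prod_congr rfl fun v _ => ?_
        split_ifs <;> simp
      rw [h2, prod_add_eq_sum_listSum, Finset.mul_sum]
      refine Finset.sum_congr rfl fun l _ => ?_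
      rw [← listSum.mul_left, ← listSum.mul_left]
      congr 1
      funext M
      rw [prod_ite_mem_eq_of_nodup h]
      split_ifs <;> ring
    · have : ∀ M : List X, ¬ (L ++ M).Nodup := fun M hM => h (List.nodup_append.1 hM).1
      simp only [this, if_false, mul_zero]
      symm
      refine Finset.sum_eq_zero fun l _ => ?_
      rw [listSum.eq_sum_ofFn]; simp
  simp only [hσ]
  rw [Finset.sum_comm]
  refine Finset.sum_congr rfl fun k _ => ?_
  rw [Finset.sum_comm]
  refine Finset.sum_congr rfl fun l _ => ?_
  rw [← Finset.mul_sum, listSum.sum_comm, mul_assoc (_ * _) _ (listSum _ _)]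
  congr 1
  rw [← listSum.mul_left]
  refine listSum.congr_of_length fun L hL => ?_
  rw [listSum.sum_comm]
  have key : ∀ M : List X, M.length = l → (∑ σ : Equiv.Perm X, if (L ++ M).Nodup then
      (L.map fun v => Y v (σ v)).prod * (M.map fun v => x v * w (σ v)).prod else 0) =
      (if (L ++ M).Nodup then (M.map x).prod else 0) *
        (((Fintype.card X - (k + l)).factorial : K) * listSum k fun L' =>
          (List.zipWith Y L L').prod * slotSum l w L') := by
    intro M hM
    split_ifs with h
    · have h1 := sum_perm_map h fun N => (List.zipWith Y L (N.take k)).prod *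
        ((M.map x).prod * ((N.drop k).map w).prod)
      have h2 : ∀ σ : Equiv.Perm X, ((L ++ M).map σ).take k = L.map σ ∧
          ((L ++ M).map σ).drop k = M.map σ := fun σ => by
        constructor <;> simp [← hL]
      simp only [fun σ => (h2 σ).1, fun σ => (h2 σ).2, prod_map_zipWith,
        ← prod_map_mul_comp x w] at h1
      rw [h1, List.length_append, hL, hM, listSum.append]
      rw [mul_left_comm (M.map x).prod, ← listSum.mul_left k (M.map x).prod]
      refine congrArg _ (listSum.congr_of_length (R := K) fun L' hL' => ?_)
      rw [slotSum, ← listSum.mul_left, ← listSum.mul_left]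
      congr 1
      funext M'
      rw [List.take_append_of_le_length hL'.ge, List.drop_append_of_le_length hL'.ge,
        ← hL', List.take_length, List.drop_length, List.nil_append]
      split_ifs <;> ring
    · simp
  refine (listSum.congr_of_length (R := K) key).trans ?_
  rw [listSum.mul_right, mul_left_comm, ← listSum.mul_left]
  congr 2
  funext L'
  simp only [slotSum]
  ring

end Perm

/-! ### Moments of the standard complex Gaussian -/

section Gaussian

theorem integral_stdComplexGaussian {E : Type*} [NormedAddCommGroup E] [NormedSpace ℝ E]
    (f : ℂ → E) : ∫ w, f w ∂stdComplexGaussian =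
      ∫ w, (1 / Real.pi * Real.exp (-‖w‖ ^ 2)) • f w := by
  rw [stdComplexGaussian, integral_withDensity_eq_integral_toReal_smul₀ (by fun_prop) (by simp)]
  refine integral_congr_ae (Filter.Eventually.of_forall fun w => ?_)
  simp only
  rw [ENNReal.toReal_ofReal (by positivity)]

theorem integral_norm_rpow_mul_gaussian (k : ℕ) :
    ∫ w : ℂ, (1 / Real.pi * Real.exp (-‖w‖ ^ 2)) * ‖w‖ ^ k = Real.Gamma (((k : ℝ) + 2) / 2) := by
  have h := Complex.integral_rpow_mul_exp_neg_rpow (p := 2) (q := k) (by norm_num)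
    (by have : (0 : ℝ) ≤ k := k.cast_nonneg
        linarith)
  have h2 : ∀ w : ℂ, (1 / Real.pi * Real.exp (-‖w‖ ^ 2)) * ‖w‖ ^ k =
      1 / Real.pi * (‖w‖ ^ (k : ℝ) * Real.exp (-‖w‖ ^ (2 : ℝ))) := fun w => by
    rw [Real.rpow_natCast, Real.rpow_ofNat]; ring
  simp only [h2]
  rw [integral_const_mul, h]
  field_simp

theorem integrable_norm_pow_mul_gaussian (k : ℕ) :
    Integrable fun w : ℂ => (1 / Real.pi * Real.exp (-‖w‖ ^ 2)) * ‖w‖ ^ k := by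
  -- A non-integrable function would have integral `0` by convention, but the value of the Gamma
  -- function is positive.
  refine Classical.not_not.1 fun h => ?_
  have h1 := integral_norm_rpow_mul_gaussian k
  rw [integral_undef h] at h1
  exact (Real.Gamma_pos_of_pos (by positivity)).ne h1

instance : IsProbabilityMeasure stdComplexGaussian := by
  refine ⟨?_⟩
  have h0 := integral_norm_rpow_mul_gaussian 0
  have hi := integrable_norm_pow_mul_gaussian 0
  simp only [pow_zero, mul_one] at h0 hi
  rw [stdComplexGaussian, withDensity_apply _ MeasurableSet.univ, Measure.restrict_univ,
    ← ofReal_integral_eq_lintegral_ofReal hi (Filter.Eventually.of_forall fun w => by positivity),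
    h0]
  norm_num

theorem integrable_stdComplexGaussian_iff {f : ℂ → ℂ} :
    Integrable f stdComplexGaussian ↔
      Integrable fun w : ℂ => (1 / Real.pi * Real.exp (-‖w‖ ^ 2)) • f w := by
  rw [stdComplexGaussian, integrable_withDensity_iff_integrable_smul' (by fun_prop) (by simp)]
  refine integrable_congr (Filter.Eventually.of_forall fun w => ?_)
  simp only
  rw [ENNReal.toReal_ofReal (by positivity)]

theorem integrable_monomial_stdComplexGaussian (a b : ℕ) :
    Integrable (fun w : ℂ => w ^ a * star w ^ b) stdComplexGaussian := by
  rw [integrable_stdComplexGaussian_iff]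
  refine (integrable_norm_pow_mul_gaussian (a + b)).mono (by fun_prop)
    (Filter.Eventually.of_forall fun w => le_of_eq ?_)
  simp only [norm_smul, norm_mul, norm_pow, norm_star, norm_norm]
  ring

theorem integral_monomial_stdComplexGaussian (a b : ℕ) :
    ∫ w, w ^ a * star w ^ b ∂stdComplexGaussian = if a = b then (a.factorial : ℂ) else 0 := by
  rw [integral_stdComplexGaussian]
  split_ifs with h
  · subst h
    have h1 : ∀ w : ℂ, (1 / Real.pi * Real.exp (-‖w‖ ^ 2)) • (w ^ a * star w ^ a) =
        (((1 / Real.pi * Real.exp (-‖w‖ ^ 2)) * ‖w‖ ^ (2 * a) : ℝ) : ℂ) := fun w => by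
      rw [← mul_pow, Complex.star_def, Complex.mul_conj, Complex.normSq_eq_norm_sq, Complex.real_smul]
      push_cast
      rw [pow_mul]
    simp only [h1]
    rw [integral_complex_ofReal, integral_norm_rpow_mul_gaussian]
    rw [show (((2 * a : ℕ) : ℝ) + 2) / 2 = a + 1 by push_cast; ring, Real.Gamma_nat_eq_factorial]
    simp
  -- Rotation by an angle with `(a - b) * θ = π` preserves the Gaussian and changes the sign of the
  -- monomial, so the integral equals its negative.
  · set θ : ℝ := Real.pi / ((a : ℝ) - b) with hθ
    have hab : ((a : ℝ) - b) ≠ 0 := sub_ne_zero.2 (by exact_mod_cast h)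
    have hu : (Circle.exp θ : ℂ) ^ a * star (Circle.exp θ : ℂ) ^ b = -1 := by
      rw [Circle.coe_exp, Complex.star_def, ← Complex.exp_conj, ← Complex.exp_nat_mul,
        ← Complex.exp_nat_mul, ← Complex.exp_add, ← Complex.exp_pi_mul_I]
      congr 1
      simp only [map_mul, Complex.conj_ofReal, Complex.conj_I]
      have : (Real.pi : ℂ) = ((a : ℂ) - b) * θ := by
        rw [hθ]; push_cast
        field_simp [show ((a : ℂ) - b) ≠ 0 by exact_mod_cast hab]
      rw [this]; ring
    have hmp := (rotation (Circle.exp θ)).measurePreserving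
    have h2 := hmp.integral_comp (rotation (Circle.exp θ)).toHomeomorph.measurableEmbedding
      fun w : ℂ => (1 / Real.pi * Real.exp (-‖w‖ ^ 2)) • (w ^ a * star w ^ b)
    have h3 : ∀ w : ℂ, (1 / Real.pi * Real.exp (-‖rotation (Circle.exp θ) w‖ ^ 2)) •
        (rotation (Circle.exp θ) w ^ a * star (rotation (Circle.exp θ) w) ^ b) =
        -((1 / Real.pi * Real.exp (-‖w‖ ^ 2)) • (w ^ a * star w ^ b)) := fun w => by
      rw [LinearIsometryEquiv.norm_map, rotation_apply, star_mul', mul_pow, mul_pow,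
        mul_mul_mul_comm, hu, neg_one_mul, smul_neg]
    simp only [h3] at h2
    rw [integral_neg] at h2
    have := h2
    exact self_eq_neg.1 this.symm

theorem charFunDual_stdComplexGaussian (ℓ : StrongDual ℝ ℂ) :
    charFunDual stdComplexGaussian ℓ =
      Complex.exp (-(((ℓ 1) ^ 2 + (ℓ Complex.I) ^ 2 : ℝ) : ℂ) / 4) := by
  set t : ℂ := ⟨ℓ 1, ℓ Complex.I⟩ with ht
  have hℓ : ∀ w : ℂ, ℓ w = inner ℝ t w := fun w => by
    have : w = w.re • (1 : ℂ) + w.im • Complex.I := by simp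
    conv_lhs => rw [this]
    rw [map_add, map_smul, map_smul, Complex.inner]
    simp [ht]
  rw [charFunDual_apply, integral_stdComplexGaussian]
  have h1 : ∀ w : ℂ, (1 / Real.pi * Real.exp (-‖w‖ ^ 2)) • Complex.exp (ℓ w * Complex.I) =
      (1 / Real.pi : ℂ) * Complex.exp (-1 * (‖w‖ : ℂ) ^ 2 + Complex.I * (inner ℝ t w : ℝ)) := by
    intro w
    rw [Complex.exp_add, hℓ, Complex.real_smul]
    push_cast
    rw [mul_comm Complex.I]
    ring_nf
  simp only [h1]
  rw [integral_const_mul, GaussianFourier.integral_cexp_neg_mul_sq_norm_add (by simp)]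
  have h2 : ‖t‖ ^ 2 = (ℓ 1) ^ 2 + (ℓ Complex.I) ^ 2 := by
    rw [← Complex.normSq_eq_norm_sq, Complex.normSq_apply]; ring
  rw [← h2]
  have hpi : (Real.pi : ℂ) ≠ 0 := by exact_mod_cast Real.pi_ne_zero
  simp only [Complex.finrank_real_complex, Complex.I_sq, div_one]
  norm_num

end Gaussian

/-! ### Gaussian vectors with independent coordinates -/

section GaussianVector

variable {X : Type*} [Fintype X]

/-- The law of a family of i.i.d. standard complex Gaussians. -/
noncomputable def gaussianVec (X : Type*) [Fintype X] : Measure (X → ℂ) :=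
  Measure.pi fun _ => stdComplexGaussian

instance : IsProbabilityMeasure (gaussianVec X) := by unfold gaussianVec; infer_instance

theorem charFunDual_gaussianVec [DecidableEq X] (ℓ : StrongDual ℝ (X → ℂ)) :
    charFunDual (gaussianVec X) ℓ = Complex.exp (-((∑ x, ((ℓ (Pi.single x 1)) ^ 2 +
      (ℓ (Pi.single x Complex.I)) ^ 2) : ℝ) : ℂ) / 4) := by
  rw [gaussianVec, charFunDual_pi]
  simp only [charFunDual_stdComplexGaussian]
  rw [← Complex.exp_sum]
  congr 1
  simp only [ContinuousLinearMap.comp_apply, ContinuousLinearMap.single_apply]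
  push_cast
  rw [← Finset.sum_div, Finset.sum_neg_distrib]

/-- The real-linear map with a given real matrix. -/
noncomputable def matMap (p : X → X → ℝ) : (X → ℂ) →L[ℝ] (X → ℂ) :=
  LinearMap.toContinuousLinearMap
    { toFun := fun W x => ∑ y, (p x y : ℂ) * W y
      map_add' := fun W W' => by funext x; simp [mul_add, Finset.sum_add_distrib]
      map_smul' := fun c W => by
        funext x; simp [Finset.mul_sum, mul_left_comm] }

theorem matMap_apply (p : X → X → ℝ) (W : X → ℂ) (x : X) :
    matMap p W x = ∑ y, (p x y : ℂ) * W y := rfl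

/-- For an orthogonal projection `p`, the parts `(1 - p) W` and `p W` of a standard Gaussian vector
are independent, so the second may be replaced by that of an independent copy. This permits
conditioning on the row and column means without conditional expectations. -/
theorem map_mix_gaussianVec (p : X → X → ℝ) (hs : ∀ x y, p x y = p y x)
    (hp : ∀ x z, ∑ y, p x y * p y z = p x z) :
    ((gaussianVec X).prod (gaussianVec X)).map
      (fun q => q.2 - matMap p q.2 + matMap p q.1) = gaussianVec X := by
  classical
  set T : (X → ℂ) × (X → ℂ) →L[ℝ] (X → ℂ) :=
    (ContinuousLinearMap.snd ℝ _ _ - (matMap p).comp (ContinuousLinearMap.snd ℝ _ _)) +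
      (matMap p).comp (ContinuousLinearMap.fst ℝ _ _) with hT
  change ((gaussianVec X).prod (gaussianVec X)).map T = _
  have : IsProbabilityMeasure (((gaussianVec X).prod (gaussianVec X)).map T) :=
    Measure.isProbabilityMeasure_map T.continuous.aemeasurable
  refine Measure.ext_of_charFunDual ?_
  funext ℓ
  rw [charFunDual_map, charFunDual_prod]
  simp only [charFunDual_gaussianVec]
  rw [← Complex.exp_add]
  congr 1
  have hL : ∀ (u : ℂ) x, ℓ (matMap p (Pi.single x u)) = ∑ y, p y x * ℓ (Pi.single y u) := by
    intro u x
    have : matMap p (Pi.single x u) = ∑ y, p y x • (Pi.single y u : X → ℂ) := by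
      funext z
      rw [matMap_apply, Finset.sum_apply]
      simp [Pi.single_apply]
    rw [this, map_sum]
    simp
  have h1 : ∀ (u : ℂ) x, ((ℓ.comp T).comp (ContinuousLinearMap.inl ℝ (X → ℂ) (X → ℂ)))
      (Pi.single x u) = ∑ y, p y x * ℓ (Pi.single y u) := by
    intro u x
    rw [← hL]
    simp [hT]
  have h2 : ∀ (u : ℂ) x, ((ℓ.comp T).comp (ContinuousLinearMap.inr ℝ (X → ℂ) (X → ℂ)))
      (Pi.single x u) = ℓ (Pi.single x u) - ∑ y, p y x * ℓ (Pi.single y u) := by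
    intro u x
    rw [← hL]
    simp [hT]
  -- Pythagoras for the projection: the quadratic forms in the two characteristic functions add up.
  have h3 : ∀ v : X → ℝ, ∑ x, (∑ y, p y x * v y) ^ 2 + ∑ x, (v x - ∑ y, p y x * v y) ^ 2 =
      ∑ x, v x ^ 2 := by
    intro v
    have h4 : ∑ x, (∑ y, p y x * v y) * (∑ y, p y x * v y) = ∑ x, v x * ∑ y, p y x * v y := by
      have : ∀ x, (∑ y, p y x * v y) * (∑ y, p y x * v y) =
          ∑ z, ∑ y, (p y x * p x z) * (v y * v z) := fun x => by
        rw [Finset.sum_mul_sum, Finset.sum_comm]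
        refine Finset.sum_congr rfl fun z _ => Finset.sum_congr rfl fun y _ => ?_
        rw [hs z x]; ring
      simp only [this]
      rw [Finset.sum_comm]
      refine Finset.sum_congr rfl fun z _ => ?_
      rw [Finset.sum_comm, Finset.mul_sum]
      refine Finset.sum_congr rfl fun y _ => ?_
      rw [← Finset.sum_mul, hp]; ring
    rw [← Finset.sum_add_distrib, ← sub_eq_zero, ← Finset.sum_sub_distrib]
    have h5 : ∀ x, (∑ y, p y x * v y) ^ 2 + (v x - ∑ y, p y x * v y) ^ 2 - v x ^ 2 =
        2 * ((∑ y, p y x * v y) * (∑ y, p y x * v y) - v x * ∑ y, p y x * v y) := fun x => by ring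
    simp only [h5]
    rw [← Finset.mul_sum, Finset.sum_sub_distrib, h4, sub_self, mul_zero]
  simp only [h1, h2, Finset.sum_add_distrib]
  rw [← h3 fun x => ℓ (Pi.single x 1), ← h3 fun x => ℓ (Pi.single x Complex.I)]
  push_cast
  ring

end GaussianVector

/-! ### Second moments of homogeneous polynomials in Gaussians -/

section Wick

variable {X : Type*} [Fintype X] [DecidableEq X]

theorem prod_comp_eq_prod_pow {k : ℕ} {M : Type*} [CommMonoid M] (e : Fin k → X) (W : X → M) :
    ∏ p, W (e p) = ∏ v, W v ^ Fintype.card {p // e p = v} := by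
  rw [← Finset.prod_fiberwise' Finset.univ e W]
  simp [Fintype.card_subtype]

theorem exists_perm_comp_eq {k : ℕ} {e e' : Fin k → X}
    (h : ∀ v, Fintype.card {p // e p = v} = Fintype.card {p // e' p = v}) :
    ∃ π : Equiv.Perm (Fin k), e = e' ∘ π := by
  let φ := (Equiv.sigmaFiberEquiv e).symm.trans ((Equiv.sigmaCongrRight fun v =>
    Fintype.equivOfCardEq (h v)).trans (Equiv.sigmaFiberEquiv e'))
  refine ⟨φ, funext fun p => ?_⟩
  simp only [φ, Function.comp_apply, Equiv.trans_apply]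
  exact (((Fintype.equivOfCardEq (h (e p))) ⟨p, rfl⟩).2).symm

theorem integrable_prod_mul_star {k : ℕ} (e e' : Fin k → X) :
    Integrable (fun W : X → ℂ => (∏ p, W (e p)) * star (∏ p, W (e' p))) (gaussianVec X) := by
  simp only [prod_comp_eq_prod_pow, star_prod, star_pow, ← Finset.prod_mul_distrib]
  exact Integrable.fintype_prod fun v => integrable_monomial_stdComplexGaussian _ _

/-- Wick's formula. The integral is the product of the factorials of the multiplicities if these
agree, and zero otherwise; the permutations that carry `e'` to `e` are a coset of a stabilizer of
this very order, or there are none. -/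
theorem integral_prod_mul_star {k : ℕ} (e e' : Fin k → X) :
    ∫ W, (∏ p, W (e p)) * star (∏ p, W (e' p)) ∂(gaussianVec X) =
      ∑ π : Equiv.Perm (Fin k), if e = e' ∘ π then 1 else 0 := by
  simp only [prod_comp_eq_prod_pow, star_prod, star_pow, ← Finset.prod_mul_distrib]
  rw [gaussianVec, integral_fintype_prod_eq_prod
    (fun v w => w ^ Fintype.card {p // e p = v} * star w ^ Fintype.card {p // e' p = v})]
  simp only [integral_monomial_stdComplexGaussian]
  by_cases h : ∀ v, Fintype.card {p // e p = v} = Fintype.card {p // e' p = v}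
  · obtain ⟨π₀, h0⟩ := exists_perm_comp_eq h
    simp only [h, if_true]
    have h1 : ∑ π : Equiv.Perm (Fin k), (if e = e' ∘ π then (1 : ℂ) else 0) =
        ∑ π : Equiv.Perm (Fin k), if e' ∘ π = e' then (1 : ℂ) else 0 := by
      rw [← Equiv.sum_comp (Equiv.mulRight π₀)]
      refine Finset.sum_congr rfl fun π _ => ?_
      have : e = e' ∘ ⇑((Equiv.mulRight π₀) π) ↔ e' ∘ π = e' := by
        rw [h0, Equiv.coe_mulRight, Equiv.Perm.coe_mul, ← Function.comp_assoc]
        constructor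
        · intro h'
          exact (π₀.surjective.injective_comp_right h').symm
        · intro h'; rw [h']
      simp only [this]
    rw [h1, Finset.sum_boole, ← Fintype.card_subtype, DomMulAct.stabilizer_card]
    push_cast
    rfl
  · rw [Finset.sum_eq_zero]
    · push Not at h
      obtain ⟨v, hv⟩ := h
      exact Finset.prod_eq_zero (Finset.mem_univ v) (if_neg hv)
    · intro π _
      refine if_neg fun hπ => h fun v => ?_
      subst hπ
      exact Fintype.card_congr (π.subtypeEquiv fun p => Iff.rfl)

/-- By Wick's formula the second moment is a sum over `k!` permutations of inner products of `f`
with a rearrangement of itself, and each is at most the squared norm. No symmetry of the kernel is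
needed. -/
theorem integral_norm_sq_le {k : ℕ} (f : (Fin k → X) → ℂ) :
    Integrable (fun W : X → ℂ => ‖∑ e, f e * ∏ p, W (e p)‖ ^ 2) (gaussianVec X) ∧
    ∫ W, ‖∑ e, f e * ∏ p, W (e p)‖ ^ 2 ∂(gaussianVec X) ≤ k.factorial * ∑ e, ‖f e‖ ^ 2 := by
  have h1 : ∀ W : X → ℂ, ((‖∑ e, f e * ∏ p, W (e p)‖ ^ 2 : ℝ) : ℂ) =
      ∑ e, ∑ e', f e * star (f e') * ((∏ p, W (e p)) * star (∏ p, W (e' p))) := by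
    intro W
    rw [← Complex.normSq_eq_norm_sq, ← Complex.mul_conj, ← Complex.star_def, star_sum,
      Finset.sum_mul_sum]
    refine Finset.sum_congr rfl fun e _ => Finset.sum_congr rfl fun e' _ => ?_
    rw [star_mul']; ring
  have hint : Integrable (fun W : X → ℂ => ((‖∑ e, f e * ∏ p, W (e p)‖ ^ 2 : ℝ) : ℂ))
      (gaussianVec X) := by
    simp only [h1]
    exact integrable_finset_sum _ fun e _ => integrable_finset_sum _ fun e' _ =>
      (integrable_prod_mul_star e e').const_mul _
  have hint' : Integrable (fun W : X → ℂ => ‖∑ e, f e * ∏ p, W (e p)‖ ^ 2) (gaussianVec X) := by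
    exact hint.re.congr (Filter.Eventually.of_forall fun W => Complex.ofReal_re _)
  refine ⟨hint', ?_⟩
  have h2 : ((∫ W, ‖∑ e, f e * ∏ p, W (e p)‖ ^ 2 ∂(gaussianVec X) : ℝ) : ℂ) =
      ∑ π : Equiv.Perm (Fin k), ∑ e', f (e' ∘ π) * star (f e') := by
    rw [← integral_complex_ofReal]
    simp only [h1]
    rw [integral_finset_sum _ fun e _ => integrable_finset_sum _ fun e' _ =>
      (integrable_prod_mul_star e e').const_mul _]
    simp only [integral_finset_sum _ fun e' _ => (integrable_prod_mul_star _ e').const_mul _,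
      integral_const_mul, integral_prod_mul_star, Finset.mul_sum]
    rw [Finset.sum_comm_cycle]
    refine Finset.sum_congr rfl fun π _ => ?_
    rw [Finset.sum_comm]
    refine Finset.sum_congr rfl fun e' _ => ?_
    simp
  have h3 : ∫ W, ‖∑ e, f e * ∏ p, W (e p)‖ ^ 2 ∂(gaussianVec X) =
      ‖∑ π : Equiv.Perm (Fin k), ∑ e', f (e' ∘ π) * star (f e')‖ := by
    rw [← h2, Complex.norm_real, Real.norm_of_nonneg (integral_nonneg fun _ => by positivity)]
  rw [h3]
  refine (norm_sum_le _ _).trans ((Finset.sum_le_sum (g := fun _ => ∑ e, ‖f e‖ ^ 2)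
    fun π _ => ?_).trans ?_)
  · refine (norm_sum_le _ _).trans ?_
    have h4 : ∑ e', ‖f (e' ∘ π)‖ ^ 2 = ∑ e, ‖f e‖ ^ 2 :=
      (Equiv.arrowCongr π.symm (Equiv.refl X)).sum_comp fun e => ‖f e‖ ^ 2
    have h5 : ∀ e', ‖f (e' ∘ π) * star (f e')‖ ≤ (‖f (e' ∘ π)‖ ^ 2 + ‖f e'‖ ^ 2) / 2 := by
      intro e'
      rw [norm_mul, norm_star]
      nlinarith [sq_nonneg (‖f (e' ∘ π)‖ - ‖f e'‖)]
    refine (Finset.sum_le_sum fun e' _ => h5 e').trans (le_of_eq ?_)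
    rw [← Finset.sum_div, Finset.sum_add_distrib, h4]
    ring
  · simp [Fintype.card_perm]

/-- The homogeneous polynomial with a given kernel. -/
def kerPoly (k : ℕ) (f : List X → ℂ) (W : X → ℂ) : ℂ := listSum k fun e => f e * (e.map W).prod

theorem kerPoly_eq_sum (k : ℕ) (f : List X → ℂ) (W : X → ℂ) :
    kerPoly k f W = ∑ e : Fin k → X, f (List.ofFn e) * ∏ p, W (e p) := by
  rw [kerPoly, listSum.eq_sum_ofFn]
  simp [List.map_ofFn, List.prod_ofFn]

theorem measurable_kerPoly (k : ℕ) (f : List X → ℂ) : Measurable (kerPoly k f) := by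
  simp only [funext (kerPoly_eq_sum k f)]
  fun_prop

theorem integrable_kerPoly_sq (k : ℕ) (f : List X → ℂ) :
    Integrable (fun W => ‖kerPoly k f W‖ ^ 2) (gaussianVec X) := by
  simp only [kerPoly_eq_sum]; exact (integral_norm_sq_le _).1

theorem integral_kerPoly_sq_le (k : ℕ) (f : List X → ℂ) :
    ∫ W, ‖kerPoly k f W‖ ^ 2 ∂(gaussianVec X) ≤
      k.factorial * listSum k fun e => ‖f e‖ ^ 2 := by
  simp only [kerPoly_eq_sum, listSum.eq_sum_ofFn]; exact (integral_norm_sq_le _).2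

/-- The kernel of the polynomial after the substitution of `matMap p W` for `W`. -/
def projKer (p : X → X → ℝ) : ℕ → (List X → ℂ) → List X → ℂ
  | 0, f, _ => f []
  | _ + 1, _, [] => 0
  | k + 1, f, x :: L => ∑ y, (p x y : ℂ) * projKer p k (fun M => f (y :: M)) L

theorem kerPoly_matMap (p : X → X → ℝ) (hs : ∀ x y, p x y = p y x) (k : ℕ) (f : List X → ℂ)
    (W : X → ℂ) : kerPoly k f (matMap p W) = kerPoly k (projKer p k f) W := by
  induction k generalizing f with
  | zero => simp [kerPoly, listSum, projKer]
  | succ k ih =>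
    have h1 : ∀ y, (listSum k fun L => f (y :: L) * ((y :: L).map (matMap p W)).prod) =
        matMap p W y * kerPoly k (projKer p k fun M => f (y :: M)) W := by
      intro y
      rw [← ih, kerPoly, ← listSum.mul_left]
      congr 1; funext L; simp only [List.map_cons, List.prod_cons]; ring
    have h2 : ∀ x, (listSum k fun L => projKer p (k + 1) f (x :: L) * ((x :: L).map W).prod) =
        ∑ y, (p x y : ℂ) * W x * kerPoly k (projKer p k fun M => f (y :: M)) W := by
      intro x
      simp only [kerPoly, ← listSum.mul_left]
      rw [listSum.sum_comm]
      congr 1; funext L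
      simp only [projKer, List.map_cons, List.prod_cons, Finset.sum_mul]
      exact Finset.sum_congr rfl fun y _ => by ring
    rw [kerPoly, kerPoly, listSum, listSum, Finset.sum_congr rfl fun y _ => h1 y,
      Finset.sum_congr rfl fun x _ => h2 x, Finset.sum_comm]
    refine Finset.sum_congr rfl fun y _ => ?_
    rw [← Finset.sum_mul, matMap_apply]
    congr 1
    exact Finset.sum_congr rfl fun x _ => by rw [hs]

/-- The contraction acts on one tensor slot at a time, with the remaining letters fixed. -/
theorem listSum_projKer_sq_le (p : X → X → ℝ) (hp : ∀ W : X → ℂ,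
    ∑ x, ‖∑ y, (p x y : ℂ) * W y‖ ^ 2 ≤ ∑ x, ‖W x‖ ^ 2) (k : ℕ) (f : List X → ℂ) :
    (listSum k fun L => ‖projKer p k f L‖ ^ 2) ≤ listSum k fun L => ‖f L‖ ^ 2 := by
  induction k generalizing f with
  | zero => simp [listSum, projKer]
  | succ k ih =>
    simp only [listSum, projKer]
    rw [listSum.sum_comm]
    refine (listSum.mono fun L _ => hp fun y => projKer p k (fun M => f (y :: M)) L).trans ?_
    rw [← listSum.sum_comm]
    exact Finset.sum_le_sum fun y _ => ih _

theorem contraction_of_idempotent (p : X → X → ℝ) (hs : ∀ x y, p x y = p y x)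
    (hp : ∀ x z, ∑ y, p x y * p y z = p x z) (W : X → ℂ) :
    ∑ x, ‖∑ y, (p x y : ℂ) * W y‖ ^ 2 ≤ ∑ x, ‖W x‖ ^ 2 := by
  set V : X → ℂ := fun x => ∑ y, (p x y : ℂ) * W y with hV
  have hcross : ∑ x, V x * star (V x) = ∑ x, V x * star (W x) := by
    have : ∀ x, V x * star (V x) = ∑ z, ∑ y, ((p z x * p x y : ℝ) : ℂ) * W y * star (W z) := by
      intro x
      simp only [hV, star_sum, Finset.sum_mul_sum]
      rw [Finset.sum_comm]
      refine Finset.sum_congr rfl fun z _ => Finset.sum_congr rfl fun y _ => ?_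
      rw [star_mul', Complex.star_def, Complex.conj_ofReal, hs x z]
      push_cast; ring
    simp only [this]
    rw [Finset.sum_comm]
    refine Finset.sum_congr rfl fun z _ => ?_
    rw [Finset.sum_comm]
    simp only [hV, Finset.sum_mul]
    refine Finset.sum_congr rfl fun y _ => ?_
    rw [← Finset.sum_mul, ← Finset.sum_mul, ← Complex.ofReal_sum, hp]
  have h1 : ∀ u : X → ℂ, ((∑ x, ‖u x‖ ^ 2 : ℝ) : ℂ) = ∑ x, u x * star (u x) := by
    intro u
    push_cast
    refine Finset.sum_congr rfl fun x _ => ?_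
    rw [Complex.star_def, Complex.mul_conj, Complex.normSq_eq_norm_sq]; push_cast; rfl
  have h2 : ∑ x, ‖W x‖ ^ 2 = ∑ x, ‖V x‖ ^ 2 + ∑ x, ‖W x - V x‖ ^ 2 := by
    have h3 : ∑ x, star (V x) * W x = ∑ x, V x * star (V x) := by
      have := congrArg star hcross
      simp only [star_sum, star_mul', star_star] at this
      rw [← this]
      exact Finset.sum_congr rfl fun x _ => mul_comm _ _
    have : ((∑ x, ‖W x‖ ^ 2 : ℝ) : ℂ) = ((∑ x, ‖V x‖ ^ 2 + ∑ x, ‖W x - V x‖ ^ 2 : ℝ) : ℂ) := by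
      rw [Complex.ofReal_add, h1, h1, h1]
      have h4 : ∀ x, (W x - V x) * star (W x - V x) = W x * star (W x) - star (V x) * W x -
          V x * star (W x) + V x * star (V x) := fun x => by rw [star_sub]; ring
      simp only [h4, Finset.sum_add_distrib, Finset.sum_sub_distrib, h3, ← hcross]
      ring
    exact_mod_cast this
  rw [h2]
  have : 0 ≤ ∑ x, ‖W x - V x‖ ^ 2 := Finset.sum_nonneg fun _ _ => by positivity
  linarith

theorem integral_kerPoly_matMap_sq_le (p : X → X → ℝ) (hs : ∀ x y, p x y = p y x)
    (hp : ∀ x z, ∑ y, p x y * p y z = p x z) (k : ℕ) (f : List X → ℂ) :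
    Integrable (fun W => ‖kerPoly k f (matMap p W)‖ ^ 2) (gaussianVec X) ∧
    ∫ W, ‖kerPoly k f (matMap p W)‖ ^ 2 ∂(gaussianVec X) ≤
      k.factorial * listSum k fun e => ‖f e‖ ^ 2 := by
  simp only [kerPoly_matMap p hs]
  refine ⟨integrable_kerPoly_sq _ _, (integral_kerPoly_sq_le _ _).trans ?_⟩
  gcongr
  exact listSum_projKer_sq_le p (contraction_of_idempotent p hs hp) k f

end Wick

/-! ### Norms of the tilted kernels -/

section TiltNorm

variable {X : Type*} [Fintype X] [DecidableEq X]

/-- The coefficients are nonnegative, so the pairs of exponents with sum below `N` can be enlarged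
to a full square, which factors. Working with partial sums avoids any convergence question for the
product. -/
theorem sum_coeff_prod_le {ι : Type*} [DecidableEq ι] (s : Finset ι) (p : ι → PowerSeries ℝ)
    (B : ι → ℝ) {τ : ℝ} (hτ : 0 ≤ τ) (h0 : ∀ i m, 0 ≤ PowerSeries.coeff m (p i))
    (hB : ∀ i N, ∑ m ∈ Finset.range N, PowerSeries.coeff m (p i) * τ ^ m ≤ B i) :
    (∀ m, 0 ≤ PowerSeries.coeff m (∏ i ∈ s, p i)) ∧
      ∀ N, ∑ m ∈ Finset.range N, PowerSeries.coeff m (∏ i ∈ s, p i) * τ ^ m ≤ ∏ i ∈ s, B i := by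
  have hB0 : ∀ i, 0 ≤ B i := fun i => by simpa using hB i 0
  induction s using Finset.induction_on with
  | empty =>
    refine ⟨fun m => by simp [PowerSeries.coeff_one]; split_ifs <;> norm_num, fun N => ?_⟩
    simp only [Finset.prod_empty, PowerSeries.coeff_one, ite_mul, one_mul, zero_mul]
    rw [Finset.sum_ite_eq']
    split_ifs <;> simp
  | insert a s ha ih =>
    obtain ⟨ih0, ihB⟩ := ih
    rw [Finset.prod_insert ha, Finset.prod_insert ha]
    refine ⟨fun m => ?_, fun N => ?_⟩
    · rw [PowerSeries.coeff_mul]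
      exact Finset.sum_nonneg fun q _ => mul_nonneg (h0 _ _) (ih0 _)
    · have h1 : ∀ m, PowerSeries.coeff m (p a * ∏ i ∈ s, p i) * τ ^ m =
          ∑ q ∈ Finset.HasAntidiagonal.antidiagonal m, (PowerSeries.coeff q.1 (p a) * τ ^ q.1) *
            (PowerSeries.coeff q.2 (∏ i ∈ s, p i) * τ ^ q.2) := by
        intro m
        rw [PowerSeries.coeff_mul, Finset.sum_mul]
        refine Finset.sum_congr rfl fun q hq => ?_
        rw [← Finset.HasAntidiagonal.mem_antidiagonal.1 hq, pow_add]; ring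
      simp only [h1]
      rw [Finset.sum_sigma']
      have hinj : ∑ q ∈ (Finset.range N).sigma fun m => Finset.HasAntidiagonal.antidiagonal m,
          (PowerSeries.coeff q.2.1 (p a) * τ ^ q.2.1) *
            (PowerSeries.coeff q.2.2 (∏ i ∈ s, p i) * τ ^ q.2.2) ≤
          ∑ q ∈ Finset.range N ×ˢ Finset.range N, (PowerSeries.coeff q.1 (p a) * τ ^ q.1) *
            (PowerSeries.coeff q.2 (∏ i ∈ s, p i) * τ ^ q.2) := by
        rw [← Finset.sum_image (f := fun q : ℕ × ℕ => (PowerSeries.coeff q.1 (p a) * τ ^ q.1) *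
            (PowerSeries.coeff q.2 (∏ i ∈ s, p i) * τ ^ q.2)) (g := fun q : (_ : ℕ) × ℕ × ℕ => q.2)]
        · refine Finset.sum_le_sum_of_subset_of_nonneg ?_ fun q _ _ =>
            mul_nonneg (mul_nonneg (h0 _ _) (by positivity)) (mul_nonneg (ih0 _) (by positivity))
          intro q hq
          simp only [Finset.mem_image, Finset.mem_sigma, Finset.mem_range,
            Finset.HasAntidiagonal.mem_antidiagonal] at hq
          obtain ⟨⟨m, q'⟩, ⟨hm, hq'⟩, rfl⟩ := hq
          simp only [Finset.mem_product, Finset.mem_range]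
          simp only at hq' hm ⊢
          omega
        · rintro ⟨m, q⟩ hm ⟨m', q'⟩ hm' h
          simp only [Finset.coe_sigma, Set.mem_sigma_iff, Finset.mem_coe,
            Finset.HasAntidiagonal.mem_antidiagonal] at hm hm'
          simp only at h
          subst h
          obtain rfl : m = m' := hm.2.symm.trans hm'.2
          rfl
      refine hinj.trans ?_
      rw [Finset.sum_product]
      dsimp only
      rw [← Finset.sum_mul_sum]
      exact mul_le_mul (hB a N) (ihB N)
        (Finset.sum_nonneg fun m _ => mul_nonneg (ih0 m) (by positivity)) (hB0 a)

/-- A Chernoff bound: one coefficient of a series with nonnegative coefficients is at most its value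
at `τ` divided by `τ ^ k`. -/
theorem listSum_profWeight_le (φ : X → ℕ → ℝ) (B : X → ℝ) {τ : ℝ} (hτ : 0 < τ)
    (h0 : ∀ v m, 0 ≤ φ v m) (hB : ∀ v, HasSum (fun m => φ v m * (τ ^ m / m.factorial)) (B v))
    (k : ℕ) : listSum k (profWeight φ) ≤ k.factorial * (τ ^ k)⁻¹ * ∏ v, B v := by
  have hc : ∀ v m, PowerSeries.coeff m (expSeries (φ v)) = φ v m / m.factorial := fun v m => by
    simp [expSeries]
  have h1 := sum_coeff_prod_le Finset.univ (fun v => expSeries (φ v)) B hτ.le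
    (fun v m => by rw [hc]; exact div_nonneg (h0 v m) (by positivity)) (fun v N => by
      refine le_trans (le_of_eq ?_) (sum_le_hasSum (Finset.range N) (fun m _ =>
        mul_nonneg (h0 v m) (by positivity)) (hB v))
      refine Finset.sum_congr rfl fun m _ => ?_
      rw [hc]; ring)
  have h2 := h1.2 (k + 1)
  rw [Finset.sum_range_succ] at h2
  have h3 : 0 ≤ ∑ m ∈ Finset.range k,
      PowerSeries.coeff m (∏ v, expSeries (φ v)) * τ ^ m :=
    Finset.sum_nonneg fun m _ => mul_nonneg (h1.1 m) (by positivity)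
  rw [listSum_profWeight, mul_assoc]
  refine mul_le_mul_of_nonneg_left ?_ (by positivity)
  rw [inv_mul_eq_div, le_div_iff₀ (by positivity)]
  linarith

/-- Apart from the factor `exp τ`, this is the mean of `‖c - m * a‖ ^ 2` for a Poisson variable `m`
with mean and variance `τ`. -/
theorem hasSum_norm_sub_sq (c a : ℂ) (τ : ℝ) :
    HasSum (fun m : ℕ => ‖c - m * a‖ ^ 2 * (τ ^ m / m.factorial))
      (Real.exp τ * (‖c - τ * a‖ ^ 2 + τ * ‖a‖ ^ 2)) := by
  have e0 : HasSum (fun m : ℕ => τ ^ m / m.factorial) (Real.exp τ) := by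
    rw [Real.exp_eq_exp_ℝ]; exact NormedSpace.expSeries_div_hasSum_exp τ
  have e1 : HasSum (fun m : ℕ => (m : ℝ) * (τ ^ m / m.factorial)) (τ * Real.exp τ) := by
    rw [← hasSum_nat_add_iff' 1]
    simp only [Finset.range_one, Finset.sum_singleton, Nat.cast_zero, zero_mul, sub_zero]
    convert! e0.mul_left τ using 1
    funext m
    rw [Nat.factorial_succ, pow_succ' τ]; push_cast
    field_simp
  have e2 : HasSum (fun m : ℕ => (m : ℝ) ^ 2 * (τ ^ m / m.factorial))
      (τ * (τ * Real.exp τ + Real.exp τ)) := by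
    rw [← hasSum_nat_add_iff' 1]
    simp only [Finset.range_one, Finset.sum_singleton, Nat.cast_zero, zero_pow two_ne_zero,
      zero_mul, sub_zero]
    convert! (e1.add e0).mul_left τ using 1
    funext m
    rw [Nat.factorial_succ, pow_succ' τ]; push_cast
    field_simp
  have hn : ∀ t : ℝ, ‖c - t * a‖ ^ 2 =
      ‖c‖ ^ 2 - 2 * t * (c.re * a.re + c.im * a.im) + t ^ 2 * ‖a‖ ^ 2 := fun t => by
    simp only [← Complex.normSq_eq_norm_sq, Complex.normSq_apply]
    simp; ring
  convert! ((e0.mul_left (‖c‖ ^ 2)).sub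
    (e1.mul_left (2 * (c.re * a.re + c.im * a.im)))).add (e2.mul_left (‖a‖ ^ 2)) using 1
  · funext m
    have := hn m
    push_cast at this
    rw [this]; ring
  · rw [hn]; ring

/-- The term `τ` on the left stems from `exp τ`. The first-order terms `-2τ Re a + τ‖a‖² + τ`
combine to `τ‖a - 1‖²`, and only the cross term with `y` is estimated, by `0 ≤ τ‖y + (a - 1)‖²`. The
cancellation of `τ` at `a = 1` is the gain from tilting. -/
theorem tilt_factor_le (y a : ℂ) {τ : ℝ} (hτ : 0 ≤ τ) :
    ‖1 + y - τ * a‖ ^ 2 + τ * ‖a‖ ^ 2 - 1 + τ ≤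
      2 * τ * ‖a - 1‖ ^ 2 + τ ^ 2 * ‖a‖ ^ 2 + 2 * (1 - τ) * y.re + (1 + τ) * ‖y‖ ^ 2 := by
  have h := mul_nonneg hτ (sq_nonneg (y.re + (a.re - 1)))
  have h' := mul_nonneg hτ (sq_nonneg (y.im + a.im))
  simp only [← Complex.normSq_eq_norm_sq, Complex.normSq_apply]
  simp
  nlinarith

/-- The tilted version of `slotPoly`. -/
noncomputable def tiltPoly (a x : X → ℂ) (L : List X) : Polynomial ℂ :=
  profWeight (fun v m => tilt m (pairW (Polynomial.C 1 + Polynomial.C (x v) * Polynomial.X)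
    (Polynomial.C (a v)))) L

theorem norm_eval_tiltPoly_sq (a x : X → ℂ) (L : List X) (s : ℂ) :
    ‖(tiltPoly a x L).eval s‖ ^ 2 =
      profWeight (fun v m => ‖1 + x v * s - m * a v‖ ^ 2) L := by
  rw [tiltPoly, profWeight, Polynomial.eval_prod, norm_prod, ← Finset.prod_pow]
  refine Finset.prod_congr rfl fun v _ => ?_
  rw [tilt_pairW]
  simp

/-- After `1 + u ≤ exp u` in each factor, the terms linear in `x` add up to a multiple of `Re (s * ∑
x)`. Therefore only the norm of the sum of `x` enters in first order, and otherwise just the sums of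
squares. -/
theorem listSum_norm_eval_tiltPoly_le (a x : X → ℂ) {D θ r τ : ℝ} (hτ : 0 < τ) (hτ1 : τ ≤ 1)
    (hr : 0 ≤ r) (ha : ∀ v, ‖a v‖ ≤ 2) (haD : ∑ v, ‖a v - 1‖ ^ 2 ≤ D)
    (hxD : ∑ v, ‖x v‖ ^ 2 ≤ D) (hx : ‖∑ v, x v‖ ≤ θ) (k : ℕ) {s : ℂ} (hs : ‖s‖ = r) :
    (listSum k fun L => ‖(tiltPoly a x L).eval s‖ ^ 2) ≤ k.factorial * (τ ^ k)⁻¹ *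
      Real.exp (2 * τ * D + 4 * τ ^ 2 * Fintype.card X + 2 * r * θ + 2 * r ^ 2 * D) := by
  simp only [norm_eval_tiltPoly_sq]
  refine (listSum_profWeight_le _ (fun v => Real.exp τ * (‖1 + x v * s - τ * a v‖ ^ 2 +
    τ * ‖a v‖ ^ 2)) hτ (fun v m => by positivity) (fun v => hasSum_norm_sub_sq _ _ _) k).trans ?_
  refine mul_le_mul_of_nonneg_left ?_ (by positivity)
  have h1 : ∀ v, Real.exp τ * (‖1 + x v * s - τ * a v‖ ^ 2 + τ * ‖a v‖ ^ 2) ≤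
      Real.exp (2 * τ * ‖a v - 1‖ ^ 2 + τ ^ 2 * ‖a v‖ ^ 2 + 2 * (1 - τ) * (x v * s).re +
        (1 + τ) * ‖x v * s‖ ^ 2) := by
    intro v
    have h2 : ‖1 + x v * s - τ * a v‖ ^ 2 + τ * ‖a v‖ ^ 2 ≤
        Real.exp (‖1 + x v * s - τ * a v‖ ^ 2 + τ * ‖a v‖ ^ 2 - 1) := by
      have := Real.add_one_le_exp (‖1 + x v * s - τ * a v‖ ^ 2 + τ * ‖a v‖ ^ 2 - 1)
      linarith
    refine (mul_le_mul_of_nonneg_left h2 (Real.exp_pos _).le).trans ?_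
    rw [← Real.exp_add]
    refine Real.exp_le_exp.2 ?_
    have := tilt_factor_le (x v * s) (a v) hτ.le
    linarith
  refine (Finset.prod_le_prod (fun v _ => by positivity) fun v _ => h1 v).trans ?_
  rw [← Real.exp_sum]
  refine Real.exp_le_exp.2 ?_
  simp only [Finset.sum_add_distrib, ← Finset.mul_sum]
  have h3 : ∑ v, ‖a v‖ ^ 2 ≤ 4 * Fintype.card X := by
    refine (Finset.sum_le_sum (g := fun _ => (4 : ℝ)) fun v _ => ?_).trans
      (by simp [mul_comm])
    nlinarith [ha v, norm_nonneg (a v)]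
  have h4 : ∑ v, (x v * s).re ≤ r * θ := by
    rw [← Complex.re_sum, ← Finset.sum_mul]
    refine (Complex.re_le_norm _).trans ?_
    rw [norm_mul, hs, mul_comm]
    gcongr
  have h4' : -(r * θ) ≤ r * θ := by
    have : 0 ≤ θ := (norm_nonneg _).trans hx
    nlinarith [mul_nonneg hr this]
  have h5 : ∑ v, ‖x v * s‖ ^ 2 ≤ r ^ 2 * D := by
    simp only [norm_mul, mul_pow, hs]
    rw [← Finset.sum_mul, mul_comm]
    gcongr
  have h6 : 0 ≤ ∑ v, ‖x v * s‖ ^ 2 := Finset.sum_nonneg fun _ _ => by positivity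
  have h7 : τ ^ 2 * ∑ v, ‖a v‖ ^ 2 ≤ τ ^ 2 * (4 * Fintype.card X) := by gcongr
  have h8 : 2 * τ * ∑ v, ‖a v - 1‖ ^ 2 ≤ 2 * τ * D := by gcongr
  have h9 : 2 * (1 - τ) * ∑ v, (x v * s).re ≤ 2 * (1 - τ) * (r * θ) := by
    have : 0 ≤ 2 * (1 - τ) := by linarith
    gcongr
  have h10 : (1 + τ) * ∑ v, ‖x v * s‖ ^ 2 ≤ 2 * (r ^ 2 * D) :=
    mul_le_mul (by linarith) h5 h6 (by norm_num)
  have h11 : 2 * (1 - τ) * (r * θ) ≤ 2 * (r * θ) := by nlinarith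
  linarith

theorem norm_coeff_sq_le_circleAverage (p : Polynomial ℂ) {r : ℝ} (l : ℕ) :
    r ^ (2 * l) * ‖p.coeff l‖ ^ 2 ≤
      Real.circleAverage (fun s => ‖p.eval ((r : ℂ) * s)‖ ^ 2) 0 1 := by
  have h := (p.comp (Polynomial.C (r : ℂ) * Polynomial.X)).sum_sq_norm_coeff_eq_circleAverage
  simp only [Polynomial.eval_comp, Polynomial.eval_mul, Polynomial.eval_C, Polynomial.eval_X] at h
  rw [← h]
  have h1 : r ^ (2 * l) * ‖p.coeff l‖ ^ 2 = ‖p.coeff l * (r : ℂ) ^ l‖ ^ 2 := by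
    rw [norm_mul, norm_pow, Complex.norm_real, mul_pow, ← pow_mul, mul_comm l 2, pow_mul, pow_mul,
      Real.norm_eq_abs, sq_abs]
    ring
  rw [h1, ← Polynomial.comp_C_mul_X_coeff]
  by_cases hl : l ∈ (p.comp (Polynomial.C (r : ℂ) * Polynomial.X)).support
  · exact Finset.single_le_sum
      (f := fun i => ‖(p.comp (Polynomial.C (r : ℂ) * Polynomial.X)).coeff i‖ ^ 2)
      (fun i _ => by positivity) hl
  · rw [Polynomial.notMem_support_iff.1 hl]
    simp
    exact Finset.sum_nonneg fun _ _ => by positivity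

/-- Parseval on the circle of radius `r` extracts the coefficient for each list; the sum over the
lists is then taken inside the average, where the bound is uniform on the circle. -/
theorem listSum_norm_coeff_tiltPoly_le (a x : X → ℂ) {D θ r τ : ℝ} (hτ : 0 < τ) (hτ1 : τ ≤ 1)
    (hr : 0 < r) (ha : ∀ v, ‖a v‖ ≤ 2) (haD : ∑ v, ‖a v - 1‖ ^ 2 ≤ D)
    (hxD : ∑ v, ‖x v‖ ^ 2 ≤ D) (hx : ‖∑ v, x v‖ ≤ θ) (k l : ℕ) :
    (listSum k fun L => ‖(tiltPoly a x L).coeff l‖ ^ 2) ≤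
      (r ^ (2 * l))⁻¹ * (k.factorial * (τ ^ k)⁻¹ *
      Real.exp (2 * τ * D + 4 * τ ^ 2 * Fintype.card X + 2 * r * θ + 2 * r ^ 2 * D)) := by
  rw [inv_mul_eq_div, le_div_iff₀ (by positivity), mul_comm, ← listSum.mul_left]
  have hci : ∀ L : List X, CircleIntegrable
      (fun s => ‖(tiltPoly a x L).eval ((r : ℂ) * s)‖ ^ 2) 0 1 := fun L =>
    ContinuousOn.circleIntegrable zero_le_one (by fun_prop)
  refine (listSum.mono fun L _ => norm_coeff_sq_le_circleAverage (tiltPoly a x L) l).trans ?_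
  rw [listSum.eq_sum_ofFn, ← Real.circleAverage_fun_sum fun e _ => hci _]
  refine Real.circleAverage_mono_on_of_le_circle ?_ fun s hs => ?_
  · exact CircleIntegrable.fun_sum _ fun e _ => hci _
  · rw [← listSum.eq_sum_ofFn k fun L => ‖(tiltPoly a x L).eval ((r : ℂ) * s)‖ ^ 2]
    refine listSum_norm_eval_tiltPoly_le a x hτ hτ1 hr.le ha haD hxD hx k ?_
    rw [norm_mul, Complex.norm_real, Real.norm_of_nonneg hr.le]
    simp at hs
    rw [hs, mul_one]

end TiltNorm

/-! ### Expansion of the centred permanent -/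

section Centred

variable {X : Type*} [Fintype X] [DecidableEq X]

theorem slotSum_eq_zero {R : Type*} [CommSemiring R] {l : ℕ} {x : X → R} {L : List X}
    (h : Fintype.card X < L.length + l) : slotSum l x L = 0 := by
  rw [slotSum, listSum.congr_of_length (G := fun _ => 0)]
  · rw [listSum.eq_sum_ofFn]; simp
  · intro M hM
    refine if_neg fun hn => ?_
    have := hn.length_le_card
    rw [List.length_append, hM] at this
    omega

theorem listSum_coeff_slotPoly (V : X → X → ℂ) (hV : ∀ j, ∑ i, V i j = 0) (a x : X → ℂ)
    (l : ℕ) (M : List X) :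
    listSum M.length (fun L => (slotPoly a x L).coeff l * (List.zipWith V L M).prod) =
      listSum M.length fun L => (tiltPoly a x L).coeff l * (List.zipWith V L M).prod := by
  have h := listSum_tilt (R := Polynomial ℂ) (fun i j => Polynomial.C (V i j))
    (fun j => by rw [← map_sum, hV, map_zero])
    (fun v => pairW (Polynomial.C 1 + Polynomial.C (x v) * Polynomial.X) (Polynomial.C (a v))) M
  have hz : ∀ L : List X, (List.zipWith (fun i j => Polynomial.C (V i j)) L M).prod =
      Polynomial.C (List.zipWith V L M).prod := by
    intro L
    rw [map_list_prod, List.map_zipWith]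
  simp only [hz] at h
  have h2 := congrArg (fun p => Polynomial.coeff p l) h
  rw [← Polynomial.lcoeff_apply, ← Polynomial.lcoeff_apply, ← LinearMap.toAddMonoidHom_coe,
    listSum.map_hom, listSum.map_hom] at h2
  simpa only [LinearMap.toAddMonoidHom_coe, Polynomial.lcoeff_apply, Polynomial.coeff_mul_C,
    slotPoly, tiltPoly] using h2

/-- The kernel of the terms of the centred permanent. -/
noncomputable def centKer (a x b w : X → ℂ) (l : ℕ) (e : List (X × X)) : ℂ :=
  (tiltPoly a x (e.map Prod.fst)).coeff l * (tiltPoly b w (e.map Prod.snd)).coeff l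

theorem zipWith_flip_prod (V : X → X → ℂ) (L M : List X) :
    (List.zipWith V L M).prod = (List.zipWith (fun j i => V i j) M L).prod := by
  rw [List.zipWith_comm]

theorem zipWith_map_fst_snd (V : X × X → ℂ) (e : List (X × X)) :
    (List.zipWith (fun i j => V (i, j)) (e.map Prod.fst) (e.map Prod.snd)).prod =
      (e.map V).prod := by
  induction e with
  | nil => rfl
  | cons p e ih => simp [ih]

theorem prod_zipWith_smul (z : ℂ) (a b : X → ℂ) (V : X → X → ℂ) {L M : List X}
    (h : L.length = M.length) :
    (List.zipWith (fun i j => z * (a i * b j * V i j)) L M).prod =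
      z ^ L.length * ((L.map a).prod * (M.map b).prod * (List.zipWith V L M).prod) := by
  induction L generalizing M with
  | nil =>
    obtain rfl : M = [] := List.length_eq_zero_iff.1 h.symm
    simp
  | cons i L ih =>
    rcases M with _ | ⟨j, M⟩
    · simp at h
    · simp only [List.zipWith_cons_cons, List.prod_cons, List.map_cons, List.length_cons,
        ih (by simpa using h), pow_succ]
      ring

/-- The matching kernel is tilted twice: in the row letters, with the column letters fixed, because
the columns of `V` sum to zero, and conversely. Each slot sum gives a factor `l!`, which leaves `l!`
of `(l!)² / l!`. -/
theorem centred_perm_expansion (z : ℂ) (a x b w : X → ℂ) (V : X × X → ℂ)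
    (hV1 : ∀ j, ∑ i, V (i, j) = 0) (hV2 : ∀ i, ∑ j, V (i, j) = 0) :
    ∑ σ : Equiv.Perm X, ∏ v, (1 + x v * w (σ v) + z * (a v * b (σ v) * V (v, σ v))) =
      ∑ k ∈ Finset.range (Fintype.card X + 1), ∑ l ∈ Finset.range (Fintype.card X + 1),
        if k + l ≤ Fintype.card X then
          (l.factorial : ℂ) / k.factorial * ((Fintype.card X - (k + l)).factorial : ℂ) * z ^ k *
            kerPoly k (centKer a x b w l) V else 0 := by
  rw [sum_perm_prod_eq (fun i j => z * (a i * b j * V (i, j))) x w]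
  refine Finset.sum_congr rfl fun k _ => Finset.sum_congr rfl fun l _ => ?_
  have hlf : (l.factorial : ℂ) ≠ 0 := by exact_mod_cast l.factorial_ne_zero
  have hkf : (k.factorial : ℂ) ≠ 0 := by exact_mod_cast k.factorial_ne_zero
  split_ifs with hkl
  · have h1 : (listSum k fun L => listSum k fun M =>
        (List.zipWith (fun i j => z * (a i * b j * V (i, j))) L M).prod *
          (slotSum l x L * slotSum l w M)) =
        z ^ k * ((l.factorial : ℂ) ^ 2 * listSum k fun L => listSum k fun M =>
          (slotPoly a x L).coeff l * ((slotPoly b w M).coeff l *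
            (List.zipWith (fun i j => V (i, j)) L M).prod)) := by
      rw [← mul_assoc, ← listSum.mul_left]
      refine listSum.congr_of_length (R := ℂ) fun L hL => ?_
      rw [← listSum.mul_left]
      refine listSum.congr_of_length (R := ℂ) fun M hM => ?_
      rw [prod_zipWith_smul z a b (fun i j => V (i, j)) (hL.trans hM.symm), hL]
      have e1 := coeff_slotPoly a x L l
      have e2 := coeff_slotPoly b w M l
      calc _ = z ^ k * (List.zipWith (fun i j => V (i, j)) L M).prod *
            (((L.map a).prod * slotSum l x L) * ((M.map b).prod * slotSum l w M)) := by ring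
        _ = _ := by rw [← e1, ← e2]; ring
    have h2 : (listSum k fun L => listSum k fun M =>
          (slotPoly a x L).coeff l * ((slotPoly b w M).coeff l *
            (List.zipWith (fun i j => V (i, j)) L M).prod)) = kerPoly k (centKer a x b w l) V := by
      have h3 : ∀ L : List X, L.length = k → (listSum k fun M =>
          (slotPoly a x L).coeff l * ((slotPoly b w M).coeff l *
            (List.zipWith (fun i j => V (i, j)) L M).prod)) = listSum k fun M =>
          (tiltPoly b w M).coeff l * ((slotPoly a x L).coeff l *
            (List.zipWith (fun i j => V (i, j)) L M).prod) := by
        intro L hL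
        subst hL
        have := listSum_coeff_slotPoly (fun j i => V (i, j)) hV2 b w l L
        simp only [← zipWith_flip_prod (fun i j => V (i, j))] at this
        rw [listSum.mul_left, this, ← listSum.mul_left]
        congr 1; funext M; ring
      refine (listSum.congr_of_length (R := ℂ) h3).trans ?_
      rw [listSum.comm]
      have h4 : ∀ M : List X, M.length = k → (listSum k fun L =>
          (tiltPoly b w M).coeff l * ((slotPoly a x L).coeff l *
            (List.zipWith (fun i j => V (i, j)) L M).prod)) = listSum k fun L =>
          (tiltPoly a x L).coeff l * (tiltPoly b w M).coeff l *
            (List.zipWith (fun i j => V (i, j)) L M).prod := by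
        intro M hM
        subst hM
        have := listSum_coeff_slotPoly (fun i j => V (i, j)) hV1 a x l M
        rw [listSum.mul_left, this, ← listSum.mul_left]
        congr 1; funext L; ring
      refine (listSum.congr_of_length (R := ℂ) h4).trans ?_
      rw [listSum.comm, listSum.prod_eq, kerPoly]
      simp only [zipWith_map_fst_snd, centKer]
    rw [h1, h2]
    field_simp
  · have h0 : ∀ L : List X, L.length = k → slotSum l x L = 0 := fun L hL =>
      slotSum_eq_zero (by omega)
    rw [listSum.congr_of_length (G := fun _ => (0 : ℂ))]
    · rw [listSum.eq_sum_ofFn]; simp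
    · intro L hL
      simp only [h0 L hL, zero_mul, mul_zero]
      rw [listSum.eq_sum_ofFn]; simp

theorem listSum_norm_centKer (a x b w : X → ℂ) (k l : ℕ) :
    (listSum k fun e => ‖centKer a x b w l e‖ ^ 2) =
      (listSum k fun L => ‖(tiltPoly a x L).coeff l‖ ^ 2) *
        listSum k fun M => ‖(tiltPoly b w M).coeff l‖ ^ 2 := by
  have := listSum.prod_eq (X := X) (Y := X) k fun L M =>
    ‖(tiltPoly a x L).coeff l‖ ^ 2 * ‖(tiltPoly b w M).coeff l‖ ^ 2
  simp only [centKer, norm_mul, mul_pow]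
  rw [← this]
  simp only [listSum.mul_left, listSum.mul_right]

/-! ### Second moments of the terms -/

/-- Factor by factor, `n * (q - i) ≤ (n - i) * q`, so `n ^ q * q!` is at most the falling factorial
times `q ^ q`; moreover `q ^ q / q! ≤ exp q`. -/
theorem inv_descFactorial_le {n q : ℕ} (hq : q ≤ n) (hq1 : 1 ≤ q) :
    ((n - q).factorial : ℝ) / n.factorial ≤ (Real.exp 1 / n) ^ q := by
  have hn : (0 : ℝ) < n := by exact_mod_cast (by omega : 0 < n)
  have hqp : (0 : ℝ) < q := by exact_mod_cast hq1
  have h1 : (n : ℝ) ^ q * q.factorial ≤ (n.descFactorial q : ℝ) * q ^ q := by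
    have h2 : ∀ m : ℕ, (q : ℕ) ≤ m → (m.descFactorial q : ℝ) = ∏ i ∈ Finset.range q, ((m : ℝ) - i) := by
      intro m hm
      rw [Nat.descFactorial_eq_prod_range]
      push_cast
      refine Finset.prod_congr rfl fun i hi => ?_
      rw [Nat.cast_sub ((Finset.mem_range.1 hi).le.trans hm)]
    rw [← Nat.descFactorial_self q, h2 n hq, h2 q le_rfl]
    have h3 : ∀ t : ℝ, t ^ q = ∏ _i ∈ Finset.range q, t := fun t => by simp
    rw [h3, h3, ← Finset.prod_mul_distrib, ← Finset.prod_mul_distrib]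
    refine Finset.prod_le_prod (fun i hi => ?_) fun i hi => ?_
    · have : (i : ℝ) ≤ q := by exact_mod_cast (Finset.mem_range.1 hi).le
      exact mul_nonneg hn.le (by linarith)
    · have h4 : (q : ℝ) ≤ n := by exact_mod_cast hq
      have h5 : (0 : ℝ) ≤ i := by positivity
      nlinarith
  have h6 : (q : ℝ) ^ q / q.factorial ≤ Real.exp q := Real.pow_div_factorial_le_exp _ hqp.le _
  have h7 : ((n - q).factorial : ℝ) * n.descFactorial q = n.factorial := by
    exact_mod_cast Nat.factorial_mul_descFactorial hq
  have hqf : (0 : ℝ) < q.factorial := by exact_mod_cast q.factorial_pos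
  have hnf : (0 : ℝ) < n.factorial := by exact_mod_cast n.factorial_pos
  have hnq : (0 : ℝ) < (n - q).factorial := by exact_mod_cast (n - q).factorial_pos
  rw [div_pow, ← Real.exp_nat_mul, mul_one, div_le_div_iff₀ hnf (by positivity), ← h7]
  rw [div_le_iff₀ hqf] at h6
  have h8 : (n : ℝ) ^ q * q.factorial ≤ (n.descFactorial q : ℝ) * Real.exp q * q.factorial := by
    have : (0 : ℝ) ≤ n.descFactorial q := by positivity
    nlinarith
  have h9 := le_of_mul_le_mul_right h8 hqf
  nlinarith

/-- The parameters will be `τ = 1/T`, and `r = 1/A` for rows, `r = 1/B` for columns. The summands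
`D/q` and `√(n/q)` of `T` bring `τD` and `τ²n` down to order `q`, and `√(D/q)` does the same for
`r²D`. Only `B` needs the additional `D/q`, because the sum of the column weights is bounded by `D`
and not zero. -/
theorem exists_saddle_params {n q D : ℝ} (hq1 : 1 ≤ q) (hqn : q ≤ n) (hD : 1 ≤ D) :
    ∃ T A B : ℝ, 1 ≤ T ∧ 0 < A ∧ 0 < B ∧
      2 * T⁻¹ * D + 4 * (T ^ 2)⁻¹ * n + 2 * A⁻¹ * 0 + 2 * (A ^ 2)⁻¹ * D ≤ 8 * q ∧
      2 * T⁻¹ * D + 4 * (T ^ 2)⁻¹ * n + 2 * B⁻¹ * D + 2 * (B ^ 2)⁻¹ * D ≤ 10 * q ∧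
      q * T ^ 2 ≤ 2 * D ^ 2 + 2 * n ∧ q ^ 2 * (A ^ 2 * B ^ 2) ≤ 2 * D ^ 3 + 2 * D ^ 2 := by
  have hq0 : 0 < q := by linarith
  have hn0 : 0 < n := by linarith
  have hD0 : 0 < D := by linarith
  have hsq : √(n / q) ^ 2 = n / q := Real.sq_sqrt (by positivity)
  have hAsq : √(D / q) ^ 2 = D / q := Real.sq_sqrt (by positivity)
  have hs0 : 1 ≤ √(n / q) := by rw [Real.one_le_sqrt, one_le_div hq0]; exact hqn
  have hA0 : 0 < √(D / q) := Real.sqrt_pos.2 (by positivity)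
  have hDq : 0 < D / q := by positivity
  have hDqq : D / q * q = D := by field_simp
  have eT1 : (D / q + √(n / q))⁻¹ * D ≤ q := by
    rw [inv_mul_le_iff₀ (by linarith), add_mul, hDqq]
    have : 0 ≤ √(n / q) * q := by positivity
    linarith
  have eT2 : ((D / q + √(n / q)) ^ 2)⁻¹ * n ≤ q := by
    rw [inv_mul_le_iff₀ (by positivity)]
    have : √(n / q) ^ 2 ≤ (D / q + √(n / q)) ^ 2 :=
      pow_le_pow_left₀ (by positivity) (by linarith) 2
    rwa [hsq, div_le_iff₀ hq0] at this
  have eA : (√(D / q) ^ 2)⁻¹ * D ≤ q := by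
    rw [hAsq]
    exact le_of_eq (by field_simp)
  have eB1 : (D / q + √(D / q))⁻¹ * D ≤ q := by
    rw [inv_mul_le_iff₀ (by linarith), add_mul, hDqq]
    have : 0 ≤ √(D / q) * q := by positivity
    linarith
  have eB2 : ((D / q + √(D / q)) ^ 2)⁻¹ * D ≤ q := by
    refine le_trans ?_ eA
    gcongr
    linarith
  refine ⟨D / q + √(n / q), √(D / q), D / q + √(D / q), by linarith, hA0, by linarith, ?_, ?_,
    ?_, ?_⟩
  · linarith
  · linarith
  · have : (D / q + √(n / q)) ^ 2 ≤ 2 * (D / q) ^ 2 + 2 * (n / q) := by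
      nlinarith [sq_nonneg (D / q - √(n / q))]
    calc q * (D / q + √(n / q)) ^ 2 ≤ q * (2 * (D / q) ^ 2 + 2 * (n / q)) := by gcongr
      _ = 2 * D ^ 2 / q + 2 * n := by field_simp
      _ ≤ 2 * D ^ 2 + 2 * n := by
        have : 2 * D ^ 2 / q ≤ 2 * D ^ 2 := div_le_self (by positivity) hq1
        linarith
  · have : (D / q + √(D / q)) ^ 2 ≤ 2 * (D / q) ^ 2 + 2 * (D / q) := by
      have : (D / q + √(D / q)) ^ 2 ≤ 2 * (D / q) ^ 2 + 2 * √(D / q) ^ 2 := by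
        nlinarith [sq_nonneg (D / q - √(D / q))]
      rwa [hAsq] at this
    calc q ^ 2 * (√(D / q) ^ 2 * (D / q + √(D / q)) ^ 2)
        ≤ q ^ 2 * (D / q * (2 * (D / q) ^ 2 + 2 * (D / q))) := by
          rw [hAsq]; gcongr
      _ = 2 * D ^ 3 / q + 2 * D ^ 2 := by field_simp
      _ ≤ _ := by
        have : 2 * D ^ 3 / q ≤ 2 * D ^ 3 := div_le_self (by positivity) hq1
        linarith

theorem factorial_le_pow_real {k q : ℕ} (h : k ≤ q) : (k.factorial : ℝ) ≤ (q : ℝ) ^ k := by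
  exact_mod_cast (Nat.factorial_le_pow k).trans (Nat.pow_le_pow_left h k)

theorem moment_bound_aux {n k l : ℕ} (hkl : k + l ≤ n) (h1 : 1 ≤ k + l) {E t T A B : ℝ} :
    ((l.factorial : ℝ) / k.factorial * ((n - (k + l)).factorial / n.factorial) * t ^ k) ^ 2 *
      (k.factorial * ((A ^ (2 * l) * (k.factorial * T ^ k * E)) *
      (B ^ (2 * l) * (k.factorial * T ^ k * E)))) ≤
    ((Real.exp 1 / n) ^ (k + l) * (Real.exp 1 / n) ^ (k + l) * (E * E)) *
      (t ^ 2 * ((k + l : ℕ) * T ^ 2)) ^ k * ((k + l : ℕ) ^ 2 * (A ^ 2 * B ^ 2)) ^ l := by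
  have hf := inv_descFactorial_le hkl h1
  have hk := factorial_le_pow_real (Nat.le_add_right k l)
  have hl := factorial_le_pow_real (Nat.le_add_left l k)
  have hkf : (k.factorial : ℝ) ≠ 0 := by exact_mod_cast k.factorial_ne_zero
  set q := k + l with hq
  set F : ℝ := (n - q).factorial / n.factorial with hF
  have hF0 : 0 ≤ F := by positivity
  have hT0 : (0 : ℝ) ≤ (T ^ 2) ^ k := by positivity
  have hAB : (0 : ℝ) ≤ (A ^ 2 * B ^ 2) ^ l := by positivity
  have hEE : 0 ≤ E * E := mul_self_nonneg E
  calc _ = (F * F * (E * E)) * (t ^ 2) ^ k *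
        (k.factorial * (T ^ 2) ^ k) * ((l.factorial) ^ 2 * (A ^ 2 * B ^ 2) ^ l) := by
        rw [mul_pow (A ^ 2), ← pow_mul, ← pow_mul, ← pow_mul, ← pow_mul]
        field_simp
        ring
    _ ≤ (((Real.exp 1 / n) ^ q * (Real.exp 1 / n) ^ q) * (E * E)) * (t ^ 2) ^ k *
        (q ^ k * (T ^ 2) ^ k) * ((q ^ l) ^ 2 * (A ^ 2 * B ^ 2) ^ l) := by
      gcongr
    _ = _ := by
      rw [mul_pow (t ^ 2), mul_pow (q : ℝ) (T ^ 2), mul_pow ((q : ℝ) ^ 2)]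
      ring

/-- The second moment of the term with indices `k, l` of the expansion: `S1` and `S2` are the
squared norms of the row and column kernels, and `k!` comes from Wick's formula. A factor of ratio
`t²(D² + n)/n²` belongs to every cell of `V`, and `(D³ + D²)/n²` to every slot. -/
theorem moment_bound {n k l : ℕ} (hkl : k + l ≤ n) (h1 : 1 ≤ k + l) {D t Y S1 S2 : ℝ}
    (hD : 1 ≤ D)
    (hY1 : t ^ 2 * (2 * D ^ 2 + 2 * n) / n ^ 2 ≤ Y) (hY2 : (2 * D ^ 3 + 2 * D ^ 2) / n ^ 2 ≤ Y)
    (hS0 : 0 ≤ S2)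
    (hS1 : ∀ r τ : ℝ, 0 < τ → τ ≤ 1 → 0 < r → S1 ≤ (r ^ (2 * l))⁻¹ * (k.factorial * (τ ^ k)⁻¹ *
      Real.exp (2 * τ * D + 4 * τ ^ 2 * n + 2 * r * 0 + 2 * r ^ 2 * D)))
    (hS2 : ∀ r τ : ℝ, 0 < τ → τ ≤ 1 → 0 < r → S2 ≤ (r ^ (2 * l))⁻¹ * (k.factorial * (τ ^ k)⁻¹ *
      Real.exp (2 * τ * D + 4 * τ ^ 2 * n + 2 * r * D + 2 * r ^ 2 * D))) :
    ((l.factorial : ℝ) / k.factorial * ((n - (k + l)).factorial / n.factorial) * t ^ k) ^ 2 *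
      (k.factorial * (S1 * S2)) ≤ (Real.exp 22 * Y) ^ (k + l) := by
  have hq1 : (1 : ℝ) ≤ (k + l : ℕ) := by exact_mod_cast h1
  have hqn : ((k + l : ℕ) : ℝ) ≤ n := by exact_mod_cast hkl
  have hn0 : (0 : ℝ) < n := by linarith
  obtain ⟨T, A, B, hT, hA, hB, x1, x2, hT2, hAB⟩ := exists_saddle_params hq1 hqn hD
  have hT0 : 0 < T := by linarith
  have b1 := hS1 A⁻¹ T⁻¹ (by positivity) (inv_le_one_of_one_le₀ hT) (by positivity)
  have b2 := hS2 B⁻¹ T⁻¹ (by positivity) (inv_le_one_of_one_le₀ hT) (by positivity)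
  simp only [inv_pow, inv_inv] at b1 b2
  set E := Real.exp (10 * (k + l : ℕ)) with hE
  have hE0 : 0 < E := Real.exp_pos _
  have c1 : S1 ≤ A ^ (2 * l) * (k.factorial * T ^ k * E) :=
    b1.trans (mul_le_mul_of_nonneg_left (mul_le_mul_of_nonneg_left
      (Real.exp_le_exp.2 (x1.trans (by linarith))) (by positivity)) (by positivity))
  have c2 : S2 ≤ B ^ (2 * l) * (k.factorial * T ^ k * E) :=
    b2.trans (mul_le_mul_of_nonneg_left (mul_le_mul_of_nonneg_left
      (Real.exp_le_exp.2 x2) (by positivity)) (by positivity))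
  have c3 := mul_le_mul c1 c2 hS0 (by positivity)
  have hexp : (Real.exp 1 / n) ^ (k + l) * (Real.exp 1 / n) ^ (k + l) * (E * E)
      = (Real.exp 22 / n ^ 2) ^ (k + l) := by
    rw [hE, mul_comm 10, Real.exp_nat_mul, ← mul_pow, ← mul_pow, ← mul_pow]
    congr 1
    -- Two factors `exp 1` per unit of `k + l` come from the squared inverse falling factorial, and
    -- `exp 10` from each of the two kernels.
    rw [show (22 : ℝ) = 1 + 1 + (10 + 10) by norm_num, Real.exp_add, Real.exp_add, Real.exp_add]
    field_simp
  have hY0 : 0 ≤ t ^ 2 * (2 * D ^ 2 + 2 * n) / n ^ 2 := by positivity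
  have hY0' : 0 ≤ (2 * D ^ 3 + 2 * D ^ 2) / (n : ℝ) ^ 2 := by positivity
  have hY : 0 ≤ Y := hY0.trans hY1
  calc _ ≤ ((l.factorial : ℝ) / k.factorial * ((n - (k + l)).factorial / n.factorial) * t ^ k) ^ 2
        * (k.factorial * ((A ^ (2 * l) * (k.factorial * T ^ k * E)) *
      (B ^ (2 * l) * (k.factorial * T ^ k * E)))) :=
        mul_le_mul_of_nonneg_left (mul_le_mul_of_nonneg_left c3 (by positivity)) (by positivity)
    _ ≤ _ := moment_bound_aux hkl h1
    _ = (Real.exp 22 / n ^ 2) ^ (k + l) * (t ^ 2 * ((k + l : ℕ) * T ^ 2)) ^ k *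
        ((k + l : ℕ) ^ 2 * (A ^ 2 * B ^ 2)) ^ l := by rw [hexp]
    _ ≤ (Real.exp 22 / n ^ 2) ^ (k + l) * (t ^ 2 * (2 * D ^ 2 + 2 * n)) ^ k *
        (2 * D ^ 3 + 2 * D ^ 2) ^ l := by gcongr
    _ = Real.exp 22 ^ (k + l) * ((t ^ 2 * (2 * D ^ 2 + 2 * n) / n ^ 2) ^ k *
        ((2 * D ^ 3 + 2 * D ^ 2) / n ^ 2) ^ l) := by
      rw [div_pow, div_pow, div_pow, pow_add (((n : ℝ)) ^ 2)]
      field_simp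
    _ ≤ Real.exp 22 ^ (k + l) * (Y ^ k * Y ^ l) := by gcongr
    _ = _ := by rw [← pow_add, mul_pow]

end Centred

/-! ### First moment of the centred permanent -/

section CentredMoment

variable {X : Type*} [Fintype X] [DecidableEq X]

/-- The projection of `ℝ^X` onto the vectors with zero sum. -/
noncomputable def centProj (X : Type*) [Fintype X] [DecidableEq X] (i j : X) : ℝ :=
  (if i = j then 1 else 0) - (Fintype.card X : ℝ)⁻¹

/-- The projection of matrices onto the matrices with zero row and column sums. -/
noncomputable def matProj (X : Type*) [Fintype X] [DecidableEq X] (p q : X × X) : ℝ :=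
  centProj X p.1 q.1 * centProj X p.2 q.2

theorem centProj_symm (i j : X) : centProj X i j = centProj X j i := by
  simp only [centProj, eq_comm]

theorem sum_centProj [Nonempty X] (j : X) : ∑ i, centProj X i j = 0 := by
  have : (Fintype.card X : ℝ) ≠ 0 := by exact_mod_cast Fintype.card_ne_zero
  simp [centProj, Finset.sum_sub_distrib, this]

theorem centProj_idem [Nonempty X] (i k : X) :
    ∑ j, centProj X i j * centProj X j k = centProj X i k := by
  have h : ∀ j, centProj X i j * centProj X j k =
      (if i = j then centProj X j k else 0) - (Fintype.card X : ℝ)⁻¹ * centProj X j k := by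
    intro j
    rw [centProj, sub_mul, ite_mul, one_mul, zero_mul]
  simp only [h, Finset.sum_sub_distrib, ← Finset.mul_sum, sum_centProj]
  simp

theorem matProj_symm (p q : X × X) : matProj X p q = matProj X q p := by
  simp only [matProj, centProj_symm]

theorem matProj_idem [Nonempty X] (p q : X × X) :
    ∑ r, matProj X p r * matProj X r q = matProj X p q := by
  rw [Fintype.sum_prod_type]
  calc _ = ∑ i, ∑ j, (centProj X p.1 i * centProj X i q.1) * (centProj X p.2 j * centProj X j q.2) := by
        refine Finset.sum_congr rfl fun i _ => Finset.sum_congr rfl fun j _ => ?_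
        simp only [matProj]; ring
    _ = _ := by
        rw [← Finset.sum_mul_sum, centProj_idem, centProj_idem]; rfl

theorem sum_matMap_matProj_left [Nonempty X] (W : X × X → ℂ) (j : X) :
    ∑ i, matMap (matProj X) W (i, j) = 0 := by
  simp only [matMap_apply, matProj]
  rw [Finset.sum_comm]
  refine Finset.sum_eq_zero fun y _ => ?_
  rw [← Finset.sum_mul, ← Complex.ofReal_sum, ← Finset.sum_mul, sum_centProj]
  simp

theorem sum_matMap_matProj_right [Nonempty X] (W : X × X → ℂ) (i : X) :
    ∑ j, matMap (matProj X) W (i, j) = 0 := by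
  simp only [matMap_apply, matProj]
  rw [Finset.sum_comm]
  refine Finset.sum_eq_zero fun y _ => ?_
  rw [← Finset.sum_mul, ← Complex.ofReal_sum, ← Finset.mul_sum, sum_centProj]
  simp

/-- The normalized permanent of the matrix `1 + x_i w_j + z a_i b_j V_ij`. -/
noncomputable def centredPer (z : ℂ) (a x b w : X → ℂ) (V : X × X → ℂ) : ℂ :=
  (∑ σ : Equiv.Perm X, ∏ v, (1 + x v * w (σ v) + z * (a v * b (σ v) * V (v, σ v)))) /
    (Fintype.card X).factorial

/-- The coefficient of the term with indices `k, l` in the expansion of `centredPer`. -/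
noncomputable def centCoeff (n : ℕ) (t : ℝ) (k l : ℕ) : ℝ :=
  (l.factorial : ℝ) / k.factorial * ((n - (k + l)).factorial / n.factorial) * t ^ k

theorem coeff_zero_tiltPoly_nil (a x : X → ℂ) : (tiltPoly a x []).coeff 0 = 1 := by
  rw [Polynomial.coeff_zero_eq_eval_zero, tiltPoly, profWeight, Polynomial.eval_prod]
  refine Finset.prod_eq_one fun v _ => ?_
  simp [tilt, pairW]

theorem centredPer_sub_one (z : ℂ) (a x b w : X → ℂ) (V : X × X → ℂ)
    (hV1 : ∀ j, ∑ i, V (i, j) = 0) (hV2 : ∀ i, ∑ j, V (i, j) = 0) :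
    ‖centredPer z a x b w V - 1‖ ≤
      ∑ q ∈ ((Finset.range (Fintype.card X + 1) ×ˢ Finset.range (Fintype.card X + 1)).filter
          fun q => q.1 + q.2 ≤ Fintype.card X).erase (0, 0),
        centCoeff (Fintype.card X) ‖z‖ q.1 q.2 * ‖kerPoly q.1 (centKer a x b w q.2) V‖ := by
  set n := Fintype.card X
  have hn : (n.factorial : ℂ) ≠ 0 := by exact_mod_cast n.factorial_ne_zero
  set S := ((Finset.range (n + 1) ×ˢ Finset.range (n + 1)).filter fun q => q.1 + q.2 ≤ n) with hS
  have h0 : ((0, 0) : ℕ × ℕ) ∈ S := by simp [hS]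
  have e : centredPer z a x b w V - 1 = ∑ q ∈ S.erase (0, 0),
      ((q.2.factorial : ℂ) / q.1.factorial * ((n - (q.1 + q.2)).factorial / n.factorial) *
        z ^ q.1) * kerPoly q.1 (centKer a x b w q.2) V := by
    rw [centredPer, centred_perm_expansion z a x b w V hV1 hV2, ← Finset.sum_product',
      ← Finset.sum_filter, ← hS, Finset.sum_div, ← Finset.add_sum_erase _ _ h0]
    have : kerPoly 0 (centKer a x b w 0) V = 1 := by
      simp [kerPoly, listSum, centKer, coeff_zero_tiltPoly_nil]
    simp only [this, Nat.factorial_zero, add_zero, Nat.sub_zero, pow_zero, mul_one, Nat.cast_one,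
      div_one, one_mul]
    rw [div_self hn, add_sub_cancel_left]
    refine Finset.sum_congr rfl fun q _ => ?_
    ring
  rw [e]
  refine (norm_sum_le _ _).trans (Finset.sum_le_sum fun q _ => ?_)
  rw [norm_mul, norm_mul, norm_mul, norm_div, norm_div, norm_pow]
  simp [centCoeff]

/-- The pointwise inequality `f ≤ (f²/s + s)/2` stands in for Cauchy–Schwarz and gives integrability
as well. -/
theorem integral_norm_le_of_sq {Ω : Type*} [MeasurableSpace Ω] {P : Measure Ω}
    [IsProbabilityMeasure P] {f : Ω → ℝ} (hf : Integrable (fun ω => f ω ^ 2) P)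
    (hm : AEStronglyMeasurable f P) (h0 : ∀ ω, 0 ≤ f ω) {s : ℝ} (hs : 0 < s)
    (h : ∫ ω, f ω ^ 2 ∂P ≤ s ^ 2) : Integrable f P ∧ ∫ ω, f ω ∂P ≤ s := by
  have hpt : ∀ ω, f ω ≤ (f ω ^ 2 / s + s) / 2 := by
    intro ω
    rw [le_div_iff₀ two_pos, ← sub_nonneg]
    have : f ω ^ 2 / s + s - f ω * 2 = (f ω - s) ^ 2 / s := by field_simp; ring
    rw [this]; positivity
  have hi : Integrable (fun ω => (f ω ^ 2 / s + s) / 2) P :=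
    ((hf.div_const s).add (integrable_const s)).div_const 2
  refine ⟨hi.mono' hm (Filter.Eventually.of_forall fun ω => ?_), ?_⟩
  · rw [Real.norm_of_nonneg (h0 ω)]; exact hpt ω
  · have hint : Integrable f P := hi.mono' hm (Filter.Eventually.of_forall fun ω => by
      rw [Real.norm_of_nonneg (h0 ω)]; exact hpt ω)
    refine (integral_mono hint hi hpt).trans ?_
    rw [integral_div, integral_add (hf.div_const s) (integrable_const s), integral_div]
    simp only [integral_const, probReal_univ, smul_eq_mul, one_mul]
    rw [div_le_iff₀ two_pos, ← le_sub_iff_add_le, div_le_iff₀ hs]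
    nlinarith

theorem sum_erase_pow_le (n : ℕ) {η : ℝ} (hη : 0 ≤ η) (hη2 : η ≤ 1 / 2) :
    ∑ q ∈ ((Finset.range (n + 1) ×ˢ Finset.range (n + 1)).filter
          fun q => q.1 + q.2 ≤ n).erase (0, 0), η ^ (q.1 + q.2) ≤ 6 * η := by
  set S := Finset.range (n + 1) ×ˢ Finset.range (n + 1) with hS
  have h0 : ((0, 0) : ℕ × ℕ) ∈ S := by simp [hS]
  have h1 : ∑ q ∈ (S.filter fun q => q.1 + q.2 ≤ n).erase (0, 0), η ^ (q.1 + q.2) ≤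
      ∑ q ∈ S.erase (0, 0), η ^ (q.1 + q.2) :=
    Finset.sum_le_sum_of_subset_of_nonneg (Finset.erase_subset_erase _ (Finset.filter_subset _ _))
      fun _ _ _ => by positivity
  have h2 := Finset.add_sum_erase S (fun q => η ^ (q.1 + q.2)) h0
  have h3 : ∑ q ∈ S, η ^ (q.1 + q.2) =
      (∑ k ∈ Finset.range (n + 1), η ^ k) * ∑ k ∈ Finset.range (n + 1), η ^ k := by
    rw [Finset.sum_mul_sum, hS, Finset.sum_product]
    simp only [pow_add]
  -- Squaring and removing the term `1` leaves `4η + 4η² ≤ 6η`, as `η ≤ 1/2`.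
  have h4 : ∑ k ∈ Finset.range (n + 1), η ^ k ≤ 1 + 2 * η := by
    have := geom_sum_mul_neg η (n + 1)
    have h5 : 0 ≤ η ^ (n + 1) := by positivity
    have h6 : (∑ k ∈ Finset.range (n + 1), η ^ k) * (1 - η) ≤ (1 + 2 * η) * (1 - η) := by
      rw [this]; nlinarith
    exact le_of_mul_le_mul_right h6 (by linarith)
  have h5 : 0 ≤ ∑ k ∈ Finset.range (n + 1), η ^ k := Finset.sum_nonneg fun _ _ => by positivity
  simp only [add_zero, pow_zero] at h2
  nlinarith

/-- The term with `k = l = 0` is `1`. By `moment_bound` every other term has mean absolute value at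
most `η ^ (k + l)`. Rows enter with sum exactly zero, columns with a sum of size at most `D`. -/
theorem integral_centredPer_sub_one_le [Nonempty X] (z : ℂ) (a x b w : X → ℂ) {D Y : ℝ}
    (hD : 1 ≤ D) (ha : ∀ v, ‖a v‖ ≤ 2) (haD : ∑ v, ‖a v - 1‖ ^ 2 ≤ D)
    (hxD : ∑ v, ‖x v‖ ^ 2 ≤ D) (hx : ∑ v, x v = 0)
    (hb : ∀ v, ‖b v‖ ≤ 2) (hbD : ∑ v, ‖b v - 1‖ ^ 2 ≤ D)
    (hwD : ∑ v, ‖w v‖ ^ 2 ≤ D) (hw : ‖∑ v, w v‖ ≤ D)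
    (hY1 : ‖z‖ ^ 2 * (2 * D ^ 2 + 2 * Fintype.card X) / Fintype.card X ^ 2 ≤ Y)
    (hY2 : (2 * D ^ 3 + 2 * D ^ 2) / Fintype.card X ^ 2 ≤ Y)
    {η : ℝ} (hη : 0 < η) (hη2 : η ≤ 1 / 2) (hYη : Real.exp 22 * Y ≤ η ^ 2) :
    ∫⁻ W, ‖centredPer z a x b w (matMap (matProj X) W) - 1‖ₑ ∂(gaussianVec (X × X)) ≤
      ENNReal.ofReal (6 * η) := by
  set n := Fintype.card X
  set S := ((Finset.range (n + 1) ×ˢ Finset.range (n + 1)).filter fun q => q.1 + q.2 ≤ n).erase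
    (0, 0) with hS
  have hmem : ∀ q ∈ S, q.1 + q.2 ≤ n ∧ 1 ≤ q.1 + q.2 := by
    intro q hq
    simp only [hS, Finset.mem_erase, Finset.mem_filter, ne_eq, Prod.ext_iff] at hq
    exact ⟨hq.2.2, by omega⟩
  have hterm : ∀ q ∈ S, Integrable (fun W => centCoeff n ‖z‖ q.1 q.2 *
        ‖kerPoly q.1 (centKer a x b w q.2) (matMap (matProj X) W)‖) (gaussianVec (X × X)) ∧
      ∫ W, centCoeff n ‖z‖ q.1 q.2 *
        ‖kerPoly q.1 (centKer a x b w q.2) (matMap (matProj X) W)‖ ∂(gaussianVec (X × X)) ≤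
        η ^ (q.1 + q.2) := by
    rintro ⟨k, l⟩ hq
    obtain ⟨hkl, h1⟩ := hmem _ hq
    have hc0 : 0 ≤ centCoeff n ‖z‖ k l := by unfold centCoeff; positivity
    have hK := integral_kerPoly_matMap_sq_le (matProj X) matProj_symm matProj_idem k
      (centKer a x b w l)
    have hmeas : Measurable fun W => kerPoly k (centKer a x b w l) (matMap (matProj X) W) :=
      (measurable_kerPoly _ _).comp (matMap (matProj X)).continuous.measurable
    refine integral_norm_le_of_sq ?_ ?_ (fun W => by positivity) (by positivity) ?_
    · simp only [mul_pow]; exact hK.1.const_mul _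
    · exact (hmeas.norm.const_mul _).aestronglyMeasurable
    · simp only [mul_pow]
      rw [integral_const_mul]
      refine (mul_le_mul_of_nonneg_left hK.2 (by positivity)).trans ?_
      rw [listSum_norm_centKer]
      refine (moment_bound hkl h1 hD hY1 hY2 (listSum.nonneg fun _ => by positivity)
        (fun r τ hτ hτ1 hr => listSum_norm_coeff_tiltPoly_le a x hτ hτ1 hr ha haD hxD
          (by rw [hx, norm_zero]) k l)
        (fun r τ hτ hτ1 hr => listSum_norm_coeff_tiltPoly_le b w hτ hτ1 hr hb hbD hwD hw k l)).trans
        ?_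
      rw [← pow_mul, mul_comm (k + l) 2, pow_mul]
      have : 0 ≤ (2 * D ^ 3 + 2 * D ^ 2) / (n : ℝ) ^ 2 := by positivity
      have hY : 0 ≤ Y := this.trans hY2
      gcongr
  have hint : Integrable (fun W => ∑ q ∈ S, centCoeff n ‖z‖ q.1 q.2 *
      ‖kerPoly q.1 (centKer a x b w q.2) (matMap (matProj X) W)‖) (gaussianVec (X × X)) :=
    integrable_finset_sum _ fun q hq => (hterm q hq).1
  have hnn : ∀ W, 0 ≤ ∑ q ∈ S, centCoeff n ‖z‖ q.1 q.2 *
      ‖kerPoly q.1 (centKer a x b w q.2) (matMap (matProj X) W)‖ := fun W =>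
    Finset.sum_nonneg fun q _ => by unfold centCoeff; positivity
  calc _ ≤ ∫⁻ W, ENNReal.ofReal (∑ q ∈ S, centCoeff n ‖z‖ q.1 q.2 *
      ‖kerPoly q.1 (centKer a x b w q.2) (matMap (matProj X) W)‖) ∂(gaussianVec (X × X)) := by
        refine lintegral_mono fun W => ?_
        rw [← ofReal_norm_eq_enorm]
        exact ENNReal.ofReal_le_ofReal (centredPer_sub_one z a x b w _
          (sum_matMap_matProj_left W) (sum_matMap_matProj_right W))
    _ = ENNReal.ofReal (∫ W, ∑ q ∈ S, centCoeff n ‖z‖ q.1 q.2 *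
      ‖kerPoly q.1 (centKer a x b w q.2) (matMap (matProj X) W)‖ ∂(gaussianVec (X × X))) :=
        (ofReal_integral_eq_lintegral_ofReal hint (Filter.Eventually.of_forall hnn)).symm
    _ ≤ _ := by
        refine ENNReal.ofReal_le_ofReal ?_
        rw [integral_finset_sum _ fun q hq => (hterm q hq).1]
        exact (Finset.sum_le_sum fun q hq => (hterm q hq).2).trans (sum_erase_pow_le n hη.le hη2)

end CentredMoment

/-! ### Splitting off row and column means -/

section Means

variable {X : Type*} [Fintype X] [DecidableEq X]

noncomputable def rowMean (W : X × X → ℂ) (i : X) : ℂ := (Fintype.card X : ℂ)⁻¹ * ∑ j, W (i, j)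

/-- The overall mean is subtracted here and stays in the row means, so that the column deviations
sum to zero. -/
noncomputable def colDev (W : X × X → ℂ) (j : X) : ℂ :=
  (Fintype.card X : ℂ)⁻¹ * ∑ i, W (i, j) - (Fintype.card X : ℂ)⁻¹ * ∑ i, rowMean W i

theorem sum_colDev [Nonempty X] (W : X × X → ℂ) : ∑ j, colDev W j = 0 := by
  have h : (Fintype.card X : ℂ) ≠ 0 := by exact_mod_cast Fintype.card_ne_zero
  simp only [colDev, Finset.sum_sub_distrib, ← Finset.mul_sum, rowMean, Finset.sum_const,
    Finset.card_univ, nsmul_eq_mul]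
  rw [Finset.sum_comm (γ := X)]
  field_simp
  ring

theorem sum_centProj_mul (f : X → ℂ) (i : X) :
    ∑ k, (centProj X i k : ℂ) * f k = f i - (Fintype.card X : ℂ)⁻¹ * ∑ k, f k := by
  simp only [centProj, Complex.ofReal_sub, Complex.ofReal_inv, Complex.ofReal_natCast, sub_mul,
    Finset.sum_sub_distrib, Finset.mul_sum]
  congr 1
  rw [Finset.sum_eq_single i (fun j _ h => by simp [h.symm]) (by simp)]
  simp

theorem eq_means_add_matMap (W : X × X → ℂ) (i j : X) :
    W (i, j) = rowMean W i + colDev W j + matMap (matProj X) W (i, j) := by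
  rw [matMap_apply, Fintype.sum_prod_type]
  have h : ∀ k l, (matProj X (i, j) (k, l) : ℂ) * W (k, l) =
      (centProj X i k : ℂ) * ((centProj X j l : ℂ) * W (k, l)) := by
    intro k l; simp only [matProj]; push_cast; ring
  simp only [h, ← Finset.mul_sum]
  simp only [sum_centProj_mul]
  simp only [colDev, rowMean, Finset.sum_sub_distrib, ← Finset.mul_sum]
  ring

theorem rowMean_matMap [Nonempty X] (W : X × X → ℂ) (i : X) :
    rowMean (matMap (matProj X) W) i = 0 := by
  rw [rowMean, sum_matMap_matProj_right, mul_zero]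

theorem colDev_matMap [Nonempty X] (W : X × X → ℂ) (i : X) :
    colDev (matMap (matProj X) W) i = 0 := by
  simp only [colDev, rowMean_matMap, sum_matMap_matProj_left]
  simp

theorem rowMean_mix [Nonempty X] (W V : X × X → ℂ) (i : X) :
    rowMean (W - matMap (matProj X) W + matMap (matProj X) V) i = rowMean W i := by
  have h1 := rowMean_matMap W i
  have h2 := rowMean_matMap V i
  simp only [rowMean, Pi.add_apply, Pi.sub_apply, Finset.sum_add_distrib, Finset.sum_sub_distrib,
    mul_add, mul_sub] at *
  rw [h1, h2]; ring

theorem colDev_mix [Nonempty X] (W V : X × X → ℂ) (i : X) :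
    colDev (W - matMap (matProj X) W + matMap (matProj X) V) i = colDev W i := by
  simp only [colDev, rowMean_mix]
  simp only [Pi.add_apply, Pi.sub_apply, Finset.sum_add_distrib, Finset.sum_sub_distrib,
    sum_matMap_matProj_left]
  ring

theorem matMap_matProj_matMap [Nonempty X] (W : X × X → ℂ) :
    matMap (matProj X) (matMap (matProj X) W) = matMap (matProj X) W := by
  funext ⟨i, j⟩
  have := eq_means_add_matMap (matMap (matProj X) W) i j
  rw [rowMean_matMap, colDev_matMap, zero_add, zero_add] at this
  exact this.symm

noncomputable def rowInv (z : ℂ) (ρ : X → ℂ) (i : X) : ℂ := (1 + z * ρ i)⁻¹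

noncomputable def meanInv (z : ℂ) (ρ : X → ℂ) : ℂ := (Fintype.card X : ℂ)⁻¹ * ∑ i, rowInv z ρ i

/-- Dividing by the row factor leaves `1 + z * rowInv i * c j`, which depends on `i`. The column
factor uses the average of `rowInv`; the deviation from it becomes the rank-one term `x i * w j` of
`restPer`, with `∑ x = 0`. -/
noncomputable def colInv (z : ℂ) (ρ c : X → ℂ) (j : X) : ℂ := (1 + z * meanInv z ρ * c j)⁻¹

/-- The permanent that remains after the factors of the row and column means are split off. -/
noncomputable def restPer (z : ℂ) (ρ c : X → ℂ) (V : X × X → ℂ) : ℂ :=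
  centredPer z (rowInv z ρ) (fun i => rowInv z ρ i - meanInv z ρ) (colInv z ρ c)
    (fun j => z * colInv z ρ c j * c j) V

theorem permanent_eq_mul_restPer (z : ℂ) (W : X × X → ℂ)
    (h1 : ∀ i, 1 + z * rowMean W i ≠ 0)
    (h2 : ∀ j, 1 + z * meanInv z (rowMean W) * colDev W j ≠ 0) :
    (∑ σ : Equiv.Perm X, ∏ v, (1 + z * W (v, σ v))) / ((Fintype.card X).factorial : ℂ) =
      (∏ i, (1 + z * rowMean W i)) * (∏ j, (1 + z * meanInv z (rowMean W) * colDev W j)) *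
        restPer z (rowMean W) (colDev W) (matMap (matProj X) W) := by
  rw [restPer, centredPer, ← mul_div_assoc, Finset.mul_sum]
  congr 1
  refine Finset.sum_congr rfl fun σ _ => ?_
  rw [← Equiv.prod_comp σ fun j => (1 + z * meanInv z (rowMean W) * colDev W j),
    ← Finset.prod_mul_distrib, ← Finset.prod_mul_distrib]
  refine Finset.prod_congr rfl fun v _ => ?_
  rw [eq_means_add_matMap W v (σ v)]
  have e1 := h1 v
  have e2 := h2 (σ v)
  simp only [rowInv, colInv]
  set m := meanInv z (rowMean W)
  set r := rowMean W v
  set c := colDev W (σ v)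
  set V := matMap (matProj X) W (v, σ v)
  have g1 : (1 + z * r) * (1 + z * r)⁻¹ = 1 := mul_inv_cancel₀ e1
  have g2 : (1 + z * m * c) * (1 + z * m * c)⁻¹ = 1 := mul_inv_cancel₀ e2
  generalize (1 + z * r)⁻¹ = A at g1 ⊢
  generalize (1 + z * m * c)⁻¹ = B at g2 ⊢
  linear_combination (-(z * c * ((1 + z * m * c) * B)) - z * V * ((1 + z * m * c) * B)) * g1 +
    (-(1 - m * (1 + z * r)) * z * c - z * V) * g2

/-! ### Estimates for the normalized factors when the means are small. -/

section Bounds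

variable {z : ℂ} {ρ c : X → ℂ} {t K : ℝ}

theorem norm_inv_one_add_le {u : ℂ} (h : ‖u‖ ≤ 1 / 2) : ‖(1 + u)⁻¹‖ ≤ 2 := by
  have h1 : 1 / 2 ≤ ‖1 + u‖ := by
    have := norm_sub_norm_le (1 : ℂ) (-u)
    rw [norm_one, norm_neg, sub_neg_eq_add] at this
    linarith
  rw [norm_inv]
  exact inv_le_of_inv_le₀ (by norm_num) (by linarith)

theorem one_add_ne_zero_of_norm_le {u : ℂ} (h : ‖u‖ ≤ 1 / 2) : 1 + u ≠ 0 := by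
  intro h0
  have : u = -1 := by linear_combination h0
  rw [this] at h; norm_num at h

theorem norm_inv_one_add_sub_one_le {u : ℂ} (h : ‖u‖ ≤ 1 / 2) : ‖(1 + u)⁻¹ - 1‖ ≤ 2 * ‖u‖ := by
  have : (1 + u)⁻¹ - 1 = -((1 + u)⁻¹ * u) := by
    have := one_add_ne_zero_of_norm_le h
    field_simp; ring
  rw [this, norm_neg, norm_mul]
  exact mul_le_mul_of_nonneg_right (norm_inv_one_add_le h) (norm_nonneg _)

/-- Convexity of the square: the average is no further from `s` than the entries are in quadratic
mean. -/
theorem norm_mean_sub_le [Nonempty X] (a : X → ℂ) (s : ℂ) :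
    ‖(Fintype.card X : ℂ)⁻¹ * ∑ i, a i - s‖ ^ 2 ≤
      (Fintype.card X : ℝ)⁻¹ * ∑ i, ‖a i - s‖ ^ 2 := by
  have hn : (0 : ℝ) < Fintype.card X := by exact_mod_cast Fintype.card_pos
  have hn' : (Fintype.card X : ℂ) ≠ 0 := by exact_mod_cast Fintype.card_ne_zero
  have e : (Fintype.card X : ℂ)⁻¹ * ∑ i, a i - s = (Fintype.card X : ℂ)⁻¹ * ∑ i, (a i - s) := by
    rw [Finset.sum_sub_distrib]; simp; field_simp
  rw [e, norm_mul, norm_inv, Complex.norm_natCast, mul_pow, inv_pow, inv_mul_le_iff₀ (by positivity)]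
  have h1 : ‖∑ i, (a i - s)‖ ^ 2 ≤ (∑ i, ‖a i - s‖) ^ 2 :=
    pow_le_pow_left₀ (norm_nonneg _) (norm_sum_le _ _) 2
  have h2 := sq_sum_le_card_mul_sum_sq (s := Finset.univ) (f := fun i => ‖a i - s‖)
  rw [Finset.card_univ] at h2
  refine (h1.trans h2).trans (le_of_eq ?_)
  field_simp


theorem norm_mul_le_of_small (hz : ‖z‖ ≤ t) (hρ : ∀ i, t * ‖ρ i‖ ≤ 1 / 4) (i : X) :
    ‖z * ρ i‖ ≤ 1 / 4 := by
  rw [norm_mul]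
  exact (mul_le_mul_of_nonneg_right hz (norm_nonneg _)).trans (hρ i)

theorem norm_meanInv_le [Nonempty X] (hz : ‖z‖ ≤ t) (hρ : ∀ i, t * ‖ρ i‖ ≤ 1 / 4) :
    ‖meanInv z ρ‖ ≤ 2 := by
  have hn : (0 : ℝ) < Fintype.card X := by exact_mod_cast Fintype.card_pos
  rw [meanInv, norm_mul, norm_inv, Complex.norm_natCast, inv_mul_le_iff₀ hn]
  refine (norm_sum_le _ _).trans ?_
  refine (Finset.sum_le_card_nsmul _ _ 2 fun i _ => norm_inv_one_add_le
    ((norm_mul_le_of_small hz hρ i).trans (by norm_num))).trans ?_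
  simp

theorem norm_mul_meanInv_mul_le [Nonempty X] (hz : ‖z‖ ≤ t) (hρ : ∀ i, t * ‖ρ i‖ ≤ 1 / 4)
    (hc : ∀ i, t * ‖c i‖ ≤ 1 / 4) (j : X) : ‖z * meanInv z ρ * c j‖ ≤ 2 * t * ‖c j‖ ∧
      ‖z * meanInv z ρ * c j‖ ≤ 1 / 2 := by
  have h : ‖z * meanInv z ρ * c j‖ ≤ 2 * t * ‖c j‖ := by
    rw [norm_mul, norm_mul]
    have := mul_le_mul hz (norm_meanInv_le hz hρ) (norm_nonneg _) ((norm_nonneg _).trans hz)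
    have := mul_le_mul_of_nonneg_right this (norm_nonneg (c j))
    linarith
  exact ⟨h, h.trans (by linarith [hc j])⟩

/-- The factor `16` in `D` covers `2 * 4 + 2 * 4` for the deviations of `rowInv` from their mean and
`4 ^ 2` for `colInv - 1`; the summand `1` ensures `1 ≤ D`. -/
theorem lintegral_restPer_sub_one_le [Nonempty X] (hz : ‖z‖ ≤ t) (hρ : ∀ i, t * ‖ρ i‖ ≤ 1 / 4)
    (hc : ∀ i, t * ‖c i‖ ≤ 1 / 4) (hc0 : ∑ i, c i = 0) (hρK : ∑ i, ‖ρ i‖ ^ 2 ≤ K)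
    (hcK : ∑ i, ‖c i‖ ^ 2 ≤ K) {D Y : ℝ} (hD : D = 16 * t ^ 2 * K + 1)
    (hY1 : t ^ 2 * (2 * D ^ 2 + 2 * Fintype.card X) / Fintype.card X ^ 2 ≤ Y)
    (hY2 : (2 * D ^ 3 + 2 * D ^ 2) / Fintype.card X ^ 2 ≤ Y)
    {η : ℝ} (hη : 0 < η) (hη2 : η ≤ 1 / 2) (hYη : Real.exp 22 * Y ≤ η ^ 2) :
    ∫⁻ W, ‖restPer z ρ c (matMap (matProj X) W) - 1‖ₑ ∂(gaussianVec (X × X)) ≤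
      ENNReal.ofReal (6 * η) := by
  have ht : 0 ≤ t := (norm_nonneg _).trans hz
  have hK : 0 ≤ K := (Finset.sum_nonneg fun i _ => by positivity).trans hρK
  have hn : (0 : ℝ) < Fintype.card X := by exact_mod_cast Fintype.card_pos
  have hn' : (Fintype.card X : ℂ) ≠ 0 := by exact_mod_cast Fintype.card_ne_zero
  have sρ : ∀ i, ‖z * ρ i‖ ≤ 1 / 2 := fun i =>
    (norm_mul_le_of_small hz hρ i).trans (by norm_num)
  have sc := fun j => norm_mul_meanInv_mul_le hz hρ hc j
  have htK : 0 ≤ t ^ 2 * K := by positivity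
  have ha1 : ∑ v, ‖rowInv z ρ v - 1‖ ^ 2 ≤ 4 * (t ^ 2 * K) := by
    have : ∀ v ∈ Finset.univ, ‖rowInv z ρ v - 1‖ ^ 2 ≤ 4 * t ^ 2 * ‖ρ v‖ ^ 2 := fun v _ => by
      have h1 := norm_inv_one_add_sub_one_le (sρ v)
      have h2 : ‖z * ρ v‖ ≤ t * ‖ρ v‖ := by
        rw [norm_mul]; exact mul_le_mul_of_nonneg_right hz (norm_nonneg _)
      calc ‖rowInv z ρ v - 1‖ ^ 2 ≤ (2 * (t * ‖ρ v‖)) ^ 2 :=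
            pow_le_pow_left₀ (norm_nonneg _) (h1.trans (by linarith)) 2
        _ = _ := by ring
    refine (Finset.sum_le_sum this).trans ?_
    rw [← Finset.mul_sum]
    have := mul_le_mul_of_nonneg_left hρK (by positivity : 0 ≤ 4 * t ^ 2)
    linarith
  have hm1 : (Fintype.card X : ℝ) * ‖meanInv z ρ - 1‖ ^ 2 ≤ 4 * (t ^ 2 * K) := by
    have := norm_mean_sub_le (rowInv z ρ) 1
    rw [← le_inv_mul_iff₀ hn]
    exact this.trans (mul_le_mul_of_nonneg_left ha1 (by positivity))
  have hb1 : ∀ v, ‖colInv z ρ c v - 1‖ ≤ 4 * t * ‖c v‖ := fun v =>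
    (norm_inv_one_add_sub_one_le (sc v).2).trans (by linarith [(sc v).1])
  have hb2 : ∀ v, ‖colInv z ρ c v‖ ≤ 2 := fun v => norm_inv_one_add_le (sc v).2
  refine integral_centredPer_sub_one_le (D := D) (Y := Y) z _ _ _ _ (by linarith)
    (fun v => norm_inv_one_add_le (sρ v)) (ha1.trans (by linarith)) ?_ ?_ hb2 ?_ ?_ ?_ ?_ hY2
    hη hη2 hYη
  · have : ∀ v ∈ Finset.univ, ‖rowInv z ρ v - meanInv z ρ‖ ^ 2 ≤
        2 * ‖rowInv z ρ v - 1‖ ^ 2 + 2 * ‖meanInv z ρ - 1‖ ^ 2 := fun v _ => by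
      have h1 : ‖rowInv z ρ v - meanInv z ρ‖ ≤ ‖rowInv z ρ v - 1‖ + ‖meanInv z ρ - 1‖ := by
        have := norm_sub_le (rowInv z ρ v - 1) (meanInv z ρ - 1)
        rwa [sub_sub_sub_cancel_right] at this
      have h2 := pow_le_pow_left₀ (norm_nonneg _) h1 2
      nlinarith [sq_nonneg (‖rowInv z ρ v - 1‖ - ‖meanInv z ρ - 1‖)]
    refine (Finset.sum_le_sum this).trans ?_
    rw [Finset.sum_add_distrib, ← Finset.mul_sum]
    simp only [Finset.sum_const, Finset.card_univ, nsmul_eq_mul]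
    linarith
  · rw [Finset.sum_sub_distrib]
    simp only [meanInv, Finset.sum_const, Finset.card_univ, nsmul_eq_mul]
    rw [mul_inv_cancel_left₀ hn', sub_self]
  · have : ∀ v ∈ Finset.univ, ‖colInv z ρ c v - 1‖ ^ 2 ≤ 16 * t ^ 2 * ‖c v‖ ^ 2 := fun v _ => by
      calc _ ≤ (4 * t * ‖c v‖) ^ 2 := pow_le_pow_left₀ (norm_nonneg _) (hb1 v) 2
        _ = _ := by ring
    refine (Finset.sum_le_sum this).trans ?_
    rw [← Finset.mul_sum]
    have := mul_le_mul_of_nonneg_left hcK (by positivity : 0 ≤ 16 * t ^ 2)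
    linarith
  · have : ∀ v ∈ Finset.univ, ‖z * colInv z ρ c v * c v‖ ^ 2 ≤ 4 * t ^ 2 * ‖c v‖ ^ 2 :=
      fun v _ => by
      rw [norm_mul, norm_mul]
      have h1 := mul_le_mul hz (hb2 v) (norm_nonneg _) ht
      have h2 := mul_le_mul_of_nonneg_right h1 (norm_nonneg (c v))
      calc _ ≤ (t * 2 * ‖c v‖) ^ 2 := pow_le_pow_left₀ (by positivity) h2 2
        _ = _ := by ring
    refine (Finset.sum_le_sum this).trans ?_
    rw [← Finset.mul_sum]
    have := mul_le_mul_of_nonneg_left hcK (by positivity : 0 ≤ 4 * t ^ 2)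
    linarith
  -- As `∑ c = 0`, `colInv` may be replaced by `colInv - 1`. Thus the sum of the column weights is
  -- of second order in `c` and stays below `D`.
  · have e : ∑ v, z * colInv z ρ c v * c v = ∑ v, z * ((colInv z ρ c v - 1) * c v) := by
      rw [← sub_eq_zero, ← Finset.sum_sub_distrib]
      have : ∀ v, z * colInv z ρ c v * c v - z * ((colInv z ρ c v - 1) * c v) = z * c v := by
        intro v; ring
      simp only [this]
      rw [← Finset.mul_sum, hc0, mul_zero]
    rw [e]
    refine (norm_sum_le _ _).trans ?_
    have : ∀ v ∈ Finset.univ, ‖z * ((colInv z ρ c v - 1) * c v)‖ ≤ 4 * t ^ 2 * ‖c v‖ ^ 2 :=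
      fun v _ => by
      rw [norm_mul, norm_mul]
      have h1 := mul_le_mul_of_nonneg_right (hb1 v) (norm_nonneg (c v))
      have h2 := mul_le_mul hz h1 (by positivity) ht
      linarith
    refine (Finset.sum_le_sum this).trans ?_
    rw [← Finset.mul_sum]
    have := mul_le_mul_of_nonneg_left hcK (by positivity : 0 ≤ 4 * t ^ 2)
    linarith
  · refine le_trans ?_ hY1
    gcongr

end Bounds

end Means

/-! ### The means are small -/

section MeanMoments

variable {X : Type*} [Fintype X] [DecidableEq X]

theorem listSum_prod_map {R : Type*} [CommSemiring R] (g : X → R) (k : ℕ) :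
    listSum k (fun e => (e.map g).prod) = (∑ x, g x) ^ k := by
  induction k with
  | zero => simp [listSum]
  | succ k ih =>
    simp only [listSum, List.map_cons, List.prod_cons, listSum.mul_left, ih, ← Finset.sum_mul]
    rw [pow_succ']

/-- The fourth power of a linear form is a form of degree `4` whose kernel is a product; `24 = 4!`
comes from Wick's formula. -/
theorem integral_linear_pow_eight_le (f : X → ℂ) :
    Integrable (fun W => ‖∑ y, f y * W y‖ ^ 8) (gaussianVec X) ∧
    ∫ W, ‖∑ y, f y * W y‖ ^ 8 ∂(gaussianVec X) ≤ 24 * (∑ y, ‖f y‖ ^ 2) ^ 4 := by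
  have h : ∀ W : X → ℂ, ‖∑ y, f y * W y‖ ^ 8 =
      ‖kerPoly 4 (fun e => (e.map f).prod) W‖ ^ 2 := by
    intro W
    have : kerPoly 4 (fun e => (e.map f).prod) W = (∑ y, f y * W y) ^ 4 := by
      rw [kerPoly, ← listSum_prod_map]
      simp only [List.prod_map_mul]
    rw [this, norm_pow, ← pow_mul]
  simp only [h]
  refine ⟨integrable_kerPoly_sq _ _, (integral_kerPoly_sq_le _ _).trans (le_of_eq ?_)⟩
  rw [← listSum_prod_map]
  congr 2
  funext e
  induction e with
  | nil => simp
  | cons x e ih => simp [mul_pow, ih]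

theorem rowMean_eq_linear (W : X × X → ℂ) (i : X) :
    rowMean W i = ∑ y : X × X, (if y.1 = i then (Fintype.card X : ℂ)⁻¹ else 0) * W y := by
  rw [Fintype.sum_prod_type, Finset.sum_eq_single i (fun k _ h => by simp [h]) (by simp), rowMean,
    Finset.mul_sum]
  simp

theorem colDev_eq_linear (W : X × X → ℂ) (j : X) :
    colDev W j = ∑ y : X × X, ((Fintype.card X : ℂ)⁻¹ * (centProj X j y.2 : ℂ)) * W y := by
  rw [Fintype.sum_prod_type]
  simp only [mul_assoc, ← Finset.mul_sum, sum_centProj_mul, Finset.sum_sub_distrib]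
  simp only [colDev, rowMean, mul_sub, ← Finset.mul_sum]

/-- The event that the row and column means are of their typical size. -/
def smallMeans (X : Type*) [Fintype X] (K : ℝ) : Set (X × X → ℂ) :=
  {W | ∑ i, ‖rowMean W i‖ ^ 8 ≤ K ^ 4 / (Fintype.card X : ℝ) ^ 3 ∧
    ∑ i, ‖colDev W i‖ ^ 8 ≤ K ^ 4 / (Fintype.card X : ℝ) ^ 3}

theorem measurable_rowMean (i : X) : Measurable fun W : X × X → ℂ => rowMean W i := by
  unfold rowMean; fun_prop

theorem measurable_colDev (i : X) : Measurable fun W : X × X → ℂ => colDev W i := by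
  unfold colDev rowMean; fun_prop

theorem measurableSet_smallMeans (K : ℝ) : MeasurableSet (smallMeans X K) := by
  have h1 := measurable_rowMean (X := X)
  have h2 := measurable_colDev (X := X)
  have a1 : MeasurableSet {W : X × X → ℂ | ∑ i, ‖rowMean W i‖ ^ 8 ≤
      K ^ 4 / (Fintype.card X : ℝ) ^ 3} :=
    measurableSet_le (Finset.measurable_fun_sum _ fun i _ => ((h1 i).norm.pow_const 8))
      measurable_const
  have a2 : MeasurableSet {W : X × X → ℂ | ∑ i, ‖colDev W i‖ ^ 8 ≤
      K ^ 4 / (Fintype.card X : ℝ) ^ 3} :=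
    measurableSet_le (Finset.measurable_fun_sum _ fun i _ => ((h2 i).norm.pow_const 8))
      measurable_const
  exact a1.inter a2

theorem measure_sum_pow_eight_gt_le [Nonempty X] (f : X → X × X → ℂ)
    (hf : ∀ i, ∑ y, ‖f i y‖ ^ 2 ≤ (Fintype.card X : ℝ)⁻¹) {K : ℝ} (hK : 0 < K) :
    gaussianVec (X × X) {W | ¬ ∑ i, ‖∑ y, f i y * W y‖ ^ 8 ≤ K ^ 4 / (Fintype.card X : ℝ) ^ 3} ≤
      ENNReal.ofReal (24 / K ^ 4) := by
  have hn : (0 : ℝ) < Fintype.card X := by exact_mod_cast Fintype.card_pos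
  set F : (X × X → ℂ) → ℝ := fun W => ∑ i, ‖∑ y, f i y * W y‖ ^ 8 with hF
  have hI : Integrable F (gaussianVec (X × X)) :=
    integrable_finset_sum _ fun i _ => (integral_linear_pow_eight_le (f i)).1
  have hle : ∫ W, F W ∂(gaussianVec (X × X)) ≤ 24 / (Fintype.card X : ℝ) ^ 3 := by
    rw [hF, integral_finset_sum _ fun i _ => (integral_linear_pow_eight_le (f i)).1]
    have : ∀ i ∈ Finset.univ, ∫ W, ‖∑ y, f i y * W y‖ ^ 8 ∂(gaussianVec (X × X)) ≤
        24 * ((Fintype.card X : ℝ)⁻¹) ^ 4 := fun i _ =>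
      (integral_linear_pow_eight_le (f i)).2.trans (by gcongr; exact hf i)
    refine (Finset.sum_le_sum this).trans (le_of_eq ?_)
    simp only [Finset.sum_const, Finset.card_univ, nsmul_eq_mul]
    field_simp
  have hpos : 0 < K ^ 4 / (Fintype.card X : ℝ) ^ 3 := by positivity
  have hM := mul_meas_ge_le_integral_of_nonneg (Filter.Eventually.of_forall fun W =>
    Finset.sum_nonneg fun i _ => by positivity) hI (K ^ 4 / (Fintype.card X : ℝ) ^ 3)
  have h2 : (gaussianVec (X × X)).real {W | K ^ 4 / (Fintype.card X : ℝ) ^ 3 ≤ F W} ≤ 24 / K ^ 4 := by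
    have := hM.trans hle
    rw [mul_comm, ← le_div_iff₀ hpos] at this
    refine this.trans (le_of_eq (by field_simp))
  rw [← ENNReal.ofReal_toReal (measure_ne_top (gaussianVec (X × X)) _)]
  refine ENNReal.ofReal_le_ofReal (le_trans ?_ h2)
  exact measureReal_mono fun W hW => (not_le.1 hW).le

theorem measure_compl_smallMeans_le [Nonempty X] {K : ℝ} (hK : 0 < K) :
    gaussianVec (X × X) (smallMeans X K)ᶜ ≤ ENNReal.ofReal (48 / K ^ 4) := by
  have hn : (0 : ℝ) < Fintype.card X := by exact_mod_cast Fintype.card_pos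
  have h1 := measure_sum_pow_eight_gt_le (X := X)
    (fun i y => if y.1 = i then (Fintype.card X : ℂ)⁻¹ else 0) (fun i => by
      rw [Fintype.sum_prod_type, Finset.sum_eq_single i (fun k _ h => by simp [h]) (by simp)]
      simp only [if_true, norm_inv, Complex.norm_natCast, Finset.sum_const, Finset.card_univ,
        nsmul_eq_mul]
      exact le_of_eq (by field_simp)) hK
  have h2 := measure_sum_pow_eight_gt_le (X := X)
    (fun j y => (Fintype.card X : ℂ)⁻¹ * (centProj X j y.2 : ℂ)) (fun j => by
      rw [Fintype.sum_prod_type]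
      have e : ∀ l, ‖(Fintype.card X : ℂ)⁻¹ * (centProj X j l : ℂ)‖ ^ 2 =
          ((Fintype.card X : ℝ)⁻¹) ^ 2 * (centProj X j l * centProj X l j) := by
        intro l
        rw [norm_mul, norm_inv, Complex.norm_natCast, Complex.norm_real, mul_pow, Real.norm_eq_abs,
          sq_abs, centProj_symm l j]
        ring
      simp only [e, ← Finset.mul_sum, centProj_idem, Finset.sum_const, Finset.card_univ,
        nsmul_eq_mul]
      have : centProj X j j ≤ 1 := by
        simp only [centProj, if_true]
        have : (0 : ℝ) ≤ (Fintype.card X : ℝ)⁻¹ := by positivity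
        linarith
      calc _ = (Fintype.card X : ℝ)⁻¹ * centProj X j j := by field_simp
        _ ≤ (Fintype.card X : ℝ)⁻¹ * 1 := by gcongr
        _ = _ := mul_one _) hK
  simp only [← rowMean_eq_linear, ← colDev_eq_linear] at h1 h2
  calc _ = gaussianVec (X × X)
        ({W | ¬ ∑ i, ‖rowMean W i‖ ^ 8 ≤ K ^ 4 / (Fintype.card X : ℝ) ^ 3} ∪
        {W | ¬ ∑ i, ‖colDev W i‖ ^ 8 ≤ K ^ 4 / (Fintype.card X : ℝ) ^ 3}) := by
        congr 1
        ext W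
        simp only [smallMeans, mem_compl_iff, mem_setOf_eq, mem_union, not_and_or]
    _ ≤ _ := measure_union_le _ _
    _ ≤ _ := add_le_add h1 h2
    _ = _ := by
        rw [← ENNReal.ofReal_add (by positivity) (by positivity)]
        congr 1; ring

/-- Power means: the typical size `n ^ (-1/2)` of the entries makes the two bounds compatible. -/
theorem sum_sq_le_of_sum_pow_eight [Nonempty X] {f : X → ℂ} {K : ℝ} (hK : 0 ≤ K)
    (h : ∑ i, ‖f i‖ ^ 8 ≤ K ^ 4 / (Fintype.card X : ℝ) ^ 3) : ∑ i, ‖f i‖ ^ 2 ≤ K := by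
  have hn : (0 : ℝ) < Fintype.card X := by exact_mod_cast Fintype.card_pos
  have h2 := pow_sum_div_card_le_sum_pow (s := Finset.univ) (f := fun i => ‖f i‖ ^ 2)
    (fun i _ => by positivity) 3
  simp only [Finset.card_univ, ← pow_mul] at h2
  norm_num at h2
  have h3 := h2.trans h
  rw [div_le_div_iff_of_pos_right (by positivity)] at h3
  exact le_of_pow_le_pow_left₀ (by norm_num) hK h3

/-- A sum of eighth powers also controls the maximum. It suffices that `t` is small compared with `n
^ (3/8)`, and `3/8 > 1/3` leaves room; so one event provides both the sums of squares and the
maximum. -/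
theorem mul_norm_le_of_sum_pow_eight [Nonempty X] {f : X → ℂ} {K t : ℝ}
    (h : ∑ i, ‖f i‖ ^ 8 ≤ K ^ 4 / (Fintype.card X : ℝ) ^ 3)
    (hs : t ^ 8 * (K ^ 4 / (Fintype.card X : ℝ) ^ 3) ≤ (1 / 4) ^ 8) (i : X) :
    t * ‖f i‖ ≤ 1 / 4 := by
  refine le_of_pow_le_pow_left₀ (n := 8) (by norm_num) (by norm_num) ?_
  rw [mul_pow]
  refine le_trans ?_ hs
  gcongr
  exact (Finset.single_le_sum (f := fun i => ‖f i‖ ^ 8) (fun i _ => by positivity)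
    (Finset.mem_univ i)).trans h

end MeanMoments

/-! ### The average over a circle -/

section CircleAverage

variable {X : Type*} [Fintype X] [DecidableEq X]

theorem measurable_restPer : Measurable fun p : ℂ × (X → ℂ) × (X → ℂ) × (X × X → ℂ) =>
    restPer p.1 p.2.1 p.2.2.1 p.2.2.2 := by
  unfold restPer centredPer colInv meanInv rowInv
  fun_prop

/-- The mean deviation from `1` over a circle of radius `t`. -/
noncomputable def circleDev (t : ℝ) (ρ c : X → ℂ) (V : X × X → ℂ) : ENNReal :=
  ∫⁻ θ in Ioc 0 (2 * Real.pi), ‖restPer (circleMap 0 t θ) ρ c V - 1‖ₑ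

theorem measurable_restPer_circleMap (t : ℝ) : Measurable
    fun p : ((X → ℂ) × (X → ℂ) × (X × X → ℂ)) × ℝ =>
      ‖restPer (circleMap 0 t p.2) p.1.1 p.1.2.1 p.1.2.2 - 1‖ₑ := by
  have h1 : Measurable fun p : ((X → ℂ) × (X → ℂ) × (X × X → ℂ)) × ℝ =>
      (circleMap 0 t p.2, p.1) :=
    (((continuous_circleMap 0 t).measurable.comp measurable_snd)).prodMk measurable_fst
  exact ((measurable_restPer.comp h1).sub_const 1).enorm

theorem measurable_circleDev (t : ℝ) : Measurable
    fun p : (X → ℂ) × (X → ℂ) × (X × X → ℂ) => circleDev t p.1 p.2.1 p.2.2 :=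
  (measurable_restPer_circleMap t).lintegral_prod_right'

/-- Tonelli: the bound for the mean deviation is uniform in the point of the circle, with the means
`ρ` and `c` held fixed. -/
theorem lintegral_circleDev_le [Nonempty X] {t K : ℝ} {ρ c : X → ℂ} (ht : 0 ≤ t)
    (hρ : ∀ i, t * ‖ρ i‖ ≤ 1 / 4)
    (hc : ∀ i, t * ‖c i‖ ≤ 1 / 4) (hc0 : ∑ i, c i = 0) (hρK : ∑ i, ‖ρ i‖ ^ 2 ≤ K)
    (hcK : ∑ i, ‖c i‖ ^ 2 ≤ K) {D Y : ℝ} (hD : D = 16 * t ^ 2 * K + 1)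
    (hY1 : t ^ 2 * (2 * D ^ 2 + 2 * Fintype.card X) / Fintype.card X ^ 2 ≤ Y)
    (hY2 : (2 * D ^ 3 + 2 * D ^ 2) / Fintype.card X ^ 2 ≤ Y)
    {η : ℝ} (hη : 0 < η) (hη2 : η ≤ 1 / 2) (hYη : Real.exp 22 * Y ≤ η ^ 2) :
    ∫⁻ W, circleDev t ρ c (matMap (matProj X) W) ∂(gaussianVec (X × X)) ≤
      ENNReal.ofReal (6 * η) * ENNReal.ofReal (2 * Real.pi) := by
  unfold circleDev
  rw [lintegral_lintegral_swap]
  · refine (lintegral_mono (g := fun _ => ENNReal.ofReal (6 * η)) fun θ =>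
      lintegral_restPer_sub_one_le (t := t) ?_ hρ hc hc0 hρK hcK hD hY1 hY2 hη hη2 hYη).trans ?_
    · rw [norm_circleMap_zero, abs_of_nonneg ht]
    · rw [lintegral_const, Measure.restrict_apply_univ, Real.volume_Ioc, sub_zero]
  · have h1 : Measurable fun p : (X × X → ℂ) × ℝ =>
        (((ρ, c, matMap (matProj X) p.1) : (X → ℂ) × (X → ℂ) × (X × X → ℂ)), p.2) := by
      have := (matMap (matProj X)).continuous.measurable
      fun_prop
    exact ((measurable_restPer_circleMap t).comp h1).aemeasurable

/-- Conditioning on the means: `W` keeps its row and column means, while its doubly centred part is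
replaced by that of an independent `V`. -/
theorem lintegral_gaussianVec_mix [Nonempty X] {G : (X × X → ℂ) → ENNReal} (hG : Measurable G) :
    ∫⁻ W, G W ∂(gaussianVec (X × X)) = ∫⁻ W, ∫⁻ V,
      G (W - matMap (matProj X) W + matMap (matProj X) V) ∂(gaussianVec (X × X))
        ∂(gaussianVec (X × X)) := by
  have hmix : Measurable fun q : (X × X → ℂ) × (X × X → ℂ) =>
      q.2 - matMap (matProj X) q.2 + matMap (matProj X) q.1 := by
    have := (matMap (matProj X)).continuous.measurable
    fun_prop
  have e := map_mix_gaussianVec (matProj X) matProj_symm matProj_idem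
  calc _ = ∫⁻ W, G W ∂(((gaussianVec (X × X)).prod (gaussianVec (X × X))).map
      (fun q => q.2 - matMap (matProj X) q.2 + matMap (matProj X) q.1)) := by rw [e]
    _ = ∫⁻ q, G (q.2 - matMap (matProj X) q.2 + matMap (matProj X) q.1)
        ∂((gaussianVec (X × X)).prod (gaussianVec (X × X))) := lintegral_map hG hmix
    _ = _ := lintegral_prod_symm' _ (hG.comp hmix)

theorem measurable_circleDev_means (t : ℝ) : Measurable fun W : X × X → ℂ =>
    circleDev t (rowMean W) (colDev W) (matMap (matProj X) W) := by
  have h0 : Measurable fun W : X × X → ℂ => matMap (matProj X) W :=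
    (matMap (matProj X)).continuous.measurable
  have h1 : Measurable fun W : X × X → ℂ => rowMean W :=
    measurable_pi_lambda _ fun i => measurable_rowMean i
  have h2 : Measurable fun W : X × X → ℂ => colDev W :=
    measurable_pi_lambda _ fun i => measurable_colDev i
  have h3 := (measurable_circleDev (X := X) t).comp (h1.prodMk (h2.prodMk h0))
  simpa only [Function.comp_def] using h3

/-- Membership in `smallMeans` depends on the means alone, so it survives the resampling of the
centred part. Markov's inequality at the threshold `π/2` turns `6η * 2π` into `24η`. -/
theorem measure_circleDev_ge_le [Nonempty X] {t K : ℝ} (ht : 0 ≤ t) (hK : 0 ≤ K)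
    (hs : t ^ 8 * (K ^ 4 / (Fintype.card X : ℝ) ^ 3) ≤ (1 / 4) ^ 8)
    {D Y : ℝ} (hD : D = 16 * t ^ 2 * K + 1)
    (hY1 : t ^ 2 * (2 * D ^ 2 + 2 * Fintype.card X) / Fintype.card X ^ 2 ≤ Y)
    (hY2 : (2 * D ^ 3 + 2 * D ^ 2) / Fintype.card X ^ 2 ≤ Y)
    {η : ℝ} (hη : 0 < η) (hη2 : η ≤ 1 / 2) (hYη : Real.exp 22 * Y ≤ η ^ 2) :
    gaussianVec (X × X) {W | W ∈ smallMeans X K ∧ ENNReal.ofReal (Real.pi / 2) ≤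
      circleDev t (rowMean W) (colDev W) (matMap (matProj X) W)} ≤ ENNReal.ofReal (24 * η) := by
  set μ := gaussianVec (X × X)
  set L := matMap (matProj X)
  set G : (X × X → ℂ) → ENNReal := (smallMeans X K).indicator
    fun W => circleDev t (rowMean W) (colDev W) (L W) with hG
  have hGm : Measurable G := by
    refine Measurable.indicator ?_ (measurableSet_smallMeans K)
    exact measurable_circleDev_means t
  have hint : ∫⁻ W, G W ∂μ ≤ ENNReal.ofReal (6 * η) * ENNReal.ofReal (2 * Real.pi) := by
    rw [lintegral_gaussianVec_mix hGm]
    change ∫⁻ W, ∫⁻ V, G (W - L W + L V) ∂μ ∂μ ≤ _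
    refine (lintegral_mono (g := fun _ => ENNReal.ofReal (6 * η) *
      ENNReal.ofReal (2 * Real.pi)) fun W => ?_).trans (by simp)
    have hr : ∀ V, rowMean (W - L W + L V) = rowMean W := fun V => funext (rowMean_mix W V)
    have hc : ∀ V, colDev (W - L W + L V) = colDev W := fun V => funext (colDev_mix W V)
    have hl : ∀ V, L (W - L W + L V) = L V := fun V => by
      rw [map_add, map_sub, matMap_matProj_matMap, matMap_matProj_matMap, sub_self, zero_add]
    by_cases hW : W ∈ smallMeans X K
    · have hm : ∀ V, W - L W + L V ∈ smallMeans X K := by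
        intro V
        simpa only [smallMeans, mem_setOf_eq, hr, hc] using hW
      have : ∀ V, G (W - L W + L V) = circleDev t (rowMean W) (colDev W) (L V) := by
        intro V
        rw [hG, indicator_of_mem (hm V), hr, hc, hl]
      simp only [this]
      exact lintegral_circleDev_le ht (mul_norm_le_of_sum_pow_eight hW.1 hs)
        (mul_norm_le_of_sum_pow_eight hW.2 hs) (sum_colDev W)
        (sum_sq_le_of_sum_pow_eight hK hW.1) (sum_sq_le_of_sum_pow_eight hK hW.2) hD hY1 hY2 hη
        hη2 hYη
    · have hm : ∀ V, W - L W + L V ∉ smallMeans X K := by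
        intro V
        simpa only [smallMeans, mem_setOf_eq, hr, hc] using hW
      have : ∀ V, G (W - L W + L V) = 0 := fun V => by
        rw [hG, indicator_of_notMem (hm V)]
      simp only [this, lintegral_zero, zero_le]
  have hpi : (0 : ℝ) < Real.pi / 2 := by positivity
  have hM := meas_ge_le_lintegral_div (μ := μ) hGm.aemeasurable
    (ε := ENNReal.ofReal (Real.pi / 2)) (by simpa using Real.pi_pos) ENNReal.ofReal_ne_top
  refine (measure_mono fun W hW => ?_).trans (hM.trans ?_)
  · rw [mem_setOf_eq, hG, indicator_of_mem hW.1]; exact hW.2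
  · rw [ENNReal.div_le_iff (by simpa using Real.pi_pos) ENNReal.ofReal_ne_top]
    refine hint.trans (le_of_eq ?_)
    rw [← ENNReal.ofReal_mul (by positivity), ← ENNReal.ofReal_mul (by positivity)]
    congr 1; ring

end CircleAverage

/-! ### Zero-freeness in a disk -/

/-- Cauchy's formula: for `‖z‖ ≤ t/2` the kernel `t / ‖w - z‖` is at most `2`. An `L¹` bound on a
single circle thus becomes a uniform bound inside, and no union bound over points of the disk is
required. -/
theorem norm_le_of_lintegral_circleMap {f : ℂ → ℂ} {t ε : ℝ} (ht : 0 < t)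
    (hf : DifferentiableOn ℂ f (Metric.closedBall 0 t)) (hε : 0 ≤ ε)
    (h : ∫⁻ θ in Ioc 0 (2 * Real.pi), ‖f (circleMap 0 t θ)‖ₑ ≤ ENNReal.ofReal (2 * Real.pi * ε))
    {z : ℂ} (hz : ‖z‖ ≤ t / 2) : ‖f z‖ ≤ 2 * ε := by
  have hd : DiffContOnCl ℂ f (Metric.ball 0 t) := by
    refine DifferentiableOn.diffContOnCl ?_
    rwa [closure_ball 0 ht.ne']
  have hzb : z ∈ Metric.ball (0 : ℂ) t := by rw [mem_ball_zero_iff]; linarith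
  have hC := hd.two_pi_i_inv_smul_circleIntegral_sub_inv_smul hzb
  rw [← hC, norm_smul]
  have hpi := Real.pi_pos
  have h1 : ‖∮ w in C(0, t), (w - z)⁻¹ • f w‖ₑ ≤ ENNReal.ofReal (2 * (2 * Real.pi * ε)) := by
    rw [circleIntegral, intervalIntegral.integral_of_le (by positivity)]
    refine (enorm_integral_le_lintegral_enorm _).trans ?_
    have h2 : ∀ θ : ℝ, ‖deriv (circleMap 0 t) θ • ((circleMap 0 t θ - z)⁻¹ • f (circleMap 0 t θ))‖ₑ ≤
        ENNReal.ofReal 2 * ‖f (circleMap 0 t θ)‖ₑ := by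
      intro θ
      rw [← ofReal_norm_eq_enorm, ← ofReal_norm_eq_enorm, ← ENNReal.ofReal_mul (by norm_num)]
      refine ENNReal.ofReal_le_ofReal ?_
      rw [norm_smul, norm_smul, ← mul_assoc]
      refine mul_le_mul_of_nonneg_right ?_ (norm_nonneg _)
      have h3 : t / 2 ≤ ‖circleMap 0 t θ - z‖ := by
        have := norm_sub_norm_le (circleMap 0 t θ) z
        rw [norm_circleMap_zero, abs_of_pos ht] at this
        linarith
      rw [deriv_circleMap, norm_mul, norm_circleMap_zero, Complex.norm_I, mul_one, abs_of_pos ht,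
        norm_inv, ← div_eq_mul_inv, div_le_iff₀ (by linarith)]
      linarith
    refine (lintegral_mono h2).trans ?_
    rw [lintegral_const_mul' _ _ ENNReal.ofReal_ne_top, ENNReal.ofReal_mul (by norm_num)]
    gcongr
  rw [← ofReal_norm_eq_enorm, ENNReal.ofReal_le_ofReal_iff (by positivity)] at h1
  have h3 : ‖(2 * (Real.pi : ℂ) * Complex.I)⁻¹‖ = (2 * Real.pi)⁻¹ := by
    rw [norm_inv, norm_mul, norm_mul, Complex.norm_I, Complex.norm_real, Real.norm_eq_abs,
      abs_of_pos hpi]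
    simp
  rw [h3, inv_mul_le_iff₀ (by positivity)]
  linarith

section Branch

variable {X : Type*} [Fintype X] [DecidableEq X]

theorem differentiableAt_rowInv {ρ : X → ℂ} {z : ℂ} {i : X} (h : 1 + z * ρ i ≠ 0) :
    DifferentiableAt ℂ (fun z => rowInv z ρ i) z := by
  unfold rowInv
  exact DifferentiableAt.inv (by fun_prop) h

theorem differentiableAt_meanInv {ρ : X → ℂ} {z : ℂ} (h : ∀ i, 1 + z * ρ i ≠ 0) :
    DifferentiableAt ℂ (fun z => meanInv z ρ) z := by
  unfold meanInv
  exact (DifferentiableAt.fun_sum fun i _ => differentiableAt_rowInv (h i)).const_mul _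

theorem differentiableAt_colInv {ρ c : X → ℂ} {z : ℂ} (h : ∀ i, 1 + z * ρ i ≠ 0) {j : X}
    (h2 : 1 + z * meanInv z ρ * c j ≠ 0) : DifferentiableAt ℂ (fun z => colInv z ρ c j) z := by
  have := differentiableAt_meanInv h
  unfold colInv
  exact DifferentiableAt.inv (by fun_prop) h2

theorem differentiableAt_restPer {ρ c : X → ℂ} {V : X × X → ℂ} {z : ℂ}
    (h : ∀ i, 1 + z * ρ i ≠ 0) (h2 : ∀ j, 1 + z * meanInv z ρ * c j ≠ 0) :
    DifferentiableAt ℂ (fun z => restPer z ρ c V) z := by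
  have h3 := differentiableAt_meanInv h
  have h4 := fun i => differentiableAt_rowInv (h i)
  have h5 := fun j => differentiableAt_colInv h (h2 j)
  unfold restPer centredPer
  refine DifferentiableAt.div_const (DifferentiableAt.fun_sum fun σ _ => ?_) _
  refine DifferentiableAt.fun_finset_prod fun v _ => ?_
  have := h4 v
  have := h5 (σ v)
  fun_prop

theorem restPer_zero (ρ c : X → ℂ) (V : X × X → ℂ) [Nonempty X] : restPer 0 ρ c V = 1 := by
  have h : ((Fintype.card X).factorial : ℂ) ≠ 0 := by exact_mod_cast Nat.factorial_ne_zero _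
  simp [restPer, centredPer, Fintype.card_perm, h]

theorem norm_log_one_add_le {u : ℂ} (h : ‖u‖ ≤ 1 / 2) : ‖Complex.log (1 + u)‖ ≤ 1 := by
  have := Complex.norm_log_one_add_half_le_self h
  linarith

/-- Existence of a bounded analytic branch of the logarithm of the permanent. -/
def HasLogBranch (W : X × X → ℂ) (R B : ℝ) : Prop :=
  ∃ g : ℂ → ℂ, AnalyticOnNhd ℂ g (Metric.closedBall 0 R) ∧ g 0 = 0 ∧
    ∀ z ∈ Metric.closedBall (0 : ℂ) R,
      Complex.exp (g z) = (∑ σ : Equiv.Perm X, ∏ v, (1 + z * W (v, σ v))) /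
        ((Fintype.card X).factorial : ℂ) ∧ ‖g z‖ ≤ B

theorem one_add_mem_slitPlane {u : ℂ} (h : ‖u‖ ≤ 1 / 2) : 1 + u ∈ Complex.slitPlane :=
  Complex.mem_slitPlane_of_norm_lt_one (by linarith)

/-- The threshold `π/2 = 2π * (1/4)` gives `‖restPer - 1‖ ≤ 1/2` on the disk of radius `t/2`. All
factors then stay in the slit plane, and the principal logarithms add up to a branch of size at most
`2n + 1`. This crude bound is enough, since it only serves the tail of the Taylor series. -/
theorem hasLogBranch_of_circleDev_lt [Nonempty X] {W : X × X → ℂ} {t : ℝ} (ht : 0 < t)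
    (hρ : ∀ i, t * ‖rowMean W i‖ ≤ 1 / 4) (hc : ∀ i, t * ‖colDev W i‖ ≤ 1 / 4)
    (h : circleDev t (rowMean W) (colDev W) (matMap (matProj X) W) ≤
      ENNReal.ofReal (Real.pi / 2)) :
    HasLogBranch W (t / 4) (3 * Fintype.card X) := by
  set ρ := rowMean W
  set c := colDev W
  set V := matMap (matProj X) W
  have s1 : ∀ {z : ℂ}, ‖z‖ ≤ t → ∀ i, ‖z * ρ i‖ ≤ 1 / 2 := fun hz i =>
    (norm_mul_le_of_small hz hρ i).trans (by norm_num)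
  have s2 : ∀ {z : ℂ}, ‖z‖ ≤ t → ∀ i, ‖z * meanInv z ρ * c i‖ ≤ 1 / 2 := fun hz i =>
    (norm_mul_meanInv_mul_le hz hρ hc i).2
  have n1 : ∀ {z : ℂ}, ‖z‖ ≤ t → ∀ i, 1 + z * ρ i ≠ 0 := fun hz i =>
    one_add_ne_zero_of_norm_le (s1 hz i)
  have n2 : ∀ {z : ℂ}, ‖z‖ ≤ t → ∀ i, 1 + z * meanInv z ρ * c i ≠ 0 := fun hz i =>
    one_add_ne_zero_of_norm_le (s2 hz i)
  have hdiff : ∀ z : ℂ, ‖z‖ ≤ t → DifferentiableAt ℂ (fun z => restPer z ρ c V) z :=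
    fun z hz => differentiableAt_restPer (n1 hz) (n2 hz)
  have hQ : ∀ z : ℂ, ‖z‖ ≤ t / 2 → ‖restPer z ρ c V - 1‖ ≤ 1 / 2 := by
    intro z hz
    have := norm_le_of_lintegral_circleMap (f := fun z => restPer z ρ c V - 1) (ε := 1 / 4) ht
      (fun z hz => ((hdiff z (by simpa using hz)).sub_const 1).differentiableWithinAt)
      (by norm_num) (by
        rw [show 2 * Real.pi * (1 / 4) = Real.pi / 2 by ring]; exact h) hz
    norm_num at this ⊢
    exact this
  set g : ℂ → ℂ := fun z => ∑ i, Complex.log (1 + z * ρ i) +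
    ∑ j, Complex.log (1 + z * meanInv z ρ * c j) + Complex.log (1 + (restPer z ρ c V - 1)) with hg
  refine ⟨g, ?_, ?_, ?_⟩
  · have hd : DifferentiableOn ℂ g (Metric.ball 0 (t / 2)) := by
      intro z hz
      have hz2 : ‖z‖ ≤ t / 2 := by
        rw [mem_ball_zero_iff] at hz; exact hz.le
      have hz1 : ‖z‖ ≤ t := by linarith
      have d1 := differentiableAt_meanInv (n1 hz1)
      have d2 := hdiff z hz1
      refine DifferentiableAt.differentiableWithinAt ?_
      refine ((DifferentiableAt.fun_sum fun i _ => ?_).add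
        (DifferentiableAt.fun_sum fun j _ => ?_)).add ?_
      · exact DifferentiableAt.clog (by fun_prop) (one_add_mem_slitPlane (s1 hz1 i))
      · exact DifferentiableAt.clog (by fun_prop) (one_add_mem_slitPlane (s2 hz1 j))
      · exact DifferentiableAt.clog (by fun_prop) (one_add_mem_slitPlane (hQ z hz2))
    exact (hd.analyticOnNhd Metric.isOpen_ball).mono (Metric.closedBall_subset_ball (by linarith))
  · simp [hg, restPer_zero]
  · intro z hz
    rw [mem_closedBall_zero_iff] at hz
    have hz2 : ‖z‖ ≤ t / 2 := by linarith
    have hz1 : ‖z‖ ≤ t := by linarith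
    constructor
    · rw [permanent_eq_mul_restPer z W (n1 hz1) (n2 hz1)]
      simp only [hg]
      rw [Complex.exp_add, Complex.exp_add, Complex.exp_sum, Complex.exp_sum,
        Complex.exp_log (one_add_ne_zero_of_norm_le (hQ z hz2)), add_sub_cancel]
      congr 2
      · exact Finset.prod_congr rfl fun i _ => Complex.exp_log (n1 hz1 i)
      · exact Finset.prod_congr rfl fun i _ => Complex.exp_log (n2 hz1 i)
    · have hn : (1 : ℝ) ≤ Fintype.card X := by exact_mod_cast Fintype.card_pos
      have b1 : ‖∑ i, Complex.log (1 + z * ρ i)‖ ≤ Fintype.card X := by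
        refine (norm_sum_le _ _).trans ((Finset.sum_le_card_nsmul _ _ 1 fun i _ =>
          norm_log_one_add_le (s1 hz1 i)).trans (by simp))
      have b2 : ‖∑ i, Complex.log (1 + z * meanInv z ρ * c i)‖ ≤ Fintype.card X := by
        refine (norm_sum_le _ _).trans ((Finset.sum_le_card_nsmul _ _ 1 fun i _ =>
          norm_log_one_add_le (s2 hz1 i)).trans (by simp))
      have b3 := norm_log_one_add_le (hQ z hz2)
      have b4 := norm_add₃_le (a := ∑ i, Complex.log (1 + z * ρ i))
        (b := ∑ i, Complex.log (1 + z * meanInv z ρ * c i))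
        (c := Complex.log (1 + (restPer z ρ c V - 1)))
      simp only [hg]
      linarith

theorem measure_not_hasLogBranch_le [Nonempty X] {t K : ℝ} (ht : 0 < t) (hK : 0 < K)
    (hs : t ^ 8 * (K ^ 4 / (Fintype.card X : ℝ) ^ 3) ≤ (1 / 4) ^ 8)
    {D Y : ℝ} (hD : D = 16 * t ^ 2 * K + 1)
    (hY1 : t ^ 2 * (2 * D ^ 2 + 2 * Fintype.card X) / Fintype.card X ^ 2 ≤ Y)
    (hY2 : (2 * D ^ 3 + 2 * D ^ 2) / Fintype.card X ^ 2 ≤ Y)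
    {η : ℝ} (hη : 0 < η) (hη2 : η ≤ 1 / 2) (hYη : Real.exp 22 * Y ≤ η ^ 2) :
    gaussianVec (X × X) {W | ¬ HasLogBranch W (t / 4) (3 * Fintype.card X)} ≤
      ENNReal.ofReal (48 / K ^ 4 + 24 * η) := by
  refine (measure_mono (t := (smallMeans X K)ᶜ ∪ {W | W ∈ smallMeans X K ∧
    ENNReal.ofReal (Real.pi / 2) ≤ circleDev t (rowMean W) (colDev W) (matMap (matProj X) W)})
    fun W hW => ?_).trans ((measure_union_le _ _).trans ?_)
  · by_contra hcon
    simp only [mem_union, mem_compl_iff, mem_setOf_eq, not_or, not_not, not_and, not_le] at hcon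
    exact hW (hasLogBranch_of_circleDev_lt ht (mul_norm_le_of_sum_pow_eight hcon.1.1 hs)
      (mul_norm_le_of_sum_pow_eight hcon.1.2 hs) (hcon.2 hcon.1).le)
  · rw [ENNReal.ofReal_add (by positivity) (by positivity)]
    exact add_le_add (measure_compl_smallMeans_le hK)
      (measure_circleDev_ge_le ht.le hK.le hs hD hY1 hY2 hη hη2 hYη)

end Branch

/-! ### The zero-free disk of radius `n ^ (1 / 3 - β)` -/

theorem tendsto_rpow_pow_div_pow {α : ℝ} {k m : ℕ} (h : k * α < m) :
    Filter.Tendsto (fun n : ℕ => ((n : ℝ) ^ α) ^ k / (n : ℝ) ^ m) Filter.atTop (nhds 0) := by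
  have h1 := (tendsto_rpow_neg_atTop (sub_pos.2 h)).comp tendsto_natCast_atTop_atTop
  refine h1.congr' ?_
  filter_upwards [Filter.eventually_gt_atTop 0] with n hn
  have hn0 : (0 : ℝ) < n := by exact_mod_cast hn
  simp only [Function.comp_apply]
  rw [neg_sub, Real.rpow_sub hn0, Real.rpow_natCast, mul_comm, Real.rpow_mul hn0.le,
    Real.rpow_natCast]

/-- Used with `t = 4 * n ^ (1/3 - β)`. Since `D` is of order `t²`, the conditions ask that `t ^ 6 /
n ^ 2` and smaller terms tend to zero; this is the place where the exponent must be below `1/3`. -/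
theorem eventually_measure_not_hasLogBranch_le {β δ : ℝ} (hβ : 0 < β) (hδ : 0 < δ) :
    ∀ᶠ n : ℕ in Filter.atTop, gaussianVec (Fin n × Fin n)
      {W | ¬ HasLogBranch W ((n : ℝ) ^ (1 / 3 - β)) (3 * n)} ≤ ENNReal.ofReal δ := by
  set p : ℕ → ℝ := fun n => (n : ℝ) ^ (1 / 3 - β) with hp
  -- With these choices `48 / K ^ 4 ≤ δ/2` and `24η ≤ δ/2`.
  set K : ℝ := 96 / δ + 1 with hK
  have hK1 : 1 ≤ K := by rw [hK]; have : 0 < 96 / δ := by positivity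
                         linarith
  have hK0 : 0 < K := by linarith
  set η : ℝ := min (1 / 2) (δ / 48) with hη
  have hη0 : 0 < η := by rw [hη]; positivity
  have hη1 : η ≤ 1 / 2 := min_le_left _ _
  have hη2 : η ≤ δ / 48 := min_le_right _ _
  have T := fun k m h => tendsto_rpow_pow_div_pow (α := 1 / 3 - β) (k := k) (m := m) h
  have t83 := T 8 3 (by push_cast; linarith)
  have t62 := T 6 2 (by push_cast; linarith)
  have t42 := T 4 2 (by push_cast; linarith)
  have t22 := T 2 2 (by push_cast; linarith)
  have t21 := T 2 1 (by push_cast; linarith)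
  have t02 := T 0 2 (by push_cast; linarith)
  have l1 : Filter.Tendsto (fun n : ℕ => (4 * p n) ^ 8 * (K ^ 4 / (n : ℝ) ^ 3)) Filter.atTop
      (nhds 0) := by
    have := t83.const_mul (4 ^ 8 * K ^ 4)
    rw [mul_zero] at this
    refine this.congr fun n => ?_
    simp only [hp]; ring
  have l2 : Filter.Tendsto (fun n : ℕ => (4 * p n) ^ 2 *
      (2 * (16 * (4 * p n) ^ 2 * K + 1) ^ 2 + 2 * n) / (n : ℝ) ^ 2) Filter.atTop (nhds 0) := by
    have := (((t62.const_mul (32 * (256 * K) ^ 2)).add (t42.const_mul (64 * (256 * K)))).add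
      (t22.const_mul 32)).add (t21.const_mul 32)
    simp only [mul_zero, add_zero] at this
    refine this.congr' ?_
    filter_upwards [Filter.eventually_gt_atTop 0] with n hn
    have hn0 : (n : ℝ) ≠ 0 := by exact_mod_cast hn.ne'
    simp only [hp]
    field_simp
    ring
  have l3 : Filter.Tendsto (fun n : ℕ => (2 * (16 * (4 * p n) ^ 2 * K + 1) ^ 3 +
      2 * (16 * (4 * p n) ^ 2 * K + 1) ^ 2) / (n : ℝ) ^ 2) Filter.atTop (nhds 0) := by
    have := (((t62.const_mul (2 * (256 * K) ^ 3)).add (t42.const_mul (8 * (256 * K) ^ 2))).add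
      (t22.const_mul (10 * (256 * K)))).add (t02.const_mul 4)
    simp only [mul_zero, add_zero] at this
    refine this.congr' ?_
    filter_upwards [Filter.eventually_gt_atTop 0] with n hn
    have hn0 : (n : ℝ) ≠ 0 := by exact_mod_cast hn.ne'
    simp only [hp]
    field_simp
    ring
  have hYpos : 0 < η ^ 2 / Real.exp 22 := by positivity
  filter_upwards [Filter.eventually_gt_atTop 0,
    l1.eventually_le_const (show (0 : ℝ) < (1 / 4) ^ 8 by norm_num),
    l2.eventually_le_const hYpos, l3.eventually_le_const hYpos] with n hn h1 h2 h3
  have hn0 : (0 : ℝ) < n := by exact_mod_cast hn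
  have : Nonempty (Fin n) := ⟨⟨0, hn⟩⟩
  have hp0 : 0 < p n := by simp only [hp]; positivity
  have key := measure_not_hasLogBranch_le (X := Fin n) (t := 4 * p n) (K := K)
    (D := 16 * (4 * p n) ^ 2 * K + 1) (Y := η ^ 2 / Real.exp 22) (by positivity) hK0
    (by rw [Fintype.card_fin]; exact h1) rfl (by rw [Fintype.card_fin]; exact h2)
    (by rw [Fintype.card_fin]; exact h3) hη0 hη1
    (le_of_eq (by field_simp))
  rw [Fintype.card_fin, show 4 * p n / 4 = p n by ring] at key
  refine key.trans (ENNReal.ofReal_le_ofReal ?_)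
  have h4 : 48 / K ^ 4 ≤ δ / 2 := by
    have : K ≤ K ^ 4 := le_self_pow₀ hK1 (by norm_num)
    rw [div_le_iff₀ (by positivity)]
    have h5 : 96 ≤ δ * K := by
      rw [hK, mul_add, mul_div_cancel₀ _ hδ.ne']; linarith
    nlinarith
  linarith

/-! ### The shuffle algebra -/

section ShuffleAlgebra

/-- The shuffle product of two functions on lists, evaluated at a list. -/
def shuffleMul {X : Type*} : List X → (List X → ℂ) → (List X → ℂ) → ℂ
  | [], f, g => f [] * g []
  | x :: L, f, g => shuffleMul L (fun M => f (x :: M)) g + shuffleMul L f (fun M => g (x :: M))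

/-- Functions on lists, with the shuffle product. -/
def Shuffle (X : Type*) := List X → ℂ

namespace Shuffle

variable {X : Type*}

instance : AddCommGroup (Shuffle X) := inferInstanceAs (AddCommGroup (List X → ℂ))

instance : Module ℂ (Shuffle X) := inferInstanceAs (Module ℂ (List X → ℂ))

instance : Mul (Shuffle X) := ⟨fun f g L => shuffleMul L f g⟩

/-- The derivation at the letter `x`. -/
def der (x : X) (f : Shuffle X) : Shuffle X := fun L => f (x :: L)

theorem der_apply (x : X) (f : Shuffle X) (L : List X) : der x f L = f (x :: L) := rfl

theorem add_apply (f g : Shuffle X) (L : List X) : (f + g) L = f L + g L := rfl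

theorem sub_apply (f g : Shuffle X) (L : List X) : (f - g) L = f L - g L := rfl

theorem neg_apply (f : Shuffle X) (L : List X) : (-f) L = -f L := rfl

theorem zero_apply (L : List X) : (0 : Shuffle X) L = 0 := rfl

theorem smul_apply (c : ℂ) (f : Shuffle X) (L : List X) : (c • f) L = c * f L := rfl

theorem mul_nil (f g : Shuffle X) : (f * g) [] = f [] * g [] := rfl

theorem mul_cons (f g : Shuffle X) (x : X) (L : List X) :
    (f * g) (x :: L) = (der x f * g) L + (f * der x g) L := rfl

theorem der_add (x : X) (f g : Shuffle X) : der x (f + g) = der x f + der x g := rfl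

theorem der_sub (x : X) (f g : Shuffle X) : der x (f - g) = der x f - der x g := rfl

theorem der_smul (x : X) (c : ℂ) (f : Shuffle X) : der x (c • f) = c • der x f := rfl

theorem der_mul (x : X) (f g : Shuffle X) : der x (f * g) = der x f * g + f * der x g := rfl

protected theorem mul_comm' (f g : Shuffle X) : f * g = g * f := by
  funext L
  induction L generalizing f g with
  | nil => rw [mul_nil, mul_nil, mul_comm]
  | cons x L ih => rw [mul_cons, mul_cons, ih, ih f, add_comm]

protected theorem add_mul' (f g h : Shuffle X) : (f + g) * h = f * h + g * h := by
  funext L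
  induction L generalizing f g h with
  | nil => simp only [mul_nil, add_apply, add_mul]
  | cons x L ih =>
    rw [add_apply]
    simp only [mul_cons, der_add, ih, add_apply]
    ring

protected theorem mul_add' (f g h : Shuffle X) : f * (g + h) = f * g + f * h := by
  rw [Shuffle.mul_comm', Shuffle.add_mul', Shuffle.mul_comm' g, Shuffle.mul_comm' h]

protected theorem zero_mul' (f : Shuffle X) : 0 * f = 0 := by
  have := Shuffle.add_mul' 0 0 f
  rwa [add_zero, left_eq_add] at this

protected theorem mul_assoc' (f g h : Shuffle X) : f * g * h = f * (g * h) := by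
  funext L
  induction L generalizing f g h with
  | nil => simp only [mul_nil, mul_assoc]
  | cons x L ih =>
    simp only [mul_cons, der_mul, Shuffle.add_mul', Shuffle.mul_add', add_apply, ih]
    ring

theorem smul_mul' (c : ℂ) (f g : Shuffle X) : (c • f) * g = c • (f * g) := by
  funext L
  induction L generalizing f g with
  | nil => simp only [mul_nil, smul_apply, mul_assoc]
  | cons x L ih => simp only [mul_cons, smul_apply, der_smul, ih, mul_add]

/-- The unit: the indicator function of the empty list. -/
instance : One (Shuffle X) := ⟨fun L => L.casesOn 1 fun _ _ => 0⟩

theorem one_nil : (1 : Shuffle X) [] = 1 := rfl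

theorem der_one (x : X) : der x (1 : Shuffle X) = 0 := rfl

protected theorem one_mul' (f : Shuffle X) : 1 * f = f := by
  funext L
  induction L generalizing f with
  | nil => rw [mul_nil, one_nil, one_mul]
  | cons x L ih => rw [mul_cons, der_one, Shuffle.zero_mul', zero_apply, ih, zero_add, der_apply]

instance : CommRing (Shuffle X) :=
  { (inferInstance : AddCommGroup (Shuffle X)) with
    mul := (· * ·)
    one := 1
    mul_comm := Shuffle.mul_comm'
    mul_assoc := Shuffle.mul_assoc'
    one_mul := Shuffle.one_mul'
    mul_one := fun f => by rw [Shuffle.mul_comm', Shuffle.one_mul']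
    left_distrib := Shuffle.mul_add'
    right_distrib := Shuffle.add_mul'
    zero_mul := Shuffle.zero_mul'
    mul_zero := fun f => by rw [Shuffle.mul_comm', Shuffle.zero_mul'] }

/-- Two functions agree on lists of length at most `k`. -/
def EqUpTo (k : ℕ) (f g : Shuffle X) : Prop := ∀ L : List X, L.length ≤ k → f L = g L

theorem EqUpTo.refl (k : ℕ) (f : Shuffle X) : EqUpTo k f f := fun _ _ => rfl

theorem EqUpTo.mul {k : ℕ} {f f' g g' : Shuffle X} (hf : EqUpTo k f f') (hg : EqUpTo k g g') :
    EqUpTo k (f * g) (f' * g') := by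
  intro L hL
  induction L generalizing f f' g g' k with
  | nil => rw [mul_nil, mul_nil, hf [] hL, hg [] hL]
  | cons x L ih =>
    rw [List.length_cons] at hL
    obtain ⟨k, rfl⟩ : ∃ m, k = m + 1 := ⟨k - 1, by omega⟩
    have h1 : ∀ {f f' : Shuffle X}, EqUpTo (k + 1) f f' → EqUpTo k f f' ∧
        EqUpTo k (der x f) (der x f') := fun h =>
      ⟨fun L hL => h L (by omega), fun L hL => h (x :: L) (by simpa using hL)⟩
    rw [mul_cons, mul_cons, ih (h1 hf).2 (h1 hg).1 (by omega), ih (h1 hf).1 (h1 hg).2 (by omega)]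

theorem exists_der_pow_succ (x : X) (u : Shuffle X) (m : ℕ) :
    ∃ g : Shuffle X, der x (u ^ (m + 1)) = u ^ m * g := by
  induction m with
  | zero => exact ⟨der x u, by rw [zero_add, pow_one, pow_zero, one_mul]⟩
  | succ m ihm =>
    obtain ⟨g, hg⟩ := ihm
    refine ⟨g + der x u, ?_⟩
    rw [pow_succ, der_mul, hg]
    ring

/-- Every factor `u` must take at least one letter, so `r` factors vanish on lists shorter than `r`.
Geometric series are therefore finite on each list. -/
theorem pow_eqUpTo_zero {u : Shuffle X} (hu : u [] = 0) (N : ℕ) :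
    ∀ r, N < r → EqUpTo N (u ^ r) 0 := by
  have h0 : ∀ r, 0 < r → (u ^ r) [] = 0 := fun r hr => by
    obtain ⟨r, rfl⟩ : ∃ m, r = m + 1 := ⟨r - 1, by omega⟩
    rw [pow_succ, mul_nil, hu, mul_zero]
  induction N with
  | zero =>
    intro r hr L hL
    rw [List.length_eq_zero_iff.1 (Nat.le_zero.1 hL), h0 r hr]
    rfl
  | succ N ih =>
    intro r hr L hL
    rcases L with _ | ⟨x, L⟩
    · rw [h0 r (by omega)]; rfl
    · obtain ⟨r, rfl⟩ : ∃ m, r = m + 1 := ⟨r - 1, by omega⟩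
      obtain ⟨g, hg⟩ := exists_der_pow_succ x u r
      have h1 := (ih r (by omega)).mul (EqUpTo.refl N g) L (by simpa using hL)
      rw [zero_mul] at h1
      exact (congrFun hg L).trans h1

/-- The inverse of a function with value `1` at the empty list. -/
noncomputable def inv (f : Shuffle X) : Shuffle X :=
  fun L => (∑ r ∈ Finset.range (L.length + 1), (1 - f) ^ r) L

theorem finset_sum_apply {ι : Type*} (s : Finset ι) (F : ι → Shuffle X) (L : List X) :
    (∑ i ∈ s, F i) L = ∑ i ∈ s, F i L := by
  classical
  induction s using Finset.induction_on with
  | empty => rfl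
  | insert a s ha ih => rw [Finset.sum_insert ha, Finset.sum_insert ha, add_apply, ih]

theorem inv_eqUpTo {f : Shuffle X} (hf : f [] = 1) (N : ℕ) :
    EqUpTo N (inv f) (∑ r ∈ Finset.range (N + 1), (1 - f) ^ r) := by
  intro L hL
  have hu : (1 - f) [] = 0 := by rw [sub_apply, one_nil, hf, sub_self]
  rw [inv, finset_sum_apply, finset_sum_apply]
  refine Finset.sum_subset (Finset.range_mono (by omega)) fun r _ hr => ?_
  rw [Finset.mem_range, not_lt] at hr
  rw [pow_eqUpTo_zero hu L.length r (by omega) L le_rfl, zero_apply]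

theorem mul_inv {f : Shuffle X} (hf : f [] = 1) : f * inv f = 1 := by
  funext L
  have hu : (1 - f) [] = 0 := by rw [sub_apply, one_nil, hf, sub_self]
  refine (((EqUpTo.refl L.length f).mul (inv_eqUpTo hf L.length)) L le_rfl).trans ?_
  have h := mul_neg_geom_sum (1 - f) (L.length + 1)
  rw [sub_sub_cancel] at h
  rw [h, sub_apply, pow_eqUpTo_zero hu L.length _ (by omega) L le_rfl, zero_apply, sub_zero]

theorem inv_nil (f : Shuffle X) : inv f [] = 1 := by
  simp [inv, one_nil]

/-- The logarithm of a function with value `1` at the empty list. -/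
noncomputable def log (f : Shuffle X) : Shuffle X
  | [] => 0
  | x :: L => (inv f * der x f) L

theorem der_log (x : X) (f : Shuffle X) : der x (log f) = inv f * der x f := rfl

theorem mul_der_log {f : Shuffle X} (hf : f [] = 1) (x : X) : f * der x (log f) = der x f := by
  rw [der_log, ← mul_assoc, mul_inv hf, one_mul]

theorem eq_of_mul_eq {f g h : Shuffle X} (hf : f [] = 1) (e : f * g = f * h) : g = h := by
  linear_combination (inv f) * e + (h - g) * mul_inv hf

theorem ext_der {f g : Shuffle X} (h0 : f [] = g []) (h : ∀ x, der x f = der x g) : f = g := by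
  funext L
  rcases L with _ | ⟨x, L⟩
  · exact h0
  · exact congrFun (h x) L

theorem der_inv {f : Shuffle X} (hf : f [] = 1) (x : X) :
    der x (inv f) = -(inv f * inv f * der x f) := by
  refine eq_of_mul_eq hf ?_
  have h1 := congrArg (der x) (mul_inv hf)
  rw [der_mul, der_one] at h1
  have h2 := mul_inv hf
  linear_combination h1 + (inv f * der x f) * h2

/-! #### Symmetric functions -/

/-- Invariance under permutations of the list. -/
def Symm (f : Shuffle X) : Prop := ∀ L M : List X, L.Perm M → f L = f M

theorem symm_iff {f : Shuffle X} :
    Symm f ↔ (∀ x, Symm (der x f)) ∧ ∀ x y, der x (der y f) = der y (der x f) := by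
  constructor
  · exact fun h => ⟨fun x L M hLM => h _ _ (hLM.cons x), fun x y => funext fun L =>
      h _ _ (List.Perm.swap _ _ _)⟩
  · rintro ⟨h1, h2⟩ L M hLM
    induction hLM with
    | nil => rfl
    | cons x h _ => exact h1 x _ _ h
    | swap x y l => exact congrFun (h2 x y) l
    | trans _ _ ih1 ih2 => exact ih1.trans ih2

theorem Symm.der {f : Shuffle X} (hf : Symm f) (x : X) : Symm (der x f) := (symm_iff.1 hf).1 x

theorem Symm.der_der {f : Shuffle X} (hf : Symm f) (x y : X) :
    Shuffle.der x (Shuffle.der y f) = Shuffle.der y (Shuffle.der x f) := (symm_iff.1 hf).2 x y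

/-- Invariance under permutations of lists of length at most `k`. -/
def SymmUpTo (k : ℕ) (f : Shuffle X) : Prop :=
  ∀ L M : List X, L.length ≤ k → L.Perm M → f L = f M

theorem symm_of_symmUpTo {f : Shuffle X} (h : ∀ k, SymmUpTo k f) : Symm f :=
  fun L M hLM => h L.length L M le_rfl hLM

theorem symmUpTo_zero (f : Shuffle X) : SymmUpTo 0 f := by
  intro L M hL hLM
  obtain rfl : L = [] := List.length_eq_zero_iff.1 (Nat.le_zero.1 hL)
  rw [List.nil_perm.1 hLM]

theorem symmUpTo_succ {k : ℕ} {f : Shuffle X} (h1 : ∀ x, SymmUpTo k (Shuffle.der x f))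
    (h2 : ∀ x y, Shuffle.der x (Shuffle.der y f) = Shuffle.der y (Shuffle.der x f)) :
    SymmUpTo (k + 1) f := by
  intro L M hL hLM
  induction hLM with
  | nil => rfl
  | cons x h _ => exact h1 x _ _ (by simpa using hL) h
  | swap x y l => exact congrFun (h2 x y) l
  | trans h _ ih1 ih2 => exact (ih1 hL).trans (ih2 (by rwa [← h.length_eq]))

theorem SymmUpTo.add {k : ℕ} {f g : Shuffle X} (hf : SymmUpTo k f) (hg : SymmUpTo k g) :
    SymmUpTo k (f + g) := fun L M hL hLM => by
  rw [add_apply, add_apply, hf L M hL hLM, hg L M hL hLM]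

/-- Induction on the length of the lists: derivatives of the product are sums of products of
symmetric functions, and mixed derivatives commute by the Leibniz rule. -/
theorem Symm.mul {f g : Shuffle X} (hf : Symm f) (hg : Symm g) : Symm (f * g) := by
  have key : ∀ k, ∀ f g : Shuffle X, Symm f → Symm g → SymmUpTo k (f * g) := by
    intro k
    induction k with
    | zero => exact fun f g _ _ => symmUpTo_zero _
    | succ k ih =>
      intro f g hf hg
      refine symmUpTo_succ (fun x => ?_) fun x y => ?_
      · exact (ih _ _ (hf.der x) hg).add (ih _ _ hf (hg.der x))
      · simp only [der_mul, der_add, hf.der_der x y, hg.der_der x y]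
        ring
  exact symm_of_symmUpTo fun k => key k f g hf hg

theorem Symm.sub {f g : Shuffle X} (hf : Symm f) (hg : Symm g) : Symm (f - g) :=
  fun L M hLM => by rw [sub_apply, sub_apply, hf L M hLM, hg L M hLM]

theorem symm_one : Symm (1 : Shuffle X) := by
  intro L M hLM
  rcases L with _ | ⟨x, L⟩
  · rw [List.nil_perm.1 hLM]
  · rcases M with _ | ⟨y, M⟩
    · exact absurd hLM (by simp)
    · rfl

theorem Symm.pow {f : Shuffle X} (hf : Symm f) (r : ℕ) : Symm (f ^ r) := by
  induction r with
  | zero => rw [pow_zero]; exact symm_one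
  | succ r ih => rw [pow_succ]; exact ih.mul hf

theorem Symm.inv {f : Shuffle X} (hf : Symm f) : Symm (inv f) := by
  intro L M hLM
  rw [Shuffle.inv, Shuffle.inv, finset_sum_apply, finset_sum_apply, hLM.length_eq]
  exact Finset.sum_congr rfl fun r _ => (symm_one.sub hf).pow r L M hLM

/-- The mixed derivative of `log f` is `inv f * der x (der y f) - inv f * inv f * der x f * der y
f`, which is symmetric in `x` and `y`. -/
theorem Symm.log {f : Shuffle X} (h1 : f [] = 1) (hf : Symm f) : Symm (log f) := by
  refine symm_iff.2 ⟨fun x => hf.inv.mul (hf.der x), fun x y => ?_⟩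
  rw [der_log, der_log, der_mul, der_mul, der_inv h1, der_inv h1, hf.der_der x y]
  ring

/-! #### Restriction of the alphabet -/

open Classical in
/-- Restriction to the lists all of whose letters satisfy `p`. -/
noncomputable def res (p : X → Prop) (f : Shuffle X) : Shuffle X :=
  fun L => if ∀ y ∈ L, p y then f L else 0

theorem res_nil (p : X → Prop) (f : Shuffle X) : res p f [] = f [] := by simp [res]

theorem der_res_of_pos {p : X → Prop} {x : X} (hx : p x) (f : Shuffle X) :
    der x (res p f) = res p (der x f) := by
  classical
  funext L
  change (if ∀ y ∈ x :: L, p y then f (x :: L) else 0) = if ∀ y ∈ L, p y then f (x :: L) else 0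
  simp only [List.forall_mem_cons, hx, true_and]

theorem der_res_of_neg {p : X → Prop} {x : X} (hx : ¬ p x) (f : Shuffle X) :
    der x (res p f) = 0 := by
  classical
  funext L
  change (if ∀ y ∈ x :: L, p y then f (x :: L) else 0) = 0
  simp only [List.forall_mem_cons, hx, false_and, if_false]

theorem res_add (p : X → Prop) (f g : Shuffle X) : res p (f + g) = res p f + res p g := by
  funext L
  by_cases h : ∀ y ∈ L, p y
  · simp only [res, if_pos h, add_apply]
  · simp only [res, if_neg h, add_apply, add_zero]

theorem res_mul (p : X → Prop) (f g : Shuffle X) : res p (f * g) = res p f * res p g := by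
  funext L
  induction L generalizing f g with
  | nil => simp only [res_nil, mul_nil]
  | cons x L ih =>
    change der x (res p (f * g)) L = der x (res p f * res p g) L
    by_cases hx : p x
    · rw [der_res_of_pos hx, der_mul, der_mul, der_res_of_pos hx, der_res_of_pos hx, res_add,
        add_apply, add_apply, ih, ih]
    · rw [der_res_of_neg hx, der_mul, der_res_of_neg hx, der_res_of_neg hx, zero_mul, mul_zero,
        add_zero]

theorem log_res (p : X → Prop) {f : Shuffle X} (hf : f [] = 1) : log (res p f) = res p (log f) := by
  have h1 : res p f [] = 1 := by rw [res_nil, hf]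
  refine ext_der (by rw [res_nil]; rfl) fun x => eq_of_mul_eq h1 ?_
  rw [mul_der_log h1]
  by_cases hx : p x
  · rw [der_res_of_pos hx, der_res_of_pos hx, ← res_mul, mul_der_log hf]
  · rw [der_res_of_neg hx, der_res_of_neg hx, mul_zero]

/-- The second derivative of the logarithm, if a derivative of `f` is proportional to `g`. -/
theorem der_der_log {f g : Shuffle X} (hf : f [] = 1) (hg : g [] = 1) {c : ℂ} {x : X}
    (h : der x f = c • g) (y : X) :
    der y (der x (log f)) = der x (log f) * der y (log g - log f) := by
  -- The function `der x f` is a multiple of `g` and so has the logarithmic derivative of `g`;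
  -- comparison with the derivative of `f * der x (log f) = der x f` produces the difference of
  -- logarithms.
  have e1 : der y (der x f) = der x f * der y (log g) := by
    rw [h, smul_mul', mul_der_log hg, der_smul]
  refine eq_of_mul_eq hf ?_
  have e2 := congrArg (der y) (mul_der_log hf x)
  rw [der_mul] at e2
  have e3 := mul_der_log hf x
  have e4 := mul_der_log hf y
  rw [der_sub]
  linear_combination e2 + e1 - der y (log g) * e3 + der x (log f) * e4

end Shuffle

end ShuffleAlgebra

/-! ### Square norms in the shuffle algebra -/

namespace Shuffle

variable {X : Type*} [Fintype X]

/-- The squared `ℓ²` norm of the degree-`k` part. -/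
noncomputable def sqNorm (k : ℕ) (f : Shuffle X) : ℝ := listSum k fun L => ‖f L‖ ^ 2

theorem sqNorm_succ (k : ℕ) (f : Shuffle X) : sqNorm (k + 1) f = ∑ x, sqNorm k (der x f) := rfl

theorem sqNorm_nonneg (k : ℕ) (f : Shuffle X) : 0 ≤ sqNorm k f :=
  listSum.nonneg fun _ => by positivity

theorem sqNorm_add_le (k : ℕ) (f g : Shuffle X) :
    sqNorm k (f + g) ≤ 2 * sqNorm k f + 2 * sqNorm k g := by
  rw [sqNorm, sqNorm, sqNorm, ← listSum.mul_left, ← listSum.mul_left, ← listSum.add]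
  refine listSum.mono fun L _ => ?_
  rw [add_apply]
  have h := pow_le_pow_left₀ (norm_nonneg _) (norm_add_le (f L) (g L)) 2
  nlinarith [sq_nonneg (‖f L‖ - ‖g L‖)]

theorem sqNorm_neg (k : ℕ) (f : Shuffle X) : sqNorm k (-f) = sqNorm k f := by
  simp only [sqNorm, neg_apply, norm_neg]

theorem sqNorm_sub_le (k : ℕ) (f g : Shuffle X) :
    sqNorm k (f - g) ≤ 2 * sqNorm k f + 2 * sqNorm k g := by
  rw [sub_eq_add_neg, ← sqNorm_neg k g]
  exact sqNorm_add_le k f (-g)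

/-- The Leibniz rule splits each letter into two terms. One factor `2` comes from `(u + v)² ≤ 2u² +
2v²`, another because each pair of degrees is reached from at most two pairs of the preceding
degree. -/
theorem sqNorm_mul_le (k : ℕ) (f g : Shuffle X) :
    sqNorm k (f * g) ≤ 4 ^ k * ∑ p ∈ Finset.HasAntidiagonal.antidiagonal k,
      sqNorm p.1 f * sqNorm p.2 g := by
  induction k generalizing f g with
  | zero => simp [sqNorm, listSum, mul_nil, mul_pow]
  | succ k ih =>
    rw [sqNorm_succ]
    have h1 : ∀ x, sqNorm k (der x (f * g)) ≤ 2 * 4 ^ k *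
        (∑ p ∈ Finset.HasAntidiagonal.antidiagonal k, sqNorm p.1 (der x f) * sqNorm p.2 g +
        ∑ p ∈ Finset.HasAntidiagonal.antidiagonal k, sqNorm p.1 f * sqNorm p.2 (der x g)) := by
      intro x
      rw [der_mul]
      have := sqNorm_add_le k (der x f * g) (f * der x g)
      have := ih (der x f) g
      have := ih f (der x g)
      linarith
    refine (Finset.sum_le_sum fun x _ => h1 x).trans ?_
    rw [← Finset.mul_sum, Finset.sum_add_distrib, Finset.sum_comm, Finset.sum_comm (s := Finset.univ)]
    simp only [← Finset.sum_mul, ← Finset.mul_sum, ← sqNorm_succ]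
    have e1 := Finset.Nat.sum_antidiagonal_succ (n := k)
      (f := fun p : ℕ × ℕ => sqNorm p.1 f * sqNorm p.2 g)
    have e2 := Finset.Nat.sum_antidiagonal_succ' (n := k)
      (f := fun p : ℕ × ℕ => sqNorm p.1 f * sqNorm p.2 g)
    have n1 := mul_nonneg (sqNorm_nonneg 0 f) (sqNorm_nonneg (k + 1) g)
    have n2 := mul_nonneg (sqNorm_nonneg (k + 1) f) (sqNorm_nonneg 0 g)
    simp only at e1 e2
    rw [pow_succ]
    have : (0 : ℝ) < 4 ^ k := by positivity
    nlinarith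

/-- Only lists with a letter outside `p` survive in the difference. Such a letter is at one of `q +
1` positions, and by symmetry it can be moved to the front. -/
theorem sqNorm_sub_res_le (p : X → Prop) [DecidablePred p] (q : ℕ) {g : Shuffle X} (hg : Symm g) :
    sqNorm (q + 1) (g - res p g) ≤
      (q + 1) * ∑ y ∈ Finset.univ.filter fun y => ¬ p y, sqNorm q (der y g) := by
  induction q generalizing g with
  | zero =>
    rw [sqNorm_succ, Finset.sum_filter]
    push_cast
    rw [zero_add, one_mul]
    refine Finset.sum_le_sum fun y _ => ?_
    rw [der_sub]
    split_ifs with h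
    · rw [der_res_of_pos h]
      simp [sqNorm, listSum, sub_apply, res_nil]
    · rw [der_res_of_neg h, sub_zero]
  | succ q ih =>
    rw [sqNorm_succ]
    have h1 : ∀ y, sqNorm (q + 1) (der y (g - res p g)) ≤
        (if ¬ p y then sqNorm (q + 1) (der y g) else 0) +
        (q + 1) * ∑ y' ∈ Finset.univ.filter fun y => ¬ p y, sqNorm q (der y' (der y g)) := by
      intro y
      rw [der_sub]
      have h0 : 0 ≤ (q + 1 : ℝ) * ∑ y' ∈ Finset.univ.filter fun y => ¬ p y,
          sqNorm q (der y' (der y g)) :=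
        mul_nonneg (by positivity) (Finset.sum_nonneg fun _ _ => sqNorm_nonneg _ _)
      split_ifs with h
      · rw [der_res_of_pos h, zero_add]
        exact ih (hg.der y)
      · rw [der_res_of_neg h, sub_zero]
        linarith
    refine (Finset.sum_le_sum fun y _ => h1 y).trans (le_of_eq ?_)
    rw [Finset.sum_add_distrib, ← Finset.sum_filter, ← Finset.mul_sum, Finset.sum_comm]
    have h2 : ∀ y', ∑ y, sqNorm q (der y' (der y g)) = sqNorm (q + 1) (der y' g) := by
      intro y'
      rw [sqNorm_succ]
      exact Finset.sum_congr rfl fun y _ => by rw [hg.der_der]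
    simp only [h2]
    push_cast
    ring

/-! ### Holomorphic families -/

/-- The coefficients at lists of length at most `k` are holomorphic. -/
def Holo (U : Set ℂ) (k : ℕ) (F : ℂ → Shuffle X) : Prop :=
  ∀ L : List X, L.length ≤ k → DifferentiableOn ℂ (fun s => F s L) U

theorem Holo.der {U : Set ℂ} {k : ℕ} {F : ℂ → Shuffle X} (h : Holo U (k + 1) F) (x : X) :
    Holo U k (fun s => der x (F s)) := fun L hL => h (x :: L) (by simpa using hL)

theorem Holo.mono {U : Set ℂ} {k m : ℕ} {F : ℂ → Shuffle X} (h : Holo U k F) (hm : m ≤ k) :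
    Holo U m F := fun L hL => h L (hL.trans hm)

theorem Holo.mul {U : Set ℂ} {k : ℕ} {F G : ℂ → Shuffle X} (hF : Holo U k F) (hG : Holo U k G) :
    Holo U k (fun s => F s * G s) := by
  intro L hL
  induction L generalizing F G k with
  | nil => exact (hF [] hL).mul (hG [] hL)
  | cons x L ih =>
    obtain ⟨k, rfl⟩ : ∃ m, k = m + 1 := ⟨k - 1, by simp at hL; omega⟩
    have hL' : L.length ≤ k := by simpa using hL
    exact (ih (hF.der x) (hG.mono (Nat.le_succ k)) hL').add
      (ih (hF.mono (Nat.le_succ k)) (hG.der x) hL')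

theorem Holo.pow {U : Set ℂ} {k : ℕ} {F : ℂ → Shuffle X} (hF : Holo U k F) (r : ℕ) :
    Holo U k (fun s => F s ^ r) := by
  induction r with
  | zero =>
    simp only [pow_zero]
    exact fun L _ => differentiableOn_const _
  | succ r ih =>
    simp only [pow_succ]
    exact ih.mul hF

theorem Holo.inv {U : Set ℂ} {k : ℕ} {F : ℂ → Shuffle X} (hF : Holo U k F) :
    Holo U k (fun s => inv (F s)) := by
  intro L hL
  have h : (fun s => Shuffle.inv (F s) L) =
      fun s => ∑ r ∈ Finset.range (L.length + 1), ((1 - F s) ^ r) L := by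
    funext s
    rw [Shuffle.inv, finset_sum_apply]
  rw [h]
  have h1 : Holo U k (fun s => 1 - F s) := fun L hL => (differentiableOn_const _).sub (hF L hL)
  exact DifferentiableOn.fun_sum fun r _ => h1.pow r L hL

theorem Holo.log {U : Set ℂ} {k : ℕ} {F : ℂ → Shuffle X} (hF : Holo U k F) :
    Holo U k (fun s => log (F s)) := by
  intro L hL
  rcases L with _ | ⟨x, L⟩
  · exact differentiableOn_const _
  · obtain ⟨k, rfl⟩ : ∃ m, k = m + 1 := ⟨k - 1, by simp at hL; omega⟩
    exact ((hF.mono (Nat.le_succ k)).inv.mul (hF.der x)) L (by simpa using hL)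

/-- The Schwarz lemma for the vector of all coefficients of degree `k`, a holomorphic map into a
Euclidean space. Its values lie within `3 * √M` of the value at the centre, whence the factor `9`.
-/
theorem sqNorm_sub_le_of_holo {k : ℕ} {F : ℂ → Shuffle X} {c z : ℂ} {r M : ℝ} (hr : 0 < r)
    (hM : 0 < M) (hF : Holo (Metric.ball c r) k F)
    (hb : ∀ s ∈ Metric.ball c r, sqNorm k (F s) ≤ M) (hz : z ∈ Metric.ball c r) :
    sqNorm k (F z - F c) ≤ 9 * M / r ^ 2 * ‖z - c‖ ^ 2 := by
  set Φ : ℂ → EuclideanSpace ℂ (Fin k → X) :=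
    fun s => WithLp.toLp 2 fun e => F s (List.ofFn e) with hΦ
  have hn : ∀ f : Shuffle X, sqNorm k f =
      ‖(WithLp.toLp 2 fun e => f (List.ofFn e) : EuclideanSpace ℂ (Fin k → X))‖ ^ 2 := by
    intro f
    rw [EuclideanSpace.norm_sq_eq, sqNorm, listSum.eq_sum_ofFn]
  have hd : DifferentiableOn ℂ Φ (Metric.ball c r) := by
    rw [differentiableOn_euclidean]
    exact fun e => hF (List.ofFn e) (by simp)
  have hbd : ∀ s ∈ Metric.ball c r, ‖Φ s‖ ≤ √M := fun s hs => by
    refine Real.le_sqrt_of_sq_le ?_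
    rw [hΦ, ← hn]
    exact hb s hs
  have hM0 : 0 < √M := Real.sqrt_pos.2 hM
  have hc : c ∈ Metric.ball c r := Metric.mem_ball_self hr
  have hmaps : MapsTo Φ (Metric.ball c r) (Metric.closedBall (Φ c) (3 * √M)) := by
    intro s hs
    rw [Metric.mem_closedBall, dist_eq_norm]
    have := norm_sub_le (Φ s) (Φ c)
    have := hbd s hs
    have := hbd c hc
    linarith
  have h := Complex.dist_le_div_mul_dist_of_mapsTo_ball hd hmaps hz
  rw [dist_eq_norm, dist_eq_norm] at h
  have e : sqNorm k (F z - F c) = ‖Φ z - Φ c‖ ^ 2 := by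
    rw [hn]; rfl
  rw [e]
  refine (pow_le_pow_left₀ (norm_nonneg _) h 2).trans (le_of_eq ?_)
  rw [mul_pow, div_pow, mul_pow, Real.sq_sqrt hM.le]
  norm_num

end Shuffle

/-! ### The cumulants of the permanent -/

namespace Shuffle

section MatchWeight

variable {n : ℕ}

/-- The weights of partial matchings in the expansion of the normalized permanent, with a complex
shift `s` of the falling factorials. -/
noncomputable def matchWeight (n : ℕ) (s : ℂ) : Shuffle (Fin n × Fin n) := fun L =>
  if (L.map Prod.fst).Nodup ∧ (L.map Prod.snd).Nodup then
    ∏ l ∈ Finset.range L.length, (1 - (s + l) / n)⁻¹ else 0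

/-- The cells `y` that share neither row nor column with `x`. -/
def Avoids (x y : Fin n × Fin n) : Prop := x.1 ≠ y.1 ∧ x.2 ≠ y.2

instance (x : Fin n × Fin n) : DecidablePred (Avoids x) := fun _ => inferInstanceAs (Decidable (_ ∧ _))

theorem matchWeight_nil (s : ℂ) : matchWeight n s [] = 1 := by simp [matchWeight]

/-- Fixing the first cell deletes its row and column and advances the falling factorial by one step.
Hence the family is closed under derivations, up to restriction. The shift is a complex number so
that the step from `s` to `s + 1` can be estimated by holomorphy. -/
theorem der_matchWeight (s : ℂ) (x : Fin n × Fin n) :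
    der x (matchWeight n s) = (1 - s / n)⁻¹ • res (Avoids x) (matchWeight n (s + 1)) := by
  classical
  funext L
  have h1 : (∀ y ∈ L, Avoids x y) ↔ x.1 ∉ L.map Prod.fst ∧ x.2 ∉ L.map Prod.snd := by
    constructor
    · refine fun h => ⟨fun hm => ?_, fun hm => ?_⟩
      · obtain ⟨y, hy, e⟩ := List.mem_map.1 hm
        exact (h y hy).1 e.symm
      · obtain ⟨y, hy, e⟩ := List.mem_map.1 hm
        exact (h y hy).2 e.symm
    · exact fun h y hy => ⟨fun e => h.1 (e ▸ List.mem_map_of_mem hy),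
        fun e => h.2 (e ▸ List.mem_map_of_mem hy)⟩
  rw [der_apply, smul_apply]
  unfold res matchWeight
  simp only [h1, List.map_cons, List.nodup_cons, List.length_cons]
  rw [Finset.prod_range_succ']
  by_cases a1 : x.1 ∈ L.map Prod.fst
  · simp only [a1, not_true, false_and, if_false, mul_zero]
  by_cases a2 : x.2 ∈ L.map Prod.snd
  · simp only [a2, not_true, false_and, and_false, if_false, mul_zero]
  by_cases a3 : (L.map Prod.fst).Nodup ∧ (L.map Prod.snd).Nodup
  · rw [if_pos ⟨⟨a1, a3.1⟩, ⟨a2, a3.2⟩⟩, if_pos ⟨a1, a2⟩, if_pos a3]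
    push_cast
    rw [add_zero, mul_comm]
    congr 1
    refine Finset.prod_congr rfl fun l _ => ?_
    rw [add_assoc s 1, add_comm (1 : ℂ)]
  · rw [if_neg fun h => a3 ⟨h.1.2, h.2.2⟩, if_pos ⟨a1, a2⟩, if_neg a3, mul_zero]

theorem symm_matchWeight (s : ℂ) : Symm (matchWeight n s) := by
  intro L M h
  simp only [matchWeight, (h.map Prod.fst).nodup_iff, (h.map Prod.snd).nodup_iff, h.length_eq]

theorem one_sub_div_ne_zero {s : ℂ} {l : ℕ} (h : ‖s‖ + l < n) : 1 - (s + l) / (n : ℂ) ≠ 0 := by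
  intro h0
  have hn : (0 : ℝ) < n := by have := norm_nonneg s; have : (0 : ℝ) ≤ l := by positivity
                              linarith
  have hn' : (n : ℂ) ≠ 0 := by exact_mod_cast hn.ne'
  have h1 : (n : ℂ) = s + l := by field_simp at h0; linear_combination h0
  have h2 := congrArg norm h1
  rw [Complex.norm_natCast] at h2
  have := norm_add_le s (l : ℂ)
  rw [Complex.norm_natCast] at this
  linarith

theorem holo_matchWeight {U : Set ℂ} {k : ℕ} (hU : ∀ s ∈ U, ‖s‖ + k ≤ n) :
    Holo U k (matchWeight n) := by
  intro L hL
  unfold matchWeight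
  split_ifs
  · refine DifferentiableOn.fun_finset_prod fun l hl => ?_
    refine DifferentiableOn.inv (by fun_prop) fun s hs => one_sub_div_ne_zero ?_
    have h1 : (l : ℝ) < k := by exact_mod_cast (Finset.mem_range.1 hl).trans_le hL
    have := hU s hs
    linarith
  · exact differentiableOn_const _

/-- The recursion for the cumulants. Its second factor is a difference of two nearly equal
functions, which provides the decay. -/
theorem der_der_log_matchWeight (s : ℂ) (x y : Fin n × Fin n) :
    der y (der x (log (matchWeight n s))) = der x (log (matchWeight n s)) *
      der y (res (Avoids x) (log (matchWeight n (s + 1))) - log (matchWeight n s)) := by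
  rw [← log_res _ (matchWeight_nil _)]
  exact der_der_log (matchWeight_nil s) (by rw [res_nil, matchWeight_nil]) (der_matchWeight s x) y

theorem card_filter_not_avoids (x : Fin n × Fin n) :
    (Finset.univ.filter fun y => ¬ Avoids x y).card ≤ 2 * n := by
  have h : (Finset.univ.filter fun y => ¬ Avoids x y) ⊆
      (Finset.univ.image fun j => (x.1, j)) ∪ Finset.univ.image fun i => (i, x.2) := by
    rintro ⟨i, j⟩ hy
    simp only [Finset.mem_filter, Finset.mem_univ, true_and, Avoids, not_and_or, not_not] at hy
    simp only [Finset.mem_union, Finset.mem_image, Finset.mem_univ, true_and, Prod.mk.injEq]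
    rcases hy with h | h
    · exact Or.inl ⟨j, h, rfl⟩
    · exact Or.inr ⟨i, rfl, h⟩
  refine (Finset.card_le_card h).trans ((Finset.card_union_le _ _).trans ?_)
  have h1 := Finset.card_image_le (s := (Finset.univ : Finset (Fin n))) (f := fun j => (x.1, j))
  have h2 := Finset.card_image_le (s := (Finset.univ : Finset (Fin n))) (f := fun i => (i, x.2))
  rw [Finset.card_univ, Fintype.card_fin] at h1 h2
  omega

theorem sqNorm_log_matchWeight_le {q : ℕ} {s : ℂ} {C : ℝ}
    (h : ∀ x, sqNorm q (der x (log (matchWeight n s))) ≤ C * (n : ℝ) ^ q) :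
    sqNorm (q + 1) (log (matchWeight n s)) ≤ C * (n : ℝ) ^ (q + 2) := by
  rw [sqNorm_succ]
  refine (Finset.sum_le_card_nsmul _ _ _ fun x _ => h x).trans (le_of_eq ?_)
  rw [Finset.card_univ, Fintype.card_prod, Fintype.card_fin, nsmul_eq_mul]
  push_cast
  ring

/-- The difference has two sources. Replacing `s` by `s + 1` inside a disk of radius `ρn/2` gains
`n⁻²` in the squared norm by the Schwarz lemma. Removing the row and column of `x` leaves lists with
a letter among at most `2n` cells instead of `n²`. Both are within `n ^ (q + 1)`, one power less
than the bound for the cumulants themselves. -/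
theorem sqNorm_diff_le {q : ℕ} {s : ℂ} {C ρ : ℝ} (hC : 0 < C) (hρ : 0 < ρ) (hρ1 : ρ ≤ 1 / 4)
    (hn1 : 2 < ρ * n) (hnq : 2 * q + 4 ≤ n) (hs : ‖s‖ ≤ ρ / 2 * n)
    (h : ∀ μ : ℂ, ‖μ‖ ≤ ρ * n → ∀ x, sqNorm q (der x (log (matchWeight n μ))) ≤ C * (n : ℝ) ^ q)
    (x : Fin n × Fin n) :
    sqNorm (q + 1) (res (Avoids x) (log (matchWeight n (s + 1))) - log (matchWeight n s)) ≤
      (72 * C / ρ ^ 2 + 4 * (q + 1) * C) * (n : ℝ) ^ (q + 1) := by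
  have hn0 : (0 : ℝ) < n := by
    have : (4 : ℝ) ≤ n := by exact_mod_cast (by omega : 4 ≤ n)
    linarith
  have hn1' : (1 : ℝ) ≤ n := by exact_mod_cast (by omega : 1 ≤ n)
  have hsum : ‖s + 1‖ ≤ ρ * n := by
    have := norm_add_le s 1
    rw [norm_one] at this
    linarith
  have hball : ∀ μ ∈ Metric.ball s (ρ / 2 * n), ‖μ‖ ≤ ρ * n := by
    intro μ hμ
    rw [Metric.mem_ball, dist_eq_norm] at hμ
    have := norm_add_le (μ - s) s
    rw [sub_add_cancel] at this
    linarith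
  set κ := fun μ => log (matchWeight n μ) with hκ
  have hholo : Holo (Metric.ball s (ρ / 2 * n)) (q + 1) κ := by
    refine Holo.log (holo_matchWeight fun μ hμ => ?_)
    have h1 := hball μ hμ
    have h2 : ρ * n ≤ 1 / 4 * n := by gcongr
    have h3 : (2 * q + 4 : ℝ) ≤ n := by exact_mod_cast hnq
    have h4 : (0 : ℝ) ≤ q := by positivity
    push_cast
    linarith
  have b1 : sqNorm (q + 1) (κ (s + 1) - κ s) ≤ 36 * C / ρ ^ 2 * (n : ℝ) ^ (q + 1) := by
    have hz : s + 1 ∈ Metric.ball s (ρ / 2 * n) := by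
      rw [Metric.mem_ball, dist_eq_norm, add_sub_cancel_left, norm_one]; linarith
    have := sqNorm_sub_le_of_holo (M := C * (n : ℝ) ^ (q + 2)) (by positivity) (by positivity) hholo
      (fun μ hμ => sqNorm_log_matchWeight_le (h μ (hball μ hμ))) hz
    rw [add_sub_cancel_left, norm_one] at this
    refine this.trans ?_
    calc _ = 36 * C / ρ ^ 2 * (n : ℝ) ^ q := by field_simp; ring
      _ ≤ _ := by gcongr; omega
  have b2 : sqNorm (q + 1) (κ (s + 1) - res (Avoids x) (κ (s + 1))) ≤
      2 * (q + 1) * C * (n : ℝ) ^ (q + 1) := by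
    refine (sqNorm_sub_res_le (Avoids x) q ((symm_matchWeight _).log (matchWeight_nil _))).trans ?_
    have h1 : ∑ y ∈ Finset.univ.filter fun y => ¬ Avoids x y, sqNorm q (der y (κ (s + 1))) ≤
        2 * n * (C * (n : ℝ) ^ q) := by
      refine (Finset.sum_le_card_nsmul _ _ _ fun y _ => h (s + 1) hsum y).trans ?_
      rw [nsmul_eq_mul]
      have : (((Finset.univ.filter fun y => ¬ Avoids x y).card : ℕ) : ℝ) ≤ 2 * n := by
        exact_mod_cast card_filter_not_avoids x
      gcongr
    calc _ ≤ ((q : ℝ) + 1) * (2 * n * (C * (n : ℝ) ^ q)) := by gcongr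
      _ = _ := by ring
  have e : res (Avoids x) (κ (s + 1)) - κ s =
      (κ (s + 1) - κ s) - (κ (s + 1) - res (Avoids x) (κ (s + 1))) := by ring
  change sqNorm (q + 1) (res (Avoids x) (κ (s + 1)) - κ s) ≤ _
  rw [e]
  refine (sqNorm_sub_le _ _ _).trans ?_
  calc _ ≤ 2 * (36 * C / ρ ^ 2 * (n : ℝ) ^ (q + 1)) + 2 * (2 * (q + 1) * C * (n : ℝ) ^ (q + 1)) := by
        gcongr
    _ = _ := by ring

/-- The bound `n ^ q` is the order of the number of lists that, together with `x`, form a connected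
set of cells. The induction on the degree uses the recursion and needs the hypothesis on a larger
disk of shifts, so the radius is halved in each step. -/
theorem exists_sqNorm_der_log_le (k : ℕ) : ∃ (C ρ : ℝ) (N : ℕ), 0 < C ∧ 0 < ρ ∧ ρ ≤ 1 / 4 ∧
    ∀ n : ℕ, N ≤ n → ∀ q ≤ k, ∀ s : ℂ, ‖s‖ ≤ ρ * n → ∀ x : Fin n × Fin n,
      sqNorm q (der x (log (matchWeight n s))) ≤ C * (n : ℝ) ^ q := by
  induction k with
  | zero =>
    refine ⟨4, 1 / 4, 0, by norm_num, by norm_num, le_rfl, fun n _ q hq s hs x => ?_⟩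
    obtain rfl : q = 0 := Nat.le_zero.1 hq
    have hn : (0 : ℝ) < n := by
      have : 0 < n := Fin.pos x.1
      exact_mod_cast this
    have h1 : der x (log (matchWeight n s)) [] = (1 - s / n)⁻¹ := by
      rw [der_log, mul_nil, inv_nil, der_matchWeight, smul_apply, res_nil, matchWeight_nil]
      ring
    have h2 : sqNorm 0 (der x (log (matchWeight n s))) = ‖(1 - s / n : ℂ)⁻¹‖ ^ 2 := by
      rw [← h1]; rfl
    have h3 : ‖(1 + -(s / n) : ℂ)⁻¹‖ ≤ 2 := by
      refine norm_inv_one_add_le ?_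
      rw [norm_neg, norm_div, Complex.norm_natCast, div_le_iff₀ hn]
      linarith
    rw [h2, pow_zero, mul_one, sub_eq_add_neg]
    nlinarith [norm_nonneg ((1 + -(s / n) : ℂ)⁻¹)]
  | succ k ih =>
    obtain ⟨C, ρ, N, hC, hρ, hρ1, h⟩ := ih
    set C1 : ℝ := 72 * C / ρ ^ 2 + 4 * (k + 1) * C with hC1
    have hC1p : 0 < C1 := by rw [hC1]; positivity
    refine ⟨C + 4 ^ k * ((k + 1) * (C * C1)), ρ / 2, max N (max (2 * k + 4) (⌊2 / ρ⌋₊ + 1)),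
      by positivity, by positivity, by linarith, fun n hn q hq s hs x => ?_⟩
    have hnN : N ≤ n := (le_max_left _ _).trans hn
    have hnk : 2 * k + 4 ≤ n := (le_max_left _ _).trans ((le_max_right _ _).trans hn)
    have hnρ : 2 < ρ * n := by
      have h1 : ⌊2 / ρ⌋₊ + 1 ≤ n := (le_max_right _ _).trans ((le_max_right _ _).trans hn)
      have h2 : (⌊2 / ρ⌋₊ + 1 : ℝ) ≤ n := by exact_mod_cast h1
      have h3 := Nat.lt_floor_add_one (2 / ρ)
      rw [div_lt_iff₀ hρ] at h3
      nlinarith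
    have hn0 : (0 : ℝ) < n := by
      have : (4 : ℝ) ≤ n := by exact_mod_cast (by omega : 4 ≤ n)
      linarith
    have hs' : ‖s‖ ≤ ρ * n := hs.trans (by nlinarith)
    have hold : C ≤ C + 4 ^ k * ((k + 1) * (C * C1)) := by
      have : 0 ≤ 4 ^ k * ((k + 1) * (C * C1)) := by positivity
      linarith
    rcases Nat.lt_or_ge k q with hkq | hkq
    · obtain rfl : q = k + 1 := by omega
      set κ := log (matchWeight n s) with hκ
      set δ := res (Avoids x) (log (matchWeight n (s + 1))) - κ with hδ
      have hδ' : ∀ q ≤ k, sqNorm (q + 1) δ ≤ C1 * (n : ℝ) ^ (q + 1) := by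
        intro q hq
        refine (sqNorm_diff_le hC hρ hρ1 hnρ (by omega) hs (fun μ hμ => h n hnN q hq μ hμ) x).trans ?_
        have : (q : ℝ) ≤ k := by exact_mod_cast hq
        rw [hC1]
        gcongr
      -- Summing the recursion over `y` raises the degree of the factor `δ` by one, so only its
      -- positive degrees occur.
      have h1 : sqNorm (k + 1) (der x κ) ≤ 4 ^ k *
          ∑ p ∈ Finset.HasAntidiagonal.antidiagonal k, sqNorm p.1 (der x κ) * sqNorm (p.2 + 1) δ := by
        rw [sqNorm_succ]
        have : ∀ y, sqNorm k (der y (der x κ)) ≤ 4 ^ k *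
            ∑ p ∈ Finset.HasAntidiagonal.antidiagonal k,
              sqNorm p.1 (der x κ) * sqNorm p.2 (der y δ) := by
          intro y
          rw [hκ, der_der_log_matchWeight]
          exact sqNorm_mul_le k _ _
        refine (Finset.sum_le_sum fun y _ => this y).trans (le_of_eq ?_)
        rw [← Finset.mul_sum, Finset.sum_comm]
        simp only [← Finset.mul_sum, ← sqNorm_succ]
      refine h1.trans ?_
      have h2 : ∑ p ∈ Finset.HasAntidiagonal.antidiagonal k,
          sqNorm p.1 (der x κ) * sqNorm (p.2 + 1) δ ≤ (k + 1) * (C * C1 * (n : ℝ) ^ (k + 1)) := by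
        refine (Finset.sum_le_card_nsmul _ _ (C * C1 * (n : ℝ) ^ (k + 1)) fun p hp => ?_).trans
          (le_of_eq ?_)
        · have hpk : p.1 + p.2 = k := Finset.HasAntidiagonal.mem_antidiagonal.1 hp
          calc _ ≤ (C * (n : ℝ) ^ p.1) * (C1 * (n : ℝ) ^ (p.2 + 1)) :=
                mul_le_mul (h n hnN p.1 (by omega) s hs' x) (hδ' p.2 (by omega))
                  (sqNorm_nonneg _ _) (by positivity)
            _ = _ := by rw [← hpk, add_assoc, pow_add (n : ℝ) p.1]; ring
        · rw [Finset.Nat.card_antidiagonal, nsmul_eq_mul]; push_cast; ring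
      calc _ ≤ 4 ^ k * ((k + 1) * (C * C1 * (n : ℝ) ^ (k + 1))) := by gcongr
        _ = (4 ^ k * ((k + 1) * (C * C1))) * (n : ℝ) ^ (k + 1) := by ring
        _ ≤ _ := by
          have : 0 ≤ C * (n : ℝ) ^ (k + 1) := by positivity
          rw [add_mul]; linarith
    · refine (h n hnN q hkq s hs' x).trans ?_
      gcongr

theorem exists_sqNorm_log_matchWeight_le (k : ℕ) : ∃ (C : ℝ) (N : ℕ), 0 < C ∧
    ∀ n : ℕ, N ≤ n → sqNorm (k + 1) (log (matchWeight n 0)) ≤ C * (n : ℝ) ^ (k + 2) := by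
  obtain ⟨C, ρ, N, hC, hρ, -, h⟩ := exists_sqNorm_der_log_le k
  exact ⟨C, N, hC, fun n hn => sqNorm_log_matchWeight_le (h n hn k le_rfl 0
    (by rw [norm_zero]; positivity))⟩

end MatchWeight

end Shuffle

/-! ### Taylor coefficients of the logarithm of the permanent -/

namespace Shuffle

section Eval

variable {X : Type*} [Fintype X]

theorem kerPoly_succ (k : ℕ) (f : Shuffle X) (W : X → ℂ) :
    kerPoly (k + 1) f W = ∑ x, W x * kerPoly k (der x f) W := by
  simp only [kerPoly, listSum, ← listSum.mul_left]
  refine Finset.sum_congr rfl fun x _ => ?_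
  congr 1; funext L
  rw [List.map_cons, List.prod_cons, der_apply]
  ring

theorem kerPoly_zero (f : Shuffle X) (W : X → ℂ) : kerPoly 0 f W = f [] := by
  simp [kerPoly, listSum]

/-- The exponential generating series of the forms with kernel `f`. -/
noncomputable def evSeries (W : X → ℂ) (f : Shuffle X) : PowerSeries ℂ :=
  PowerSeries.mk fun k => (k.factorial : ℂ)⁻¹ * kerPoly k f W

theorem coeff_evSeries (W : X → ℂ) (f : Shuffle X) (k : ℕ) :
    PowerSeries.coeff k (evSeries W f) = (k.factorial : ℂ)⁻¹ * kerPoly k f W :=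
  PowerSeries.coeff_mk _ _

theorem derivative_evSeries (W : X → ℂ) (f : Shuffle X) :
    PowerSeries.derivative ℂ (evSeries W f) = ∑ x, PowerSeries.C (W x) * evSeries W (der x f) := by
  ext k
  rw [PowerSeries.coeff_derivative, coeff_evSeries, map_sum, kerPoly_succ]
  simp only [PowerSeries.coeff_C_mul, coeff_evSeries]
  have h1 : (k.factorial : ℂ) ≠ 0 := by exact_mod_cast k.factorial_ne_zero
  have h2 : (k + 1 : ℂ) ≠ 0 := by exact_mod_cast k.succ_ne_zero
  rw [Nat.factorial_succ, Finset.mul_sum, Finset.sum_mul]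
  refine Finset.sum_congr rfl fun x _ => ?_
  push_cast
  field_simp

theorem evSeries_add (W : X → ℂ) (f g : Shuffle X) :
    evSeries W (f + g) = evSeries W f + evSeries W g := by
  ext k
  rw [map_add, coeff_evSeries, coeff_evSeries, coeff_evSeries, ← mul_add]
  simp only [kerPoly]
  rw [← listSum.add]
  simp only [add_apply, add_mul]

/-- Evaluation carries the derivations to the formal derivative, so both sides obey the same Leibniz
rule; the coefficients agree by induction. -/
theorem evSeries_mul (W : X → ℂ) (f g : Shuffle X) :
    evSeries W (f * g) = evSeries W f * evSeries W g := by
  ext k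
  induction k generalizing f g with
  | zero =>
    simp [PowerSeries.coeff_mul, coeff_evSeries, kerPoly_zero, mul_nil]
  | succ k ih =>
    have h2 : (k + 1 : ℂ) ≠ 0 := by exact_mod_cast k.succ_ne_zero
    refine mul_right_cancel₀ h2 ?_
    rw [← PowerSeries.coeff_derivative, ← PowerSeries.coeff_derivative, Derivation.leibniz,
      derivative_evSeries, derivative_evSeries, derivative_evSeries, smul_eq_mul, smul_eq_mul,
      Finset.mul_sum, Finset.mul_sum, ← Finset.sum_add_distrib, map_sum, map_sum]
    refine Finset.sum_congr rfl fun x _ => ?_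
    rw [der_mul, evSeries_add, mul_add, map_add, map_add, PowerSeries.coeff_C_mul,
      PowerSeries.coeff_C_mul, ih, ih, ← PowerSeries.coeff_C_mul, ← PowerSeries.coeff_C_mul, add_comm]
    congr 2 <;> ring

theorem evSeries_log (W : X → ℂ) {f : Shuffle X} (hf : f [] = 1) :
    evSeries W f * PowerSeries.derivative ℂ (evSeries W (log f)) =
      PowerSeries.derivative ℂ (evSeries W f) := by
  rw [derivative_evSeries, derivative_evSeries, Finset.mul_sum]
  refine Finset.sum_congr rfl fun x _ => ?_
  rw [← mul_der_log hf x, evSeries_mul]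
  ring

end Eval

end Shuffle

/-! ### Taylor series at the origin and their logarithmic derivatives. -/

section TaylorSeries

/-- The Taylor series at `0`. -/
noncomputable def taylorSeries (f : ℂ → ℂ) : PowerSeries ℂ :=
  PowerSeries.mk fun k => iteratedDeriv k f 0 / (k.factorial : ℂ)

theorem coeff_taylorSeries (f : ℂ → ℂ) (k : ℕ) :
    PowerSeries.coeff k (taylorSeries f) = iteratedDeriv k f 0 / (k.factorial : ℂ) :=
  PowerSeries.coeff_mk _ _

theorem taylorSeries_mul {f g : ℂ → ℂ} (hf : AnalyticAt ℂ f 0) (hg : AnalyticAt ℂ g 0) :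
    taylorSeries (f * g) = taylorSeries f * taylorSeries g := by
  ext k
  rw [PowerSeries.coeff_mul, coeff_taylorSeries, iteratedDeriv_mul hf.contDiffAt hg.contDiffAt,
    Finset.sum_div, Finset.Nat.sum_antidiagonal_eq_sum_range_succ_mk]
  refine Finset.sum_congr rfl fun i hi => ?_
  have hi' : i ≤ k := Nat.lt_succ_iff.1 (Finset.mem_range.1 hi)
  rw [coeff_taylorSeries, coeff_taylorSeries, Nat.cast_choose ℂ hi']
  have h1 : (k.factorial : ℂ) ≠ 0 := by exact_mod_cast k.factorial_ne_zero
  have h2 : (i.factorial : ℂ) ≠ 0 := by exact_mod_cast i.factorial_ne_zero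
  have h3 : ((k - i).factorial : ℂ) ≠ 0 := by exact_mod_cast (k - i).factorial_ne_zero
  field_simp

theorem taylorSeries_deriv (f : ℂ → ℂ) :
    taylorSeries (deriv f) = PowerSeries.derivative ℂ (taylorSeries f) := by
  ext k
  rw [PowerSeries.coeff_derivative, coeff_taylorSeries, coeff_taylorSeries, iteratedDeriv_succ',
    Nat.factorial_succ]
  have h1 : (k.factorial : ℂ) ≠ 0 := by exact_mod_cast k.factorial_ne_zero
  have h2 : (k + 1 : ℂ) ≠ 0 := by exact_mod_cast k.succ_ne_zero
  push_cast
  field_simp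

theorem taylorSeries_congr {f g : ℂ → ℂ} (h : f =ᶠ[nhds 0] g) : taylorSeries f = taylorSeries g := by
  ext k
  rw [coeff_taylorSeries, coeff_taylorSeries, h.iteratedDeriv_eq]

theorem taylorSeries_sum_pow (m : ℕ) (a : ℕ → ℂ) :
    taylorSeries (fun z => ∑ k ∈ Finset.range m, a k * z ^ k) =
      PowerSeries.mk fun k => if k < m then a k else 0 := by
  ext j
  rw [coeff_taylorSeries, PowerSeries.coeff_mk, iteratedDeriv_fun_sum fun i _ => by fun_prop]
  simp only [iteratedDeriv_const_mul_field, iteratedDeriv_fun_pow_zero]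
  have h1 : (j.factorial : ℂ) ≠ 0 := by exact_mod_cast j.factorial_ne_zero
  split_ifs with h
  · rw [Finset.sum_eq_single j]
    · simp [h1]
    · intro b _ hb
      simp [hb.symm]
    · intro hj; exact absurd (Finset.mem_range.2 h) hj
  · rw [Finset.sum_eq_zero, zero_div]
    intro b hb
    have : j ≠ b := by rintro rfl; exact h (Finset.mem_range.1 hb)
    simp [this]

/-- The Taylor series of a logarithm of `p`, up to the constant term. -/
theorem taylorSeries_log {p f : ℂ → ℂ} (hp : AnalyticAt ℂ p 0) (hf : AnalyticAt ℂ f 0)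
    (h : ∀ᶠ z in nhds 0, Complex.exp (f z) = p z) :
    taylorSeries p * PowerSeries.derivative ℂ (taylorSeries f) =
      PowerSeries.derivative ℂ (taylorSeries p) := by
  rw [← taylorSeries_deriv, ← taylorSeries_deriv, ← taylorSeries_mul hp hf.deriv]
  refine taylorSeries_congr ?_
  have h2 : ∀ᶠ z in nhds (0 : ℂ), AnalyticAt ℂ f z := hf.eventually_analyticAt
  filter_upwards [h.eventually_nhds, h2] with z hz hfz
  have h3 : deriv p z = deriv (fun z => Complex.exp (f z)) z :=
    (Filter.EventuallyEq.deriv_eq hz).symm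
  rw [h3, Pi.mul_apply, deriv_cexp hfz.differentiableAt, hz.self_of_nhds]

/-- A logarithm is determined up to its constant term by `P * F' = P'`, since power series over a
field have no zero divisors. -/
theorem coeff_eq_of_mul_derivative_eq {P F G : PowerSeries ℂ} (hP : PowerSeries.coeff 0 P = 1)
    (h : P * PowerSeries.derivative ℂ F = P * PowerSeries.derivative ℂ G) {k : ℕ} (hk : 1 ≤ k) :
    PowerSeries.coeff k F = PowerSeries.coeff k G := by
  have hP0 : P ≠ 0 := by rintro rfl; simp at hP
  have h1 := mul_left_cancel₀ hP0 h
  obtain ⟨k, rfl⟩ : ∃ m, k = m + 1 := ⟨k - 1, by omega⟩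
  have h2 := congrArg (PowerSeries.coeff k) h1
  rw [PowerSeries.coeff_derivative, PowerSeries.coeff_derivative] at h2
  exact mul_right_cancel₀ (by exact_mod_cast k.succ_ne_zero) h2

end TaylorSeries

/-! ### Moments of the Taylor coefficients -/

section LogCoeff

variable {n : ℕ}

theorem normPer_eq_sum_perm (M : Matrix (Fin n) (Fin n) ℂ) (z : ℂ) :
    normPer M z = (∑ σ : Equiv.Perm (Fin n), ∏ v, (1 + z * M v (σ v))) / (n.factorial : ℂ) := by
  rw [normPer, ← Matrix.permanent_transpose, Matrix.permanent]
  simp [Matrix.transpose_apply]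

theorem slotSum_zero_weight {X : Type*} [Fintype X] [DecidableEq X] (l : ℕ) (L : List X) :
    slotSum l (fun _ => (0 : ℂ)) L = if l = 0 ∧ L.Nodup then 1 else 0 := by
  rcases l with _ | l
  · simp [slotSum, listSum]
  · rw [slotSum, listSum]
    simp [listSum.eq_sum_ofFn]

theorem prod_inv_eq_factorial_div {k : ℕ} (hk : k ≤ n) :
    ((n : ℂ)⁻¹) ^ k * ∏ l ∈ Finset.range k, (1 - (0 + (l : ℂ)) / n)⁻¹ =
      ((n - k).factorial : ℂ) / n.factorial := by
  induction k with
  | zero =>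
    have : (n.factorial : ℂ) ≠ 0 := by exact_mod_cast n.factorial_ne_zero
    simp [this]
  | succ k ih =>
    have hn : (n : ℂ) ≠ 0 := by exact_mod_cast (by omega : n ≠ 0)
    have h1 : (n - k).factorial = (n - k) * (n - (k + 1)).factorial := by
      rw [show n - k = (n - (k + 1)) + 1 by omega, Nat.factorial_succ]
    have h2 : ((n : ℂ) - k) ≠ 0 := by
      rw [sub_ne_zero]; exact_mod_cast (by omega : n ≠ k)
    have h3 : (1 - (0 + (k : ℂ)) / n)⁻¹ = n / (n - k) := by
      rw [zero_add, one_sub_div hn, inv_div]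
    have ih' := ih (by omega)
    rw [h1] at ih'
    rw [Finset.prod_range_succ, pow_succ, h3]
    calc _ = (((n : ℂ)⁻¹) ^ k * ∏ l ∈ Finset.range k, (1 - (0 + (l : ℂ)) / n)⁻¹) *
          ((n : ℂ)⁻¹ * (n / (n - k))) := by ring
      _ = _ := by
        rw [ih']
        push_cast [Nat.cast_sub (by omega : k ≤ n)]
        field_simp

/-- The entries of a matrix, divided by its size. -/
noncomputable def scaledEntries (M : Matrix (Fin n) (Fin n) ℂ) (p : Fin n × Fin n) : ℂ :=
  (n : ℂ)⁻¹ * M p.1 p.2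

theorem coeff_evSeries_matchWeight (M : Matrix (Fin n) (Fin n) ℂ) (k : ℕ) :
    PowerSeries.coeff k (Shuffle.evSeries (scaledEntries M) (Shuffle.matchWeight n 0)) =
      if k < n + 1 then (k.factorial : ℂ)⁻¹ * (((n - k).factorial : ℂ) / n.factorial) *
        listSum k (fun e : List (Fin n × Fin n) =>
          if (e.map Prod.fst).Nodup ∧ (e.map Prod.snd).Nodup then
            (e.map fun p => M p.1 p.2).prod else 0) else 0 := by
  rw [Shuffle.coeff_evSeries]
  unfold kerPoly
  split_ifs with hk
  · rw [mul_assoc, ← prod_inv_eq_factorial_div (Nat.lt_succ_iff.1 hk)]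
    refine congrArg ((k.factorial : ℂ)⁻¹ * ·) (Eq.trans (listSum.congr_of_length (R := ℂ)
      (X := Fin n × Fin n) fun e he => ?_) (listSum.mul_left k _ _))
    have h1 : (e.map (scaledEntries M)).prod = ((n : ℂ)⁻¹) ^ k * (e.map fun p => M p.1 p.2).prod := by
      rw [← he]
      clear he
      induction e with
      | nil => simp
      | cons p e ih =>
        rw [List.map_cons, List.prod_cons, ih, List.map_cons, List.prod_cons, List.length_cons,
          scaledEntries, pow_succ]
        ring
    rw [h1, Shuffle.matchWeight, he]
    split_ifs
    · ring
    · ring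
  · rw [listSum.congr_of_length (G := fun _ => (0 : ℂ))]
    · rw [listSum.eq_sum_ofFn]; simp
    · intro e he
      rw [Shuffle.matchWeight, if_neg, zero_mul]
      intro h
      have := h.1.length_le_card
      rw [List.length_map, he, Fintype.card_fin] at this
      omega

/-- The case without rank-one term of `sum_perm_prod_eq`: only `l = 0` contributes, and partial
matchings remain. -/
theorem normPer_eq_sum (M : Matrix (Fin n) (Fin n) ℂ) (z : ℂ) :
    normPer M z = ∑ k ∈ Finset.range (n + 1), PowerSeries.coeff k
      (Shuffle.evSeries (scaledEntries M) (Shuffle.matchWeight n 0)) * z ^ k := by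
  have h := sum_perm_prod_eq (X := Fin n) (K := ℂ) (fun i j => z * M i j) (fun _ => 0) fun _ => 0
  simp only [mul_zero, add_zero, slotSum_zero_weight, Fintype.card_fin] at h
  rw [normPer_eq_sum_perm, h, Finset.sum_div]
  refine Finset.sum_congr rfl fun k hk => ?_
  rw [Finset.sum_eq_single 0 (fun l _ hl => by simp [hl, listSum.eq_sum_ofFn])
    (fun h0 => absurd (Finset.mem_range.2 (Nat.succ_pos n)) h0),
    coeff_evSeries_matchWeight, if_pos (Finset.mem_range.1 hk)]
  have h2 : (listSum k fun L => listSum k fun N => (List.zipWith (fun i j => z * M i j) L N).prod *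
      ((if 0 = 0 ∧ L.Nodup then (1 : ℂ) else 0) * if 0 = 0 ∧ N.Nodup then 1 else 0)) =
      z ^ k * listSum k (fun e : List (Fin n × Fin n) =>
          if (e.map Prod.fst).Nodup ∧ (e.map Prod.snd).Nodup then
            (e.map fun p => M p.1 p.2).prod else 0) := by
    rw [listSum.prod_eq k fun L N => (List.zipWith (fun i j => z * M i j) L N).prod *
      ((if 0 = 0 ∧ L.Nodup then (1 : ℂ) else 0) * if 0 = 0 ∧ N.Nodup then 1 else 0),
      ← listSum.mul_left]
    refine listSum.congr_of_length (R := ℂ) fun e he => ?_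
    have h3 := zipWith_map_fst_snd (fun p : Fin n × Fin n => z * M p.1 p.2) e
    simp only at h3
    rw [h3]
    have h4 : (e.map fun p => z * M p.1 p.2).prod = z ^ k * (e.map fun p => M p.1 p.2).prod := by
      rw [List.prod_map_mul, List.map_const', List.prod_replicate, he]
    rw [h4]
    by_cases a1 : (e.map Prod.fst).Nodup <;> by_cases a2 : (e.map Prod.snd).Nodup <;> simp [a1, a2]
  rw [h2]
  simp only [Nat.factorial_zero, Nat.cast_one, inv_one, mul_one, add_zero]
  ring

theorem taylorSeries_normPer (M : Matrix (Fin n) (Fin n) ℂ) :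
    taylorSeries (normPer M) = Shuffle.evSeries (scaledEntries M) (Shuffle.matchWeight n 0) := by
  have h : normPer M = fun z => ∑ k ∈ Finset.range (n + 1), PowerSeries.coeff k
      (Shuffle.evSeries (scaledEntries M) (Shuffle.matchWeight n 0)) * z ^ k :=
    funext fun z => normPer_eq_sum M z
  rw [h, taylorSeries_sum_pow]
  ext k
  rw [PowerSeries.coeff_mk]
  split_ifs with hk
  · rfl
  · rw [coeff_evSeries_matchWeight, if_neg hk]

theorem normPer_zero (M : Matrix (Fin n) (Fin n) ℂ) : normPer M 0 = 1 := by
  have : (n.factorial : ℂ) ≠ 0 := by exact_mod_cast n.factorial_ne_zero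
  rw [normPer_eq_sum_perm]
  simp [Fintype.card_perm, this]

theorem differentiable_normPer (M : Matrix (Fin n) (Fin n) ℂ) : Differentiable ℂ (normPer M) := by
  have h : normPer M = fun z => (∑ σ : Equiv.Perm (Fin n), ∏ v, (1 + z * M v (σ v))) /
      (n.factorial : ℂ) := funext fun z => normPer_eq_sum_perm M z
  rw [h]
  fun_prop

theorem analyticAt_normPer (M : Matrix (Fin n) (Fin n) ℂ) (z : ℂ) : AnalyticAt ℂ (normPer M) z :=
  (differentiable_normPer M).analyticAt z

theorem analyticAt_log_normPer (M : Matrix (Fin n) (Fin n) ℂ) :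
    AnalyticAt ℂ (fun z => Complex.log (normPer M z)) 0 :=
  (analyticAt_normPer M 0).clog (by rw [normPer_zero]; exact Complex.one_mem_slitPlane)

theorem exp_log_normPer (M : Matrix (Fin n) (Fin n) ℂ) :
    ∀ᶠ z in nhds 0, Complex.exp (Complex.log (normPer M z)) = normPer M z := by
  have h : ∀ᶠ z in nhds 0, normPer M z ≠ 0 :=
    (analyticAt_normPer M 0).continuousAt.eventually_ne (by rw [normPer_zero]; exact one_ne_zero)
  filter_upwards [h] with z hz using Complex.exp_log hz

theorem coeff_taylorSeries_log (M : Matrix (Fin n) (Fin n) ℂ) (k : ℕ) :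
    PowerSeries.coeff k (taylorSeries fun z => Complex.log (normPer M z)) = logCoeff M k := by
  rw [coeff_taylorSeries, logCoeff]

theorem coeff_zero_evSeries_matchWeight (M : Matrix (Fin n) (Fin n) ℂ) :
    PowerSeries.coeff 0 (Shuffle.evSeries (scaledEntries M) (Shuffle.matchWeight n 0)) = 1 := by
  rw [Shuffle.coeff_evSeries, Shuffle.kerPoly_zero, Shuffle.matchWeight_nil]; simp

/-- The Taylor coefficients of any branch of the logarithm. -/
theorem taylorCoeff_eq_logCoeff (M : Matrix (Fin n) (Fin n) ℂ) {g : ℂ → ℂ} (hg : AnalyticAt ℂ g 0)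
    (h : ∀ᶠ z in nhds 0, Complex.exp (g z) = normPer M z) {k : ℕ} (hk : 1 ≤ k) :
    iteratedDeriv k g 0 / (k.factorial : ℂ) = logCoeff M k := by
  rw [← coeff_taylorSeries, ← coeff_taylorSeries_log]
  refine coeff_eq_of_mul_derivative_eq (P := taylorSeries (normPer M)) ?_ ?_ hk
  · rw [taylorSeries_normPer, coeff_zero_evSeries_matchWeight]
  · rw [taylorSeries_log (analyticAt_normPer M 0) hg h,
      taylorSeries_log (analyticAt_normPer M 0) (analyticAt_log_normPer M) (exp_log_normPer M)]

/-- The analytic and the shuffle logarithm satisfy the same equation `P * F' = P'` after evaluation,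
so their coefficients of positive degree agree. -/
theorem logCoeff_eq_kerPoly (M : Matrix (Fin n) (Fin n) ℂ) {k : ℕ} (hk : 1 ≤ k) :
    logCoeff M k = (k.factorial : ℂ)⁻¹ *
      kerPoly k (Shuffle.log (Shuffle.matchWeight n 0)) (scaledEntries M) := by
  rw [← Shuffle.coeff_evSeries, ← coeff_taylorSeries_log]
  refine coeff_eq_of_mul_derivative_eq (P := taylorSeries (normPer M)) ?_ ?_ hk
  · rw [taylorSeries_normPer, coeff_zero_evSeries_matchWeight]
  · rw [taylorSeries_log (analyticAt_normPer M 0) (analyticAt_log_normPer M) (exp_log_normPer M),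
      taylorSeries_normPer, Shuffle.evSeries_log _ (Shuffle.matchWeight_nil 0)]

theorem kerPoly_smul {X : Type*} [Fintype X] (k : ℕ) (f : List X → ℂ) (c : ℂ) (W : X → ℂ) :
    kerPoly k f (fun x => c * W x) = c ^ k * kerPoly k f W := by
  rw [kerPoly, kerPoly, ← listSum.mul_left]
  refine listSum.congr_of_length (R := ℂ) fun e he => ?_
  rw [List.prod_map_mul, List.map_const', List.prod_replicate, he]
  ring

/-- The matrix with given entries. -/
def toMatrix (W : Fin n × Fin n → ℂ) : Matrix (Fin n) (Fin n) ℂ := Matrix.of fun i j => W (i, j)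

theorem logCoeff_toMatrix (W : Fin n × Fin n → ℂ) {k : ℕ} (hk : 1 ≤ k) :
    logCoeff (toMatrix W) k = ((k.factorial : ℂ)⁻¹ * ((n : ℂ)⁻¹) ^ k) *
      kerPoly k (Shuffle.log (Shuffle.matchWeight n 0)) W := by
  rw [logCoeff_eq_kerPoly _ hk, mul_assoc]
  exact congrArg ((k.factorial : ℂ)⁻¹ * ·) (kerPoly_smul k _ _ W)

/-- The entries are scaled by `1/n`, which gives `n ^ (-2k)`, and the squared norm of the cumulant
kernel is of order `n ^ (k + 1)`. -/
theorem exists_integral_norm_logCoeff_sq_le (k : ℕ) (hk : 1 ≤ k) : ∃ (C : ℝ) (N : ℕ), 0 < C ∧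
    ∀ n : ℕ, N ≤ n →
      Integrable (fun W => ‖logCoeff (toMatrix W) k‖ ^ 2) (gaussianVec (Fin n × Fin n)) ∧
      ∫ W, ‖logCoeff (toMatrix W) k‖ ^ 2 ∂(gaussianVec (Fin n × Fin n)) ≤
        C * (n : ℝ)⁻¹ ^ (k - 1) := by
  obtain ⟨k, rfl⟩ : ∃ m, k = m + 1 := ⟨k - 1, by omega⟩
  obtain ⟨C, N, hC, h⟩ := Shuffle.exists_sqNorm_log_matchWeight_le k
  refine ⟨C, max N 1, hC, fun n hn => ?_⟩
  have hn0 : (0 : ℝ) < n := by exact_mod_cast (le_max_right N 1).trans hn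
  simp only [logCoeff_toMatrix _ hk, norm_mul, mul_pow, norm_inv, norm_pow, Complex.norm_natCast]
  refine ⟨(integrable_kerPoly_sq _ _).const_mul _, ?_⟩
  rw [integral_const_mul]
  have h1 := (integral_kerPoly_sq_le (k + 1) (Shuffle.log (Shuffle.matchWeight n 0))).trans
    (mul_le_mul_of_nonneg_left (h n ((le_max_left _ _).trans hn)) (by positivity))
  refine (mul_le_mul_of_nonneg_left h1 (by positivity)).trans ?_
  have hf : (1 : ℝ) ≤ (k + 1).factorial := by exact_mod_cast Nat.one_le_iff_ne_zero.2 (Nat.factorial_ne_zero _)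
  rw [add_tsub_cancel_right]
  calc _ = ((k + 1).factorial : ℝ)⁻¹ * (C * (n : ℝ)⁻¹ ^ k) := by
        rw [← mul_pow, pow_add (n : ℝ) k 2, pow_succ ((n : ℝ)⁻¹) k, inv_pow]
        field_simp
    _ ≤ 1 * (C * (n : ℝ)⁻¹ ^ k) := by
        gcongr
        exact inv_le_one_of_one_le₀ hf
    _ = _ := one_mul _

end LogCoeff

/-! ### Approximation by the Taylor polynomial -/

section Approx

variable {n : ℕ}

/-- The remainder of the Taylor series is cut at `K`. The coefficients from `d + 1` to `K` are
bounded by hypothesis; those beyond are bounded by Cauchy's estimate `B / R' ^ k`, so the tail is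
geometric with ratio `R / R'`. -/
theorem logBranchApprox_of_hasLogBranch {W : Fin n × Fin n → ℂ} {R R' B ε : ℝ} {d K : ℕ}
    (hR : 0 < R) (hRR : R < R') (hB : 0 ≤ B) (h : HasLogBranch W R' B) (hdK : d ≤ K)
    (hε : 0 ≤ ε)
    (hmid : ∀ k ∈ Finset.Ioc d K, ‖logCoeff (toMatrix W) k‖ * R ^ k ≤ ε / (2 * (K + 1)))
    (htail : B * (R / R') ^ (K + 1) / (1 - R / R') ≤ ε / 2) :
    LogBranchApprox (toMatrix W) R d ε := by
  obtain ⟨g, hg, hg0, hgz⟩ := h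
  have hR' : 0 < R' := hR.trans hRR
  have hsub : Metric.closedBall (0 : ℂ) R ⊆ Metric.closedBall 0 R' :=
    Metric.closedBall_subset_closedBall hRR.le
  have hexp : ∀ z ∈ Metric.closedBall (0 : ℂ) R', Complex.exp (g z) = normPer (toMatrix W) z := by
    intro z hz
    rw [(hgz z hz).1, normPer_eq_sum_perm, Fintype.card_fin]
    rfl
  refine ⟨g, hg.mono hsub, hg0, fun z hz => hexp z (hsub hz), fun z hz => ?_⟩
  have hg00 : AnalyticAt ℂ g 0 := hg 0 (Metric.mem_closedBall_self hR'.le)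
  have hcoef : ∀ k, 1 ≤ k → iteratedDeriv k g 0 / (k.factorial : ℂ) = logCoeff (toMatrix W) k :=
    fun k hk => taylorCoeff_eq_logCoeff _ hg00 (by
      filter_upwards [Metric.closedBall_mem_nhds (0 : ℂ) hR'] with z hz using hexp z hz) hk
  have hdiff : DifferentiableOn ℂ g (Metric.closedBall 0 R') := hg.differentiableOn
  have hdc : DiffContOnCl ℂ g (Metric.ball 0 R') := by
    refine DifferentiableOn.diffContOnCl ?_
    rwa [closure_ball 0 hR'.ne']
  have hbound : ∀ k, 1 ≤ k → ‖logCoeff (toMatrix W) k‖ ≤ B / R' ^ k := by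
    intro k hk
    have hf : (0 : ℝ) < k.factorial := by exact_mod_cast k.factorial_pos
    have := Complex.norm_iteratedDeriv_le_of_forall_mem_sphere_norm_le k hR' hdc
      (fun z hz => (hgz z (Metric.sphere_subset_closedBall hz)).2)
    rw [← hcoef k hk, norm_div, Complex.norm_natCast, div_le_iff₀ hf]
    exact this.trans (le_of_eq (by ring))
  have hzR : ‖z‖ ≤ R := by simpa using hz
  have hs := Complex.hasSum_taylorSeries_on_ball (hdiff.mono Metric.ball_subset_closedBall)
    (z := z) (Metric.closedBall_subset_ball hRR hz)
  set t : ℕ → ℂ := fun k => if k = 0 then 0 else logCoeff (toMatrix W) k * z ^ k with ht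
  have hts : HasSum t (g z) := by
    refine hs.congr_fun fun k => ?_
    rcases Nat.eq_zero_or_pos k with rfl | hk
    · simp [ht, hg0]
    · rw [ht]
      simp only [hk.ne', if_false, ← hcoef k hk, sub_zero, smul_eq_mul]
      ring
  have htrunc : logTrunc (toMatrix W) d z = ∑ k ∈ Finset.range (d + 1), t k := by
    rw [Finset.sum_range_succ', logTrunc]
    simp only [ht, Nat.succ_ne_zero, if_false, if_true, add_zero]
    rw [Finset.range_eq_Ico, Finset.sum_Ico_add' (fun k => logCoeff (toMatrix W) k * z ^ k) 0 d 1]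
    rfl
  have hsplit : g z = ∑ k ∈ Finset.range (K + 1), t k + ∑' k, t (k + (K + 1)) := by
    rw [← hts.tsum_eq]
    exact (hts.summable.sum_add_tsum_nat_add (K + 1)).symm
  have hmidsum : ∑ k ∈ Finset.range (K + 1), t k =
      ∑ k ∈ Finset.range (d + 1), t k + ∑ k ∈ Finset.Ioc d K, t k := by
    rw [← Finset.sum_range_add_sum_Ico _ (by omega : d + 1 ≤ K + 1)]
    refine congrArg (_ + ·) (Finset.sum_congr ?_ fun _ _ => rfl)
    ext k
    simp only [Finset.mem_Ico, Finset.mem_Ioc]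
    omega
  have e : g z - logTrunc (toMatrix W) d z =
      ∑ k ∈ Finset.Ioc d K, t k + ∑' k, t (k + (K + 1)) := by
    rw [hsplit, htrunc, hmidsum]; ring
  have hq0 : 0 ≤ R / R' := by positivity
  have hq1 : R / R' < 1 := (div_lt_one hR').2 hRR
  have hm : ‖∑ k ∈ Finset.Ioc d K, t k‖ ≤ ε / 2 := by
    refine (norm_sum_le _ _).trans ?_
    have : ∀ k ∈ Finset.Ioc d K, ‖t k‖ ≤ ε / (2 * (K + 1)) := by
      intro k hk
      have hk0 : k ≠ 0 := by have := (Finset.mem_Ioc.1 hk).1; omega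
      simp only [ht, hk0, if_false, norm_mul, norm_pow]
      exact (by gcongr : _ ≤ ‖logCoeff (toMatrix W) k‖ * R ^ k).trans (hmid k hk)
    refine (Finset.sum_le_card_nsmul _ _ _ this).trans ?_
    rw [Nat.card_Ioc, nsmul_eq_mul]
    have h1 : ((K - d : ℕ) : ℝ) ≤ K + 1 := by exact_mod_cast (by omega : K - d ≤ K + 1)
    calc _ ≤ ((K : ℝ) + 1) * (ε / (2 * (K + 1))) := by gcongr
      _ = ε / 2 := by field_simp
  have htl : ‖∑' k, t (k + (K + 1))‖ ≤ ε / 2 := by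
    refine le_trans ?_ htail
    refine tsum_of_norm_bounded (g := fun k => B * (R / R') ^ (K + 1) * (R / R') ^ k) ?_ fun k => ?_
    · rw [div_eq_mul_inv]
      exact (hasSum_geometric_of_lt_one hq0 hq1).mul_left _
    · have hk0 : k + (K + 1) ≠ 0 := by omega
      simp only [ht, hk0, if_false, norm_mul, norm_pow]
      have h1 := hbound (k + (K + 1)) (by omega)
      calc _ ≤ B / R' ^ (k + (K + 1)) * R ^ (k + (K + 1)) := by gcongr
        _ = _ := by
          rw [div_pow, div_pow, pow_add R', pow_add R]
          field_simp
  rw [e]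
  exact (norm_add_le _ _).trans (by linarith)

theorem measure_logCoeff_gt_le {k : ℕ} {C lam : ℝ} (hlam : 0 < lam)
    (hI : Integrable (fun W => ‖logCoeff (toMatrix W) k‖ ^ 2) (gaussianVec (Fin n × Fin n)))
    (h : ∫ W, ‖logCoeff (toMatrix W) k‖ ^ 2 ∂(gaussianVec (Fin n × Fin n)) ≤ C) :
    gaussianVec (Fin n × Fin n) {W | ¬ ‖logCoeff (toMatrix W) k‖ ≤ lam} ≤
      ENNReal.ofReal (C / lam ^ 2) := by
  have hM := mul_meas_ge_le_integral_of_nonneg (Filter.Eventually.of_forall fun W => by positivity)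
    hI (lam ^ 2)
  have h2 : (gaussianVec (Fin n × Fin n)).real {W | lam ^ 2 ≤ ‖logCoeff (toMatrix W) k‖ ^ 2} ≤
      C / lam ^ 2 := by
    rw [le_div_iff₀ (by positivity), mul_comm]
    exact hM.trans h
  rw [← ENNReal.ofReal_toReal (measure_ne_top (gaussianVec (Fin n × Fin n)) _)]
  refine ENNReal.ofReal_le_ofReal (le_trans ?_ h2)
  refine measureReal_mono fun W hW => ?_
  have hW' : lam ≤ ‖logCoeff (toMatrix W) k‖ := (not_le.1 hW).le
  exact pow_le_pow_left₀ hlam.le hW' 2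

/-- Chebyshev's inequality. The failure probability is of order `n` to the power `2γ - (k - 1) +
2k(1/3 - β)`, negative exactly for `γ < k/6 + βk - 1/2`; the worst case `k = d + 1` is the tradeoff
exponent. -/
theorem eventually_measure_logCoeff_gt_le {β γ δ c : ℝ} {d k : ℕ} (hβ : 0 < β) (hk : d < k)
    (hγ : γ < tradeoffExponent d β) (hδ : 0 < δ) (hc : 0 < c) :
    ∀ᶠ n : ℕ in Filter.atTop, gaussianVec (Fin n × Fin n)
      {W | ¬ ‖logCoeff (toMatrix W) k‖ * ((n : ℝ) ^ (1 / 3 - β)) ^ k ≤ c * (n : ℝ) ^ (-γ)} ≤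
        ENNReal.ofReal δ := by
  obtain ⟨C, N, hC, h⟩ := exists_integral_norm_logCoeff_sq_le k (by omega)
  have hexp : 2 * γ - (k - 1) + 2 * (k * (1 / 3 - β)) < 0 := by
    have h1 : (d + 1 : ℝ) ≤ k := by exact_mod_cast hk
    rw [tradeoffExponent] at hγ
    nlinarith
  have hlim : Filter.Tendsto (fun n : ℕ => C / c ^ 2 *
      (n : ℝ) ^ (2 * γ - (k - 1) + 2 * (k * (1 / 3 - β)))) Filter.atTop (nhds 0) := by
    have h1 := (tendsto_rpow_neg_atTop (neg_pos.2 hexp)).comp tendsto_natCast_atTop_atTop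
    have h2 := h1.const_mul (C / c ^ 2)
    rw [mul_zero] at h2
    simpa only [Function.comp_def, neg_neg] using h2
  filter_upwards [Filter.eventually_ge_atTop N, Filter.eventually_gt_atTop 0,
    hlim.eventually_le_const hδ] with n hnN hn0 hn
  have hn' : (0 : ℝ) < n := by exact_mod_cast hn0
  set r : ℝ := ((n : ℝ) ^ (1 / 3 - β)) ^ k with hr
  have hr0 : 0 < r := by positivity
  have key := measure_logCoeff_gt_le (lam := c * (n : ℝ) ^ (-γ) / r) (by positivity)
    (h n hnN).1 (h n hnN).2
  simp only [le_div_iff₀ hr0] at key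
  refine key.trans (ENNReal.ofReal_le_ofReal (le_trans (le_of_eq ?_) hn))
  have e1 : r ^ 2 = (n : ℝ) ^ (2 * (k * (1 / 3 - β))) := by
    rw [hr, ← pow_mul, ← Real.rpow_natCast, ← Real.rpow_mul hn'.le]
    congr 1; push_cast; ring
  have e2 : ((n : ℝ) ^ (-γ)) ^ 2 = ((n : ℝ) ^ (2 * γ))⁻¹ := by
    rw [← Real.rpow_neg hn'.le, ← Real.rpow_natCast, ← Real.rpow_mul hn'.le]
    congr 1; push_cast; ring
  have e3 : (n : ℝ)⁻¹ ^ (k - 1) = (n : ℝ) ^ (-((k : ℝ) - 1)) := by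
    rw [Real.rpow_neg hn'.le, inv_pow, ← Real.rpow_natCast, Nat.cast_sub (by omega)]
    push_cast; rfl
  rw [sub_eq_add_neg (2 * γ), Real.rpow_add hn', Real.rpow_add hn', ← e1, ← e3, div_pow, mul_pow, e2]
  field_simp

/-- The ratio of the radii is `n ^ (-β/2)`, so `K + 1` factors beat both the bound `3n` for the
branch and `n ^ (-γ)`. The `12` below is `3 * 4`, with `4` from the target `1/2` and from `1 - ratio
≥ 1/2`. -/
theorem eventually_tail_le {β γ : ℝ} (hβ : 0 < β) {K : ℕ} (hK : 1 + γ < β / 2 * (K + 1)) :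
    ∀ᶠ n : ℕ in Filter.atTop, (n : ℝ) ^ (1 / 3 - β) < (n : ℝ) ^ (1 / 3 - β / 2) ∧
      3 * (n : ℝ) * ((n : ℝ) ^ (1 / 3 - β) / (n : ℝ) ^ (1 / 3 - β / 2)) ^ (K + 1) /
        (1 - (n : ℝ) ^ (1 / 3 - β) / (n : ℝ) ^ (1 / 3 - β / 2)) ≤ (n : ℝ) ^ (-γ) / 2 := by
  have l1 : Filter.Tendsto (fun n : ℕ => (n : ℝ) ^ (-(β / 2))) Filter.atTop (nhds 0) :=
    (tendsto_rpow_neg_atTop (by positivity)).comp tendsto_natCast_atTop_atTop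
  have l2 : Filter.Tendsto (fun n : ℕ => 12 * (n : ℝ) ^ (-(β / 2 * (K + 1) - (1 + γ))))
      Filter.atTop (nhds 0) := by
    have := ((tendsto_rpow_neg_atTop (sub_pos.2 hK)).comp tendsto_natCast_atTop_atTop).const_mul
      (12 : ℝ)
    rw [mul_zero] at this
    exact this
  filter_upwards [Filter.eventually_gt_atTop 1,
    l1.eventually_le_const (show (0 : ℝ) < 1 / 2 by norm_num),
    l2.eventually_le_const one_pos] with n hn h1 h2
  have hn1 : (1 : ℝ) < n := by exact_mod_cast hn
  have hn0 : (0 : ℝ) < n := by linarith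
  have hq : (n : ℝ) ^ (1 / 3 - β) / (n : ℝ) ^ (1 / 3 - β / 2) = (n : ℝ) ^ (-(β / 2)) := by
    rw [← Real.rpow_sub hn0]; congr 1; ring
  refine ⟨Real.rpow_lt_rpow_of_exponent_lt hn1 (by linarith), ?_⟩
  rw [hq, div_le_iff₀ (by linarith)]
  have e1 : ((n : ℝ) ^ (-(β / 2))) ^ (K + 1) =
      (n : ℝ) ^ (-(β / 2 * (K + 1) - (1 + γ))) * ((n : ℝ)⁻¹ * (n : ℝ) ^ (-γ)) := by
    rw [← Real.rpow_neg_one, ← Real.rpow_add hn0, ← Real.rpow_add hn0, ← Real.rpow_natCast,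
      ← Real.rpow_mul hn0.le]
    congr 1; push_cast; ring
  have hp : 0 < (n : ℝ) ^ (-γ) := by positivity
  rw [e1]
  calc _ = (12 * (n : ℝ) ^ (-(β / 2 * (K + 1) - (1 + γ)))) * ((n : ℝ) ^ (-γ) / 4) := by
        field_simp; ring
    _ ≤ 1 * ((n : ℝ) ^ (-γ) / 4) := by gcongr
    _ ≤ (n : ℝ) ^ (-γ) / 2 * (1 - (n : ℝ) ^ (-(β / 2))) := by nlinarith

/-- The zero-free disk is taken with `β/2` in place of `β`, to have room for Cauchy's estimates.
Since `K` depends on `d`, `β` and `γ` only, finitely many coefficient events are excluded, with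
total probability at most `δ/2`. -/
theorem eventually_measure_not_logBranchApprox_le {β γ δ : ℝ} {d : ℕ} (hβ : 0 < β)
    (hγ : γ < tradeoffExponent d β) (hδ : 0 < δ) :
    ∀ᶠ n : ℕ in Filter.atTop, gaussianVec (Fin n × Fin n)
      {W | ¬ LogBranchApprox (toMatrix W) ((n : ℝ) ^ (1 / 3 - β)) d ((n : ℝ) ^ (-γ))} ≤
        ENNReal.ofReal δ := by
  obtain ⟨K, hdK, hK⟩ : ∃ K : ℕ, d ≤ K ∧ 1 + γ < β / 2 * (K + 1) := by
    obtain ⟨m, hm⟩ := exists_nat_gt ((1 + γ) / (β / 2))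
    refine ⟨max d m, le_max_left _ _, ?_⟩
    rw [div_lt_iff₀ (by positivity)] at hm
    have : (m : ℝ) ≤ (max d m : ℕ) := by exact_mod_cast le_max_right d m
    nlinarith
  have hK0 : (0 : ℝ) < K + 1 := by positivity
  have hmid : ∀ᶠ n : ℕ in Filter.atTop, ∀ k ∈ Finset.Ioc d K, gaussianVec (Fin n × Fin n)
      {W | ¬ ‖logCoeff (toMatrix W) k‖ * ((n : ℝ) ^ (1 / 3 - β)) ^ k ≤
        1 / (2 * (K + 1)) * (n : ℝ) ^ (-γ)} ≤ ENNReal.ofReal (δ / (2 * (K + 1))) := by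
    rw [Filter.eventually_all_finset]
    intro k hk
    exact eventually_measure_logCoeff_gt_le hβ (Finset.mem_Ioc.1 hk).1 hγ (by positivity)
      (by positivity)
  filter_upwards [hmid, eventually_tail_le hβ hK, Filter.eventually_gt_atTop 0,
    eventually_measure_not_hasLogBranch_le (β := β / 2) (δ := δ / 2) (by positivity)
    (by positivity)] with n h1 h2 hn h3
  have hn0 : (0 : ℝ) < n := by exact_mod_cast hn
  set μ := gaussianVec (Fin n × Fin n)
  set S : ℕ → Set (Fin n × Fin n → ℂ) := fun k =>
    {W | ¬ ‖logCoeff (toMatrix W) k‖ * ((n : ℝ) ^ (1 / 3 - β)) ^ k ≤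
        1 / (2 * (K + 1)) * (n : ℝ) ^ (-γ)} with hS
  refine (measure_mono (t := {W | ¬ HasLogBranch W ((n : ℝ) ^ (1 / 3 - β / 2)) (3 * n)} ∪
    ⋃ k ∈ Finset.Ioc d K, S k) fun W hW => ?_).trans ?_
  · by_contra hcon
    simp only [mem_union, mem_setOf_eq, not_or, not_not, mem_iUnion, not_exists, hS] at hcon
    refine hW (logBranchApprox_of_hasLogBranch (by positivity) h2.1 (by positivity) hcon.1 hdK
      (by positivity) (fun k hk => (hcon.2 k hk).trans (le_of_eq (by ring))) h2.2)
  · refine (measure_union_le _ _).trans ((add_le_add h3 ((measure_biUnion_finset_le _ _).trans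
      (Finset.sum_le_sum fun k hk => h1 k hk))).trans ?_)
    rw [Finset.sum_const, Nat.card_Ioc, nsmul_eq_mul, ← ENNReal.ofReal_natCast,
      ← ENNReal.ofReal_mul (by positivity), ← ENNReal.ofReal_add (by positivity) (by positivity)]
    refine ENNReal.ofReal_le_ofReal ?_
    have h4 : ((K - d : ℕ) : ℝ) ≤ K + 1 := by exact_mod_cast (by omega : K - d ≤ K + 1)
    calc _ ≤ δ / 2 + ((K : ℝ) + 1) * (δ / (2 * (K + 1))) := by gcongr
      _ = δ := by field_simp; ring

end Approx

/-! ### Transfer to matrices with independent Gaussian entries -/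

theorem IsIIDComplexGaussian.measure_le {Ω : Type*} [MeasurableSpace Ω] {P : Measure Ω}
    [IsProbabilityMeasure P] {n : ℕ} {W : Ω → Matrix (Fin n) (Fin n) ℂ}
    (hW : IsIIDComplexGaussian W P) (p : Matrix (Fin n) (Fin n) ℂ → Prop) :
    P {ω | p (W ω)} ≤ gaussianVec (Fin n × Fin n) {w | p (toMatrix w)} := by
  have hm : ∀ e : Fin n × Fin n, AEMeasurable (fun ω => W ω e.1 e.2) P := fun e =>
    (hW.law e.1 e.2).aemeasurable
  have h1 := (iIndepFun_iff_map_fun_eq_pi_map hm).1 hW.indep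
  have h2 : P.map (fun ω (e : Fin n × Fin n) => W ω e.1 e.2) = gaussianVec (Fin n × Fin n) := by
    rw [h1, gaussianVec]
    congr 1
    funext e
    exact (hW.law e.1 e.2).map_eq
  rw [← h2]
  -- This inequality holds for arbitrary sets, so the measurability of the event is not needed.
  exact Measure.le_map_apply (aemeasurable_pi_lambda _ hm) {w | p (toMatrix w)}

theorem exists_forall_measure_not_logBranchApprox_le {β γ δ : ℝ} {d : ℕ} (hβ : 0 < β)
    (hγ : γ < tradeoffExponent d β) (hδ : 0 < δ) : ∃ N : ℕ, ∀ n : ℕ, N ≤ n →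
      ∀ (Ω : Type*) [MeasurableSpace Ω] (P : Measure Ω) [IsProbabilityMeasure P]
        (W : Ω → Matrix (Fin n) (Fin n) ℂ), IsIIDComplexGaussian W P →
        P {ω | ¬ LogBranchApprox (W ω) ((n : ℝ) ^ (1 / 3 - β)) d ((n : ℝ) ^ (-γ))} ≤
          ENNReal.ofReal δ := by
  obtain ⟨N, hN⟩ := Filter.eventually_atTop.1
    (eventually_measure_not_logBranchApprox_le hβ hγ hδ)
  exact ⟨N, fun n hn Ω _ P _ W hW => (hW.measure_le fun M => ¬ LogBranchApprox M
    ((n : ℝ) ^ (1 / 3 - β)) d ((n : ℝ) ^ (-γ))).trans (hN n hn)⟩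

/-! ### Programs: enumeration of partial matchings -/

section Ram

variable {n : ℕ} {W : Matrix (Fin n) (Fin n) ℂ}

/-- The program `p` runs from `s` to `s'` in at most `T` steps. -/
def Runs (W : Matrix (Fin n) (Fin n) ℂ) (p : RamProg) (s : RamState) (T : ℕ) (s' : RamState) :
    Prop := ∃ t ≤ T, RamExec W p s t s'

theorem Runs.mono {p : RamProg} {s s' : RamState} {T T' : ℕ} (h : Runs W p s T s') (hT : T ≤ T') :
    Runs W p s T' s' := by
  obtain ⟨t, ht, h⟩ := h
  exact ⟨t, ht.trans hT, h⟩

theorem Runs.seq {p q : RamProg} {s₁ s₂ s₃ : RamState} {T₁ T₂ : ℕ} (hp : Runs W p s₁ T₁ s₂)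
    (hq : Runs W q s₂ T₂ s₃) : Runs W (.seq p q) s₁ (T₁ + T₂) s₃ := by
  obtain ⟨t₁, h₁, hp⟩ := hp
  obtain ⟨t₂, h₂, hq⟩ := hq
  exact ⟨t₁ + t₂, by omega, .seq hp hq⟩

theorem Runs.op {o : RamOp} {s s' : RamState} (h : o.eval W s = some s') : Runs W (.op o) s 1 s' :=
  ⟨1, le_rfl, .op h⟩

/-- Run `p` if `idx[a] ≠ idx[b]`. -/
def ifNe (a b : ℕ) (p : RamProg) : RamProg := .ite a b p (.ite b a p (.op .skip))

theorem Runs.ifNe_of_ne {a b : ℕ} {p : RamProg} {s s' : RamState} {T : ℕ} (h : s.idx a ≠ s.idx b)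
    (hp : Runs W p s T s') : Runs W (ifNe a b p) s (T + 2) s' := by
  obtain ⟨t, ht, hp⟩ := hp
  rcases lt_or_gt_of_ne h with h | h
  · exact ⟨t + 1, by omega, .iteTrue h hp⟩
  · exact ⟨t + 1 + 1, by omega, .iteFalse h.not_gt (.iteTrue h hp)⟩

theorem Runs.ifNe_of_eq {a b : ℕ} {p : RamProg} {s : RamState} (h : s.idx a = s.idx b) :
    Runs W (ifNe a b p) s 3 s :=
  ⟨1 + 1 + 1, le_rfl, .iteFalse h.not_lt (.iteFalse h.symm.not_lt (.op rfl))⟩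

/-- Run `p` if the cell in the registers `R, C` avoids the cells in the first `m` pairs of
registers. -/
def guards (R C : ℕ) (p : RamProg) : ℕ → RamProg
  | 0 => p
  | l + 1 => ifNe (2 + 2 * l) R (ifNe (3 + 2 * l) C (guards R C p l))

/-- The registers hold the cells of the list, the last one at the head. -/
def Holds (s : RamState) : List (Fin n × Fin n) → Prop
  | [] => True
  | x :: L => s.idx (2 + 2 * L.length) = x.1 ∧ s.idx (3 + 2 * L.length) = x.2 ∧ Holds s L

theorem Runs.guards_of_avoids {R C : ℕ} {p : RamProg} {s s' : RamState} {T : ℕ}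
    {x : Fin n × Fin n} {L : List (Fin n × Fin n)} (hR : s.idx R = x.1) (hC : s.idx C = x.2)
    (hs : Holds s L) (h : ∀ y ∈ L, Shuffle.Avoids y x) (hp : Runs W p s T s') :
    Runs W (guards R C p L.length) s (T + 4 * L.length) s' := by
  induction L with
  | nil => exact hp
  | cons y L ih =>
    obtain ⟨h1, h2, h3⟩ := hs
    have hy := h y List.mem_cons_self
    rw [List.length_cons, guards]
    refine Runs.mono (Runs.ifNe_of_ne ?_ (Runs.ifNe_of_ne ?_ (ih h3 fun y hy =>
      h y (List.mem_cons_of_mem _ hy)))) (by omega)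
    · rw [h1, hR]; exact fun e => hy.1 (Fin.ext e)
    · rw [h2, hC]; exact fun e => hy.2 (Fin.ext e)

theorem Runs.guards_of_not_avoids {R C : ℕ} {p : RamProg} {s : RamState}
    {x : Fin n × Fin n} {L : List (Fin n × Fin n)} (hR : s.idx R = x.1) (hC : s.idx C = x.2)
    (hs : Holds s L) (h : ¬ ∀ y ∈ L, Shuffle.Avoids y x) :
    Runs W (guards R C p L.length) s (4 * L.length + 1) s := by
  induction L with
  | nil => simp at h
  | cons y L ih =>
    obtain ⟨h1, h2, h3⟩ := hs
    rw [List.length_cons, guards]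
    by_cases a1 : y.1 = x.1
    · exact (Runs.ifNe_of_eq (by rw [h1, hR, a1])).mono (by omega)
    by_cases a2 : y.2 = x.2
    · refine Runs.mono (Runs.ifNe_of_ne ?_ (Runs.ifNe_of_eq (by rw [h2, hC, a2]))) (by omega)
      rw [h1, hR]; exact fun e => a1 (Fin.ext e)
    · refine Runs.mono (Runs.ifNe_of_ne ?_ (Runs.ifNe_of_ne ?_ (ih h3 fun hL => h ?_))) (by omega)
      · rw [h1, hR]; exact fun e => a1 (Fin.ext e)
      · rw [h2, hC]; exact fun e => a2 (Fin.ext e)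
      · intro w hw
        rcases List.mem_cons.1 hw with rfl | hw
        · exact ⟨a1, a2⟩
        · exact hL w hw

/-- The states agree on the index registers below `b`, and on the number registers `0` and
`3 + d, …, q`. -/
def Agree (d b q : ℕ) (s s' : RamState) : Prop :=
  (∀ a < b, s'.idx a = s.idx a) ∧ ∀ a, a = 0 ∨ 3 + d ≤ a ∧ a ≤ q → s'.num a = s.num a

/-- The states agree, except that `c k` is added to the accumulators `2 + k`, for `k ≤ d`. -/
def Adds (d b q : ℕ) (c : ℕ → ℂ) (s s' : RamState) : Prop :=
  Agree d b q s s' ∧ ∀ k ≤ d, s'.num (2 + k) = s.num (2 + k) + c k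

theorem Agree.trans {d b q : ℕ} {s₁ s₂ s₃ : RamState} (h : Agree d b q s₁ s₂)
    (h' : Agree d b q s₂ s₃) : Agree d b q s₁ s₃ :=
  ⟨fun a ha => (h'.1 a ha).trans (h.1 a ha), fun a ha => (h'.2 a ha).trans (h.2 a ha)⟩

theorem Agree.refl (d b q : ℕ) (s : RamState) : Agree d b q s s := ⟨fun _ _ => rfl, fun _ _ => rfl⟩

theorem Agree.mono {d b b' q q' : ℕ} {s s' : RamState} (h : Agree d b q s s') (hb : b' ≤ b)
    (hq : q' ≤ q) : Agree d b' q' s s' :=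
  ⟨fun a ha => h.1 a (ha.trans_le hb), fun a ha => h.2 a (by omega)⟩

theorem Adds.trans {d b q : ℕ} {c c' : ℕ → ℂ} {s₁ s₂ s₃ : RamState} (h : Adds d b q c s₁ s₂)
    (h' : Adds d b q c' s₂ s₃) : Adds d b q (fun k => c k + c' k) s₁ s₃ :=
  ⟨h.1.trans h'.1, fun k hk => by rw [h'.2 k hk, h.2 k hk, add_assoc]⟩

theorem Adds.mono {d b b' q q' : ℕ} {c : ℕ → ℂ} {s s' : RamState} (h : Adds d b q c s s')
    (hb : b' ≤ b) (hq : q' ≤ q) : Adds d b' q' c s s' := ⟨h.1.mono hb hq, h.2⟩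

theorem Adds.congr {d b q : ℕ} {c c' : ℕ → ℂ} {s s' : RamState} (h : Adds d b q c s s')
    (hc : ∀ k ≤ d, c k = c' k) : Adds d b q c' s s' :=
  ⟨h.1, fun k hk => by rw [h.2 k hk, hc k hk]⟩

theorem Adds.zero {d b q : ℕ} {s s' : RamState} (h : Agree d b q s s')
    (h' : ∀ k ≤ d, s'.num (2 + k) = s.num (2 + k)) : Adds d b q (fun _ => 0) s s' :=
  ⟨h, fun k hk => by rw [h' k hk, add_zero]⟩

theorem adds_setIdx {d b q I v : ℕ} (s : RamState) (h : b ≤ I) :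
    Adds d b q (fun _ => 0) s (s.setIdx I v) :=
  .zero ⟨fun _ ha => Function.update_of_ne (by omega) _ _, fun _ _ => rfl⟩ fun _ _ => rfl

theorem setIdx_idx_self (s : RamState) (a v : ℕ) : (s.setIdx a v).idx a = v :=
  Function.update_self _ _ _

theorem setNum_num_self (s : RamState) (a : ℕ) (v : ℂ) : (s.setNum a v).num a = v :=
  Function.update_self _ _ _

theorem setNum_num_of_ne (s : RamState) {a b : ℕ} (v : ℂ) (h : b ≠ a) :
    (s.setNum a v).num b = s.num b := Function.update_of_ne h _ _

theorem Agree.holds {d b q : ℕ} {s s' : RamState} (h : Agree d b q s s')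
    {L : List (Fin n × Fin n)} (hb : 2 * L.length + 2 ≤ b) (hs : Holds s L) : Holds s' L := by
  induction L with
  | nil => trivial
  | cons x L ih =>
    rw [List.length_cons] at hb
    obtain ⟨h1, h2, h3⟩ := hs
    exact ⟨by rw [h.1 _ (by omega), h1], by rw [h.1 _ (by omega), h2], ih (by omega) h3⟩

/-- For `idx[I]` from `0` to `n - 1` do `p`. -/
def forLoop (I : ℕ) (p : RamProg) : RamProg :=
  .seq (.op (.idxConst I 0)) (.loop I 0 (.seq p (.op (.idxAdd I I 1))))

/-- The body is assumed to work from every state that agrees with `s₀`, so it can be iterated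
although it spoils registers above `I`. Each round costs `T` and two more steps, for the increment
and the test. -/
theorem runs_loop_aux {d I q T : ℕ} {p : RamProg} {c : Fin n → ℕ → ℂ} {s₀ : RamState} (hI : 2 ≤ I)
    (h0 : s₀.idx 0 = n) (h1 : s₀.idx 1 = 1)
    (hp : ∀ i : Fin n, ∀ s, Agree d I q s₀ s → s.idx I = i →
      ∃ s', Runs W p s T s' ∧ Adds d (I + 1) q (c i) s s') (m : ℕ) :
    ∀ i : ℕ, i + m = n → ∀ s, Agree d I q s₀ s → s.idx I = i →
      ∃ s', Runs W (.loop I 0 (.seq p (.op (.idxAdd I I 1)))) s (m * (T + 2) + 1) s' ∧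
        Adds d I q (fun k => ∑ j ∈ Finset.univ.filter fun j : Fin n => i ≤ j, c j k) s s' := by
  induction m with
  | zero =>
    intro i hi s hs hsI
    refine ⟨s, ⟨1, by omega, .loopStop ?_⟩, (Adds.zero (Agree.refl _ _ _ _) fun _ _ => rfl).congr
      fun k _ => ?_⟩
    · rw [hsI, hs.1 0 (by omega), h0]; omega
    · rw [Finset.filter_false_of_mem fun j _ => by omega, Finset.sum_empty]
  | succ m ih =>
    intro i hi s hs hsI
    have hin : i < n := by omega
    obtain ⟨s₁, ⟨t₁, ht₁, e₁⟩, a₁⟩ := hp ⟨i, hin⟩ s hs hsI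
    set s₂ := s₁.setIdx I (i + 1) with hs₂
    have e₂ : RamExec W (.op (.idxAdd I I 1)) s₁ 1 s₂ := by
      refine .op ?_
      rw [RamOp.eval, a₁.1.1 I (by omega), a₁.1.1 1 (by omega), hs.1 1 (by omega), h1, hsI]
    have a₂ : Adds d I q (fun k => c ⟨i, hin⟩ k + 0) s s₂ :=
      (a₁.mono (Nat.le_succ I) le_rfl).trans (adds_setIdx s₁ le_rfl)
    obtain ⟨s₃, ⟨t₃, ht₃, e₃⟩, a₃⟩ := ih (i + 1) (by omega) s₂ (hs.trans a₂.1)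
      (setIdx_idx_self _ _ _)
    refine ⟨s₃, ⟨(t₁ + 1) + t₃ + 1, ?_, .loopStep ?_ (.seq e₁ e₂) e₃⟩,
      (a₂.trans a₃).congr fun k _ => ?_⟩
    · rw [add_mul]; omega
    · rw [hsI, hs.1 0 (by omega), h0]; exact hin
    · have : (Finset.univ.filter fun j : Fin n => i ≤ j) =
          insert ⟨i, hin⟩ (Finset.univ.filter fun j : Fin n => i + 1 ≤ j) := by
        ext j
        simp only [Finset.mem_filter, Finset.mem_univ, true_and, Finset.mem_insert, Fin.ext_iff]
        omega
      rw [this, Finset.sum_insert (by simp), add_zero]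

theorem runs_forLoop {d I q T : ℕ} {p : RamProg} {c : Fin n → ℕ → ℂ} {s₀ : RamState} (hI : 2 ≤ I)
    (h0 : s₀.idx 0 = n) (h1 : s₀.idx 1 = 1)
    (hp : ∀ i : Fin n, ∀ s, Agree d I q s₀ s → s.idx I = i →
      ∃ s', Runs W p s T s' ∧ Adds d (I + 1) q (c i) s s') :
    ∃ s', Runs W (forLoop I p) s₀ (n * (T + 2) + 2) s' ∧
      Adds d I q (fun k => ∑ j, c j k) s₀ s' := by
  have a : Adds d I q (fun _ => 0) s₀ (s₀.setIdx I 0) := adds_setIdx s₀ le_rfl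
  obtain ⟨s', r, h⟩ := runs_loop_aux hI h0 h1 hp n 0 (by omega) (s₀.setIdx I 0) a.1
    (setIdx_idx_self _ _ _)
  refine ⟨s', (Runs.seq (Runs.op rfl) r).mono (by omega), (a.trans h).congr fun k _ => ?_⟩
  rw [zero_add]
  simp

/-- Enumeration of the extensions, by at most `r` cells, of the matching of the `m` cells in the
first registers. -/
def enumMatchings (d : ℕ) : ℕ → ℕ → RamProg
  | 0, m => .op (.numAdd (2 + m) (2 + m) (3 + d + m))
  | r + 1, m => .seq (.op (.numAdd (2 + m) (2 + m) (3 + d + m)))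
      (forLoop (2 + 2 * m) (forLoop (3 + 2 * m) (guards (2 + 2 * m) (3 + 2 * m)
        (.seq (.op (.entry 1 (2 + 2 * m) (3 + 2 * m)))
          (.seq (.op (.numMul (3 + d + (m + 1)) (3 + d + m) 1)) (enumMatchings d r (m + 1)))) m)))

open Classical in
/-- The sum over the extensions of a matching by `j` further cells. -/
noncomputable def extSum (W : Matrix (Fin n) (Fin n) ℂ) : ℕ → List (Fin n × Fin n) → ℂ
  | 0, _ => 1
  | j + 1, L => ∑ x : Fin n × Fin n,
      if ∀ y ∈ L, Shuffle.Avoids y x then W x.1 x.2 * extSum W j (x :: L) else 0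

/-- Layout: `idx 0 = n` and `idx 1 = 1`; the cell number `m` is in `idx (2 + 2 * m)` and `idx (3 + 2
* m)`; `num 1` is scratch; `num (2 + k)` accumulates the sum over matchings with `k` cells; `num (3
+ d + m)` holds the product of the first `m` entries. A deeper level writes only beyond the
registers of the current one, apart from scratch and accumulators. -/
theorem runs_enumMatchings {d : ℕ} (hn : 1 ≤ n) (r : ℕ) : ∀ (L : List (Fin n × Fin n)) (s : RamState),
    L.length + r = d → s.idx 0 = n → s.idx 1 = 1 → Holds s L →
    ∃ s', Runs W (enumMatchings d r L.length) s ((1 + r * (4 * d + 12)) * n ^ (2 * r)) s' ∧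
      Adds d (2 + 2 * L.length) (3 + d + L.length) (fun k => if L.length ≤ k then
        s.num (3 + d + L.length) * extSum W (k - L.length) L else 0) s s' := by
  have hacc : ∀ (L : List (Fin n × Fin n)) (s : RamState), L.length ≤ d →
      ∃ s', Runs W (.op (.numAdd (2 + L.length) (2 + L.length) (3 + d + L.length))) s 1 s' ∧
      Adds d (2 + 2 * L.length) (3 + d + L.length) (fun k => if k = L.length then
        s.num (3 + d + L.length) else 0) s s' := by
    intro L s hL
    refine ⟨_, Runs.op rfl, ⟨fun _ _ => rfl, fun a ha => setNum_num_of_ne _ _ (by omega)⟩,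
      fun k hk => ?_⟩
    beta_reduce
    split_ifs with h
    · rw [h, setNum_num_self]
    · rw [setNum_num_of_ne _ _ (by omega), add_zero]
  induction r with
  | zero =>
    intro L s hL h0 h1 hs
    obtain ⟨s', r, a⟩ := hacc L s (by omega)
    refine ⟨s', r.mono (by simp), a.congr fun k hk => ?_⟩
    by_cases h : k = L.length
    · simp [h, extSum]
    · rw [if_neg h, if_neg (by omega)]
  | succ r ih =>
    intro L s hL h0 h1 hs
    obtain ⟨s₁, r₁, a₁⟩ := hacc L s (by omega)
    set m := L.length with hm
    set v := s.num (3 + d + m) with hv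
    have hv₁ : s₁.num (3 + d + m) = v := a₁.1.2 _ (Or.inr ⟨by omega, le_rfl⟩)
    classical
    set T := (1 + r * (4 * d + 12)) * n ^ (2 * r) with hT
    set c : Fin n → Fin n → ℕ → ℂ := fun i j k => if m + 1 ≤ k then
      (if ∀ y ∈ L, Shuffle.Avoids y (i, j) then
        v * W i j * extSum W (k - (m + 1)) ((i, j) :: L) else 0) else 0 with hc
    have inner : ∀ (i j : Fin n) (s : RamState), Agree d (2 + 2 * m) (3 + d + m) s₁ s →
        s.idx (2 + 2 * m) = i → s.idx (3 + 2 * m) = j →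
        ∃ s', Runs W (guards (2 + 2 * m) (3 + 2 * m)
          (.seq (.op (.entry 1 (2 + 2 * m) (3 + 2 * m)))
          (.seq (.op (.numMul (3 + d + (m + 1)) (3 + d + m) 1)) (enumMatchings d r (m + 1)))) m) s
            (T + 4 * d + 3) s' ∧ Adds d (2 + 2 * m + 2) (3 + d + m) (c i j) s s' := by
      intro i j s ha hi hj
      have hsH : Holds s L := ha.holds (by omega) (a₁.1.holds (by omega) hs)
      by_cases hav : ∀ y ∈ L, Shuffle.Avoids y (i, j)
      · set s₂ := s.setNum 1 (W i j) with hs₂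
        have e₂ : Runs W (.op (.entry 1 (2 + 2 * m) (3 + 2 * m))) s 1 s₂ := by
          refine Runs.op ?_
          rw [RamOp.eval, dif_pos ⟨by rw [hi]; exact i.2, by rw [hj]; exact j.2⟩]
          simp only [hi, hj, Fin.eta, hs₂]
        set s₃ := s₂.setNum (3 + d + (m + 1)) (v * W i j) with hs₃
        have e₃ : Runs W (.op (.numMul (3 + d + (m + 1)) (3 + d + m) 1)) s₂ 1 s₃ := by
          refine Runs.op ?_
          rw [RamOp.eval, hs₂, setNum_num_self, setNum_num_of_ne _ _ (by omega),
            ha.2 _ (Or.inr ⟨by omega, le_rfl⟩), hv₁]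
        have hidx : s₃.idx = s.idx := rfl
        have hnum : ∀ a, a ≠ 1 → a ≠ 3 + d + (m + 1) → s₃.num a = s.num a := fun a h1 h2 => by
          rw [hs₃, setNum_num_of_ne _ _ h2, hs₂, setNum_num_of_ne _ _ h1]
        have hi0 : s.idx 0 = n := by rw [ha.1 0 (by omega), a₁.1.1 0 (by omega), h0]
        have hi1 : s.idx 1 = 1 := by rw [ha.1 1 (by omega), a₁.1.1 1 (by omega), h1]
        have hsH3 : Holds s₃ L :=
          Agree.holds (d := d) (b := 2 * m + 2) (q := 0) (s := s) (s' := s₃)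
            ⟨fun _ _ => rfl, fun a ha => hnum a (by omega) (by omega)⟩ le_rfl hsH
        obtain ⟨s₄, r₄, a₄⟩ := ih ((i, j) :: L) s₃ (by rw [List.length_cons]; omega)
          (by rw [hidx, hi0]) (by rw [hidx, hi1]) ⟨by rw [hidx, hi], by rw [hidx, hj], hsH3⟩
        rw [List.length_cons, ← hm] at r₄ a₄
        have a₃ : Adds d (2 + 2 * m + 2) (3 + d + m) (fun _ => 0) s s₃ :=
          .zero ⟨fun _ _ => rfl, fun a ha => hnum a (by omega) (by omega)⟩
            fun k hk => hnum _ (by omega) (by omega)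
        refine ⟨s₄, (Runs.guards_of_avoids (x := (i, j)) hi hj hsH hav
          (e₂.seq (e₃.seq r₄))).mono (by omega),
          (a₃.trans (a₄.mono (by omega) (by omega))).congr fun k _ => ?_⟩
        rw [zero_add, hc, hs₃, setNum_num_self]
        simp only [if_pos hav]
      · refine ⟨s, (Runs.guards_of_not_avoids (x := (i, j)) hi hj hsH hav).mono (by omega),
          (Adds.zero (Agree.refl _ _ _ _) fun _ _ => rfl).congr fun k _ => ?_⟩
        rw [hc]
        simp only [if_neg hav, ite_self]
    have hI0 : s₁.idx 0 = n := by rw [a₁.1.1 0 (by omega), h0]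
    have hI1 : s₁.idx 1 = 1 := by rw [a₁.1.1 1 (by omega), h1]
    obtain ⟨s₂, r₂, a₂⟩ := runs_forLoop (W := W) (d := d) (I := 2 + 2 * m) (q := 3 + d + m)
      (T := n * (T + 4 * d + 3 + 2) + 2) (p := forLoop (3 + 2 * m) (guards (2 + 2 * m) (3 + 2 * m)
          (.seq (.op (.entry 1 (2 + 2 * m) (3 + 2 * m)))
          (.seq (.op (.numMul (3 + d + (m + 1)) (3 + d + m) 1)) (enumMatchings d r (m + 1)))) m))
      (c := fun i k => ∑ j, c i j k) (s₀ := s₁) (by omega) hI0 hI1 (fun i s ha hi => by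
        obtain ⟨s', r', a'⟩ := runs_forLoop (W := W) (d := d) (I := 3 + 2 * m) (q := 3 + d + m)
          (T := T + 4 * d + 3) (c := c i) (s₀ := s) (by omega)
          (by rw [ha.1 0 (by omega), hI0]) (by rw [ha.1 1 (by omega), hI1]) (fun j s'' ha'' hj => by
            obtain ⟨s', r', a'⟩ := inner i j s'' (ha.trans (ha''.mono (by omega) le_rfl))
              (by rw [ha''.1 _ (by omega), hi]) hj
            exact ⟨s', r', a'.mono (by omega) le_rfl⟩)
        exact ⟨s', r', a'.mono (by omega) le_rfl⟩)
    refine ⟨s₂, (r₁.seq r₂).mono ?_, (a₁.trans a₂).congr fun k hk => ?_⟩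
    -- Each of the `n²` cells costs the inner enumeration plus `O(d)` steps for the guards and
    -- loops; the overhead is absorbed in `4 * d + 12` per level.
    · have e1 : (1 + (r + 1) * (4 * d + 12)) * n ^ (2 * (r + 1)) =
          n ^ 2 * T + (4 * d + 12) * (n ^ 2 * n ^ (2 * r)) := by
        rw [hT, show 2 * (r + 1) = 2 * r + 2 by ring, pow_add]; ring
      have h2 : 1 ≤ n ^ (2 * r) := Nat.one_le_pow _ _ hn
      have h3 : n ^ 2 ≤ n ^ 2 * n ^ (2 * r) := Nat.le_mul_of_pos_right _ h2
      have h4 : n ≤ n ^ 2 := Nat.le_self_pow (by norm_num) n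
      have h5 : (4 * d + 12) * n ^ 2 ≤ (4 * d + 12) * (n ^ 2 * n ^ (2 * r)) :=
        Nat.mul_le_mul_left _ h3
      have h6 : n * (n * (T + 4 * d + 3 + 2) + 2 + 2) = n ^ 2 * T + ((4 * d + 5) * n ^ 2 + 4 * n) := by
        ring
      have h7 : (4 * d + 12) * n ^ 2 = (4 * d + 5) * n ^ 2 + 7 * n ^ 2 := by ring
      rw [e1, h6]
      omega
    · rcases lt_trichotomy k m with h | h | h
      · rw [if_neg (by omega), if_neg (by omega), zero_add]
        refine Finset.sum_eq_zero fun i _ => Finset.sum_eq_zero fun j _ => ?_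
        rw [hc]
        simp only [if_neg (show ¬ m + 1 ≤ k by omega)]
      · rw [if_pos h, if_pos (by omega), h, Nat.sub_self, extSum, mul_one]
        rw [Finset.sum_eq_zero fun i _ => Finset.sum_eq_zero fun j _ => ?_, add_zero]
        rw [hc]
        simp only [if_neg (show ¬ m + 1 ≤ m by omega)]
      · rw [if_neg (by omega), if_pos h.le, zero_add, show k - m = (k - (m + 1)) + 1 by omega,
          extSum, Fintype.sum_prod_type, Finset.mul_sum]
        refine Finset.sum_congr rfl fun i _ => ?_
        rw [Finset.mul_sum]
        refine Finset.sum_congr rfl fun j _ => ?_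
        rw [hc]
        simp only [if_pos (show m + 1 ≤ k by omega), mul_ite, mul_zero]
        congr 1
        ring

end Ram

/-! ### Straight-line programs -/

/-- Arithmetic expressions in the number registers, the size of the matrix, and constants. -/
inductive RExpr where
  | reg (a : ℕ)
  | nat (k : ℕ)
  | size
  | add (e f : RExpr)
  | sub (e f : RExpr)
  | mul (e f : RExpr)
  | div (e f : RExpr)

namespace RExpr

/-- The value of an expression. -/
noncomputable def eval (n : ℕ) (v : ℕ → ℂ) : RExpr → ℂ
  | reg a => v a
  | nat k => k
  | size => n
  | add e f => eval n v e + eval n v f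
  | sub e f => eval n v e - eval n v f
  | mul e f => eval n v e * eval n v f
  | div e f => eval n v e / eval n v f

/-- The expression uses only the registers below `b`, and no denominator vanishes. -/
def Defined (n : ℕ) (v : ℕ → ℂ) (b : ℕ) : RExpr → Prop
  | reg a => a < b
  | nat _ => True
  | size => True
  | add e f => Defined n v b e ∧ Defined n v b f
  | sub e f => Defined n v b e ∧ Defined n v b f
  | mul e f => Defined n v b e ∧ Defined n v b f
  | div e f => Defined n v b e ∧ Defined n v b f ∧ eval n v f ≠ 0

theorem Defined.congr {n b b' : ℕ} {v v' : ℕ → ℂ} (hb : b ≤ b') (hv : ∀ a < b, v' a = v a)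
    {e : RExpr} (h : Defined n v b e) : Defined n v' b' e ∧ eval n v' e = eval n v e := by
  induction e with
  | reg a => exact ⟨lt_of_lt_of_le h hb, hv a h⟩
  | nat k => exact ⟨trivial, rfl⟩
  | size => exact ⟨trivial, rfl⟩
  | add e f ihe ihf =>
    exact ⟨⟨(ihe h.1).1, (ihf h.2).1⟩, by simp only [eval, (ihe h.1).2, (ihf h.2).2]⟩
  | sub e f ihe ihf =>
    exact ⟨⟨(ihe h.1).1, (ihf h.2).1⟩, by simp only [eval, (ihe h.1).2, (ihf h.2).2]⟩
  | mul e f ihe ihf =>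
    exact ⟨⟨(ihe h.1).1, (ihf h.2).1⟩, by simp only [eval, (ihe h.1).2, (ihf h.2).2]⟩
  | div e f ihe ihf =>
    exact ⟨⟨(ihe h.1).1, (ihf h.2.1).1, by rw [(ihf h.2.1).2]; exact h.2.2⟩,
      by simp only [eval, (ihe h.1).2, (ihf h.2.1).2]⟩

/-- Evaluate the expression into the register `r`, using the registers from `r` on. -/
def compile : RExpr → ℕ → RamProg
  | reg a, r => .seq (.op (.numConst r 0)) (.op (.numAdd r a r))
  | nat k, r => .op (.numConst r k)
  | size, r => .op (.numOfIdx r 0)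
  | add e f, r => .seq (compile e r) (.seq (compile f (r + 1)) (.op (.numAdd r r (r + 1))))
  | sub e f, r => .seq (compile e r) (.seq (compile f (r + 1)) (.op (.numSub r r (r + 1))))
  | mul e f, r => .seq (compile e r) (.seq (compile f (r + 1)) (.op (.numMul r r (r + 1))))
  | div e f, r => .seq (compile e r) (.seq (compile f (r + 1)) (.op (.numDiv r r (r + 1))))

/-- The number of steps of the evaluation. -/
def cost : RExpr → ℕ
  | reg _ => 2
  | nat _ => 1
  | size => 1
  | add e f => cost e + (cost f + 1)
  | sub e f => cost e + (cost f + 1)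
  | mul e f => cost e + (cost f + 1)
  | div e f => cost e + (cost f + 1)

/-- The state `s'` arises from `s` by writing `x` to the register `r` and arbitrary values to the
later number registers. -/
def Writes (r : ℕ) (x : ℂ) (s s' : RamState) : Prop :=
  s'.idx = s.idx ∧ s'.num r = x ∧ ∀ a < r, s'.num a = s.num a

section

variable {n : ℕ} {W : Matrix (Fin n) (Fin n) ℂ}

theorem runs_binary {o : RamOp} {p q : RamProg} {r T T' : ℕ} {x y z : ℂ} {s : RamState}
    (hp : ∃ s', Runs W p s T s' ∧ Writes r x s s')
    (hq : ∀ s₁, Writes r x s s₁ → ∃ s', Runs W q s₁ T' s' ∧ Writes (r + 1) y s₁ s')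
    (ho : ∀ s₂ : RamState, s₂.num r = x → s₂.num (r + 1) = y → o.eval W s₂ = some (s₂.setNum r z)) :
    ∃ s', Runs W (.seq p (.seq q (.op o))) s (T + (T' + 1)) s' ∧ Writes r z s s' := by
  obtain ⟨s₁, r₁, w₁⟩ := hp
  obtain ⟨s₂, r₂, w₂⟩ := hq s₁ w₁
  refine ⟨_, r₁.seq (r₂.seq (Runs.op (ho s₂ ?_ w₂.2.1))), w₂.1.trans w₁.1, setNum_num_self _ _ _,
    fun a ha => ?_⟩
  · rw [w₂.2.2 _ (Nat.lt_succ_self r), w₁.2.1]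
  · rw [setNum_num_of_ne _ _ ha.ne, w₂.2.2 a (by omega), w₁.2.2 a ha]

theorem runs_compile (e : RExpr) : ∀ (r : ℕ) (s : RamState), s.idx 0 = n → Defined n s.num r e →
    ∃ s', Runs W (compile e r) s e.cost s' ∧ Writes r (eval n s.num e) s s' := by
  have next {e f : RExpr} {r : ℕ} {s : RamState} {x : ℂ}
      (ih : ∀ (r : ℕ) (s : RamState), s.idx 0 = n → Defined n s.num r f →
        ∃ s', Runs W (compile f r) s f.cost s' ∧ Writes r (eval n s.num f) s s')
      (h0 : s.idx 0 = n) (h : Defined n s.num r f) (s₁ : RamState) (w : Writes r x s s₁) :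
      ∃ s', Runs W (compile f (r + 1)) s₁ f.cost s' ∧ Writes (r + 1) (eval n s.num f) s₁ s' := by
    obtain ⟨h1, h2⟩ := h.congr (Nat.le_succ r) w.2.2
    rw [← h2]
    exact ih (r + 1) s₁ (by rw [w.1, h0]) h1
  induction e with
  | reg a =>
    intro r s h0 h
    -- A copy is an addition to a cleared register; clearing does no harm, as `a < r`.
    refine ⟨(s.setNum r (0 : ℕ)).setNum r ((s.setNum r (0 : ℕ)).num a + (s.setNum r (0 : ℕ)).num r),
      Runs.seq (Runs.op rfl) (Runs.op rfl), rfl, ?_, fun b hb => ?_⟩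
    · rw [setNum_num_self, setNum_num_self, setNum_num_of_ne _ _ (ne_of_lt h), Nat.cast_zero,
        add_zero, eval]
    · rw [setNum_num_of_ne _ _ hb.ne, setNum_num_of_ne _ _ hb.ne]
  | nat k =>
    intro r s h0 h
    exact ⟨_, Runs.op rfl, rfl, setNum_num_self _ _ _, fun b hb => setNum_num_of_ne _ _ hb.ne⟩
  | size =>
    intro r s h0 h
    exact ⟨_, Runs.op rfl, rfl, by rw [setNum_num_self, h0, eval],
      fun b hb => setNum_num_of_ne _ _ hb.ne⟩
  | add e f ihe ihf =>
    intro r s h0 h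
    exact runs_binary (ihe r s h0 h.1) (next (e := e) ihf h0 h.2)
      fun s₂ h1 h2 => by rw [RamOp.eval, h1, h2, eval]
  | sub e f ihe ihf =>
    intro r s h0 h
    exact runs_binary (ihe r s h0 h.1) (next (e := e) ihf h0 h.2)
      fun s₂ h1 h2 => by rw [RamOp.eval, h1, h2, eval]
  | mul e f ihe ihf =>
    intro r s h0 h
    exact runs_binary (ihe r s h0 h.1) (next (e := e) ihf h0 h.2)
      fun s₂ h1 h2 => by rw [RamOp.eval, h1, h2, eval]
  | div e f ihe ihf =>
    intro r s h0 h
    exact runs_binary (ihe r s h0 h.1) (next (e := e) ihf h0 h.2.1)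
      fun s₂ h1 h2 => by rw [RamOp.eval, h1, h2, if_neg h.2.2, eval]

/-- Evaluate the expressions `f 0, …, f (m - 1)` into the registers `b, …, b + m - 1`. -/
def lines (f : ℕ → RExpr) (b : ℕ) : ℕ → RamProg
  | 0 => .op .skip
  | m + 1 => .seq (lines f b m) (compile (f m) (b + m))

/-- The hypothesis allows every assignment with the correct earlier values, so a line may refer to
the results of preceding lines. Temporary values lie above the current target and are overwritten.
-/
theorem runs_lines {f : ℕ → RExpr} {b : ℕ} {x : ℕ → ℂ} {s : RamState} (h0 : s.idx 0 = n) (m : ℕ)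
    (hf : ∀ k < m, ∀ v : ℕ → ℂ, (∀ a < b, v a = s.num a) → (∀ i < k, v (b + i) = x i) →
      Defined n v (b + k) (f k) ∧ eval n v (f k) = x k) :
    ∃ s', Runs W (lines f b m) s (∑ k ∈ Finset.range m, (f k).cost + 1) s' ∧ s'.idx = s.idx ∧
      (∀ a < b, s'.num a = s.num a) ∧ ∀ i < m, s'.num (b + i) = x i := by
  induction m with
  | zero => exact ⟨s, (Runs.op rfl).mono (by simp), rfl, fun _ _ => rfl, fun _ h => by omega⟩
  | succ m ih =>
    obtain ⟨s₁, r₁, i₁, l₁, x₁⟩ := ih fun k hk => hf k (by omega)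
    obtain ⟨h1, h2⟩ := hf m (Nat.lt_succ_self m) s₁.num l₁ x₁
    obtain ⟨s₂, r₂, i₂, x₂, l₂⟩ := runs_compile (W := W) (f m) (b + m) s₁ (by rw [i₁, h0]) h1
    refine ⟨s₂, (r₁.seq r₂).mono (by rw [Finset.sum_range_succ]; omega), i₂.trans i₁,
      fun a ha => by rw [l₂ a (by omega), l₁ a ha], fun i hi => ?_⟩
    rcases Nat.lt_succ_iff_lt_or_eq.1 hi with h | rfl
    · rw [l₂ _ (by omega), x₁ i h]
    · rw [x₂, h2]

end

/-- A sum of expressions. -/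
def sum (f : ℕ → RExpr) : ℕ → RExpr
  | 0 => nat 0
  | m + 1 => add (sum f m) (f m)

/-- A product of expressions. -/
def prod (f : ℕ → RExpr) : ℕ → RExpr
  | 0 => nat 1
  | m + 1 => mul (prod f m) (f m)

theorem eval_sum (n : ℕ) (v : ℕ → ℂ) (f : ℕ → RExpr) (m : ℕ) :
    eval n v (sum f m) = ∑ i ∈ Finset.range m, eval n v (f i) := by
  induction m with
  | zero => simp [sum, eval]
  | succ m ih => rw [sum, eval, ih, Finset.sum_range_succ]

theorem eval_prod (n : ℕ) (v : ℕ → ℂ) (f : ℕ → RExpr) (m : ℕ) :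
    eval n v (prod f m) = ∏ i ∈ Finset.range m, eval n v (f i) := by
  induction m with
  | zero => simp [prod, eval]
  | succ m ih => rw [prod, eval, ih, Finset.prod_range_succ]

theorem defined_sum {n b m : ℕ} {v : ℕ → ℂ} {f : ℕ → RExpr} (h : ∀ i < m, Defined n v b (f i)) :
    Defined n v b (sum f m) := by
  induction m with
  | zero => trivial
  | succ m ih => exact ⟨ih fun i hi => h i (by omega), h m (by omega)⟩

theorem defined_prod {n b m : ℕ} {v : ℕ → ℂ} {f : ℕ → RExpr} (h : ∀ i < m, Defined n v b (f i)) :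
    Defined n v b (prod f m) := by
  induction m with
  | zero => trivial
  | succ m ih => exact ⟨ih fun i hi => h i (by omega), h m (by omega)⟩

end RExpr

/-! ### The program for the truncated logarithm -/

section

variable {n : ℕ}

open Classical in
theorem extSum_eq_listSum (W : Matrix (Fin n) (Fin n) ℂ) (j : ℕ) : ∀ L : List (Fin n × Fin n),
    extSum W j L = listSum j fun e : List (Fin n × Fin n) =>
      if ((e.map Prod.fst).Nodup ∧ (e.map Prod.snd).Nodup) ∧ ∀ x ∈ e, ∀ y ∈ L, Shuffle.Avoids y x then
        (e.map fun p => W p.1 p.2).prod else 0 := by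
  induction j with
  | zero => intro L; simp [extSum, listSum]
  | succ j ih =>
    intro L
    rw [extSum, listSum]
    refine Finset.sum_congr rfl fun x _ => ?_
    by_cases hav : ∀ y ∈ L, Shuffle.Avoids y x
    · rw [if_pos hav, ih, ← listSum.mul_left]
      refine listSum.congr_of_length fun e _ => ?_
      have : (((x :: e).map Prod.fst).Nodup ∧ ((x :: e).map Prod.snd).Nodup) ∧
          (∀ w ∈ x :: e, ∀ y ∈ L, Shuffle.Avoids y w) ↔
          ((e.map Prod.fst).Nodup ∧ (e.map Prod.snd).Nodup) ∧
          ∀ w ∈ e, ∀ y ∈ x :: L, Shuffle.Avoids y w := by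
        have h : (∀ w ∈ e, Shuffle.Avoids x w) ↔ x.1 ∉ e.map Prod.fst ∧ x.2 ∉ e.map Prod.snd := by
          simp only [Shuffle.Avoids, List.mem_map, not_exists, not_and, forall_and]
          exact ⟨fun h => ⟨fun w hw e => h.1 w hw e.symm, fun w hw e => h.2 w hw e.symm⟩,
            fun h => ⟨fun w hw e => h.1 w hw e.symm, fun w hw e => h.2 w hw e.symm⟩⟩
        simp only [List.map_cons, List.nodup_cons, List.forall_mem_cons, forall_and, h]
        tauto
      rw [mul_ite, mul_zero]
      simp only [List.map_cons, List.prod_cons] at this ⊢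
      simp only [this]
    · rw [if_neg hav]
      refine Eq.trans ?_ (listSum.congr_of_length (F := fun _ => (0 : ℂ)) fun e _ => ?_)
      · rw [listSum.eq_sum_ofFn, Finset.sum_const_zero]
      · rw [if_neg fun h => hav (h.2 x List.mem_cons_self)]

/-- The `k`-th Taylor coefficient of the normalized permanent, by its sum over partial matchings. -/
theorem coeff_taylorSeries_normPer (W : Matrix (Fin n) (Fin n) ℂ) {k : ℕ} (hk : k ≤ n) :
    PowerSeries.coeff k (taylorSeries (normPer W)) =
      extSum W k [] / (k.factorial * ∏ l ∈ Finset.range k, ((n : ℂ) - l)) := by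
  rw [taylorSeries_normPer, coeff_evSeries_matchWeight, if_pos (Nat.lt_succ_of_le hk),
    extSum_eq_listSum]
  have h : (n.factorial : ℂ) = (n - k).factorial * ∏ l ∈ Finset.range k, ((n : ℂ) - l) := by
    rw [← Nat.factorial_mul_descFactorial hk, Nat.descFactorial_eq_prod_range]
    push_cast
    congr 1
    refine Finset.prod_congr rfl fun l hl => ?_
    rw [Nat.cast_sub ((Finset.mem_range.1 hl).le.trans hk)]
  have h1 : ((n - k).factorial : ℂ) ≠ 0 := by exact_mod_cast (n - k).factorial_ne_zero
  have h2 : (k.factorial : ℂ) ≠ 0 := by exact_mod_cast k.factorial_ne_zero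
  have h3 : (n.factorial : ℂ) ≠ 0 := by exact_mod_cast n.factorial_ne_zero
  have h4 : ∏ l ∈ Finset.range k, ((n : ℂ) - l) ≠ 0 := fun e => h3 (by rw [h, e, mul_zero])
  simp only [List.not_mem_nil, false_imp_iff, implies_true, and_true]
  rw [h]
  field_simp

/-- The coefficient of `z ^ (k - 1)` in `P * (log P)' = P'`. In terms of `k * b_k` the recursion
needs no division, so these products are what the program stores. -/
theorem mul_logCoeff_eq (W : Matrix (Fin n) (Fin n) ℂ) (k : ℕ) :
    (k : ℂ) * logCoeff W k = k * PowerSeries.coeff k (taylorSeries (normPer W)) -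
      ∑ i ∈ Finset.range (k - 1), PowerSeries.coeff (i + 1) (taylorSeries (normPer W)) *
        ((k - 1 - i : ℕ) * logCoeff W (k - 1 - i)) := by
  rcases k with _ | m
  · simp
  have h := congrArg (PowerSeries.coeff m)
    (taylorSeries_log (analyticAt_normPer W 0) (analyticAt_log_normPer W) (exp_log_normPer W))
  rw [PowerSeries.coeff_mul, PowerSeries.coeff_derivative,
    Finset.Nat.sum_antidiagonal_eq_sum_range_succ_mk, Finset.sum_range_succ'] at h
  simp only [PowerSeries.coeff_derivative, coeff_taylorSeries_log] at h
  rw [taylorSeries_normPer, coeff_zero_evSeries_matchWeight, ← taylorSeries_normPer, one_mul,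
    Nat.sub_zero] at h
  rw [Nat.add_sub_cancel]
  push_cast
  rw [eq_sub_iff_add_eq, add_comm, mul_comm _ (logCoeff W (m + 1)), mul_comm _ (PowerSeries.coeff _ _),
    ← h]
  congr 1
  refine Finset.sum_congr rfl fun i hi => ?_
  rw [Finset.mem_range] at hi
  rw [show m - i = m - (i + 1) + 1 by omega]
  push_cast
  ring

namespace RExpr

/-- The Taylor coefficient of the permanent, from the sums over matchings. -/
def permCoeff (k : ℕ) : RExpr :=
  div (reg (2 + k)) (mul (nat k.factorial) (prod (fun l => sub size (nat l)) k))

/-- The Taylor coefficients of the logarithm, from those in the registers from `b` on, and the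
preceding ones in the registers from `c` on. -/
def logCoeffs (b c k : ℕ) : RExpr :=
  sub (mul (nat k) (reg (b + k))) (sum (fun i => mul (reg (b + (i + 1))) (reg (c + (k - 1 - i)))) (k - 1))

/-- The value of the truncated logarithm. -/
def truncValue (c d : ℕ) : RExpr :=
  sum (fun i => mul (div (reg (c + (i + 1))) (nat (i + 1))) (prod (fun _ => reg 0) (i + 1))) d

end RExpr

open RExpr

/-- The program for the truncation at degree `d`. -/
def truncProgram (d : ℕ) : RamProg :=
  .seq (.op (.idxConst 1 1)) (.seq (.op (.numConst (3 + d) 1)) (.seq (enumMatchings d d 0)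
    (.seq (lines permCoeff (3 + d) (d + 1))
      (.seq (lines (logCoeffs (3 + d) (4 + 2 * d)) (4 + 2 * d) (d + 1))
        (.seq (compile (truncValue (4 + 2 * d) d) (5 + 3 * d))
          (.seq (.op (.numConst (6 + 3 * d) 0)) (.op (.numAdd 0 (5 + 3 * d) (6 + 3 * d)))))))))

/-- For `d < n` the denominators contain only factors `n - l` with `l < d`, so no division gets
stuck. The coefficients of the permanent overwrite the product registers of the enumeration, which
are no longer needed. -/
theorem exists_runs_truncProgram (d : ℕ) : ∃ c : ℕ, ∀ n, d + 1 ≤ n →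
    ∀ (W : Matrix (Fin n) (Fin n) ℂ) (z : ℂ), ∃ s,
      Runs W (truncProgram d) (ramInit n z) ((1 + d * (4 * d + 12)) * n ^ (2 * d) + c) s ∧
        s.num 0 = logTrunc W d z := by
  refine ⟨1 + 1 + (∑ k ∈ Finset.range (d + 1), (permCoeff k).cost + 1) +
    (∑ k ∈ Finset.range (d + 1), (logCoeffs (3 + d) (4 + 2 * d) k).cost + 1) +
    (truncValue (4 + 2 * d) d).cost + 1 + 1, fun n hn W z => ?_⟩
  set s₁ := (ramInit n z).setIdx 1 1 with hs₁
  set s₂ := s₁.setNum (3 + d) (1 : ℕ) with hs₂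
  have i₂ : s₂.idx 0 = n := by
    simp [hs₂, hs₁, RamState.setNum, RamState.setIdx, ramInit]
  have z₂ : s₂.num 0 = z := by
    rw [hs₂, setNum_num_of_ne _ _ (by omega)]
    simp [hs₁, RamState.setIdx, ramInit]
  have acc₂ : ∀ k ≤ d, s₂.num (2 + k) = 0 := fun k hk => by
    rw [hs₂, setNum_num_of_ne _ _ (by omega), hs₁, RamState.setIdx, ramInit]
    exact Pi.single_eq_of_ne (by omega) _
  obtain ⟨s₃, r₃, a₃⟩ := runs_enumMatchings (W := W) (d := d) (by omega) d [] s₂ (by simp) i₂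
    (setIdx_idx_self (ramInit n z) 1 1) trivial
  have i₃ : s₃.idx 0 = n := by rw [a₃.1.1 0 (by omega), i₂]
  have z₃ : s₃.num 0 = z := by rw [a₃.1.2 0 (Or.inl rfl), z₂]
  have acc₃ : ∀ k ≤ d, s₃.num (2 + k) = extSum W k [] := fun k hk => by
    rw [a₃.2 k hk, acc₂ k hk]
    beta_reduce
    rw [List.length_nil, if_pos (Nat.zero_le k), Nat.add_zero, hs₂,
      setNum_num_self, Nat.cast_one, one_mul, zero_add, Nat.sub_zero]
  obtain ⟨s₄, r₄, i₄, l₄, x₄⟩ := runs_lines (W := W) (f := permCoeff) (b := 3 + d)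
    (x := fun k => PowerSeries.coeff k (taylorSeries (normPer W))) i₃ (d + 1) fun k hk v hv _ => by
      have hden : eval n v (mul (nat k.factorial) (prod (fun l => sub size (nat l)) k)) =
          k.factorial * ∏ l ∈ Finset.range k, ((n : ℂ) - l) := by
        simp only [eval, eval_prod]
      refine ⟨⟨show 2 + k < 3 + d + k by omega, ⟨trivial, defined_prod fun _ _ =>
        ⟨trivial, trivial⟩⟩, ?_⟩, ?_⟩
      · rw [hden]
        refine mul_ne_zero (by exact_mod_cast k.factorial_ne_zero)
          (Finset.prod_ne_zero_iff.2 fun l hl => ?_)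
        rw [Finset.mem_range] at hl
        rw [sub_ne_zero]
        exact_mod_cast (by omega : n ≠ l)
      · rw [coeff_taylorSeries_normPer W (by omega), permCoeff, eval, hden, eval,
          hv _ (by omega), acc₃ k (by omega)]
  have i₄' : s₄.idx 0 = n := by rw [i₄, i₃]
  obtain ⟨s₅, r₅, i₅, l₅, x₅⟩ := runs_lines (W := W) (f := logCoeffs (3 + d) (4 + 2 * d))
    (b := 4 + 2 * d) (x := fun k => (k : ℂ) * logCoeff W k) i₄' (d + 1) fun k hk v hv hx => by
      refine ⟨⟨⟨trivial, show 3 + d + k < 4 + 2 * d + k by omega⟩, defined_sum fun i hi =>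
        ⟨show 3 + d + (i + 1) < 4 + 2 * d + k by omega,
          show 4 + 2 * d + (k - 1 - i) < 4 + 2 * d + k by omega⟩⟩, ?_⟩
      rw [mul_logCoeff_eq]
      simp only [logCoeffs, eval, eval_sum]
      rw [hv _ (by omega), x₄ k hk]
      refine congrArg _ (Finset.sum_congr rfl fun i hi => ?_)
      rw [Finset.mem_range] at hi
      rw [hv _ (by omega), x₄ _ (by omega), hx _ (by omega)]
  have i₅' : s₅.idx 0 = n := by rw [i₅, i₄']
  have z₅ : s₅.num 0 = z := by rw [l₅ _ (by omega), l₄ _ (by omega), z₃]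
  obtain ⟨s₆, r₆, i₆, x₆, -⟩ := runs_compile (W := W) (truncValue (4 + 2 * d) d) (5 + 3 * d) s₅ i₅'
    (defined_sum fun i hi => ⟨⟨show 4 + 2 * d + (i + 1) < 5 + 3 * d by omega, trivial, by
      rw [eval]; exact_mod_cast Nat.succ_ne_zero i⟩, defined_prod fun _ _ =>
        show 0 < 5 + 3 * d by omega⟩)
  have v₆ : eval n s₅.num (truncValue (4 + 2 * d) d) = logTrunc W d z := by
    have hI : Finset.Icc 1 d = Finset.Ico 1 (d + 1) := by
      ext k; simp only [Finset.mem_Icc, Finset.mem_Ico]; omega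
    rw [truncValue, eval_sum, logTrunc, hI, Finset.sum_Ico_eq_sum_range, Nat.add_sub_cancel]
    refine Finset.sum_congr rfl fun i hi => ?_
    rw [Finset.mem_range] at hi
    have hi' : ((i + 1 : ℕ) : ℂ) ≠ 0 := by exact_mod_cast Nat.succ_ne_zero i
    simp only [eval, eval_prod]
    rw [x₅ _ (by omega), z₅, Finset.prod_const, Finset.card_range, mul_div_cancel_left₀ _ hi',
      add_comm 1 i]
  have r₇ := (Runs.op (W := W) (o := .idxConst 1 1) (s := ramInit n z) rfl).seq
    ((Runs.op (W := W) (o := .numConst (3 + d) 1) (s := s₁) rfl).seq (r₃.seq (r₄.seq (r₅.seq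
      (r₆.seq ((Runs.op (W := W) (o := .numConst (6 + 3 * d) 0) (s := s₆) rfl).seq
        (Runs.op (W := W) (o := .numAdd 0 (5 + 3 * d) (6 + 3 * d)) rfl)))))))
  refine ⟨_, r₇.mono (by omega), ?_⟩
  rw [setNum_num_self, setNum_num_self, setNum_num_of_ne _ _ (by omega), x₆, v₆, Nat.cast_zero,
    add_zero]

end

/-! ### Polynomial running time and conclusion. -/

theorem exists_ramOutputs_truncProgram (d : ℕ) : ∃ N : ℕ, ∀ n, N ≤ n →
    ∀ (W : Matrix (Fin n) (Fin n) ℂ) (z : ℂ), ∃ t ≤ n ^ (2 * d + 1),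
      RamOutputs (truncProgram d) W z t (logTrunc W d z) := by
  obtain ⟨c, hc⟩ := exists_runs_truncProgram d
  -- One additional factor `n` absorbs all constants that depend on `d`.
  refine ⟨1 + d * (4 * d + 12) + c + d + 1, fun n hn W z => ?_⟩
  obtain ⟨s, ⟨t, ht, hs⟩, hv⟩ := hc n (by omega) W z
  refine ⟨t, ht.trans ?_, s, hs, hv⟩
  have h1 : 1 ≤ n ^ (2 * d) := Nat.one_le_pow _ _ (by omega)
  calc (1 + d * (4 * d + 12)) * n ^ (2 * d) + c
      ≤ (1 + d * (4 * d + 12)) * n ^ (2 * d) + c * n ^ (2 * d) :=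
        Nat.add_le_add_left (Nat.le_mul_of_pos_right _ h1) _
    _ = (1 + d * (4 * d + 12) + c) * n ^ (2 * d) := by ring
    _ ≤ n * n ^ (2 * d) := Nat.mul_le_mul_right _ (by omega)
    _ = n ^ (2 * d + 1) := by ring

theorem mainTheorem3 :
    (∀ β : ℝ, 0 < β → β < 1 / 3 → ∀ d : ℕ, 2 ≤ d → ∀ γ : ℝ, γ < tradeoffExponent d β →
      ∀ δ : ℝ, 0 < δ → δ < 1 → ∃ N : ℕ, ∀ n : ℕ, N ≤ n →
        ∀ (Ω : Type*) [MeasurableSpace Ω] (P : Measure Ω) [IsProbabilityMeasure P]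
          (W : Ω → Matrix (Fin n) (Fin n) ℂ), IsIIDComplexGaussian W P →
          P {ω | ¬ LogBranchApprox (W ω) ((n : ℝ) ^ (1 / 3 - β)) d ((n : ℝ) ^ (-γ))} ≤
            ENNReal.ofReal δ) ∧
    (∃ C : ℝ, 0 < C ∧ ∀ γ : ℝ, 0 < γ → ∃ p : RamProg,
      (∃ N : ℕ, ∀ n : ℕ, N ≤ n → ∀ (W : Matrix (Fin n) (Fin n) ℂ) (z : ℂ), ∃ t : ℕ,
        (t : ℝ) ≤ (n : ℝ) ^ (C * (1 + γ)) ∧ RamOutputs p W z t (logTrunc W ⌈6 * γ + 3⌉₊ z)) ∧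
      ∀ β : ℝ, 0 < β → β < 1 / 3 → ∀ δ : ℝ, 0 < δ → δ < 1 → ∃ N : ℕ, ∀ n : ℕ, N ≤ n →
        ∀ (Ω : Type*) [MeasurableSpace Ω] (P : Measure Ω) [IsProbabilityMeasure P]
          (W : Ω → Matrix (Fin n) (Fin n) ℂ), IsIIDComplexGaussian W P →
          P {ω | ¬ LogBranchApprox (W ω) ((n : ℝ) ^ (1 / 3 - β)) ⌈6 * γ + 3⌉₊
              ((n : ℝ) ^ (-γ))} ≤ ENNReal.ofReal δ) := by
  refine ⟨fun β hβ _ d _ γ hγ δ hδ _ => exists_forall_measure_not_logBranchApprox_le hβ hγ hδ,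
    -- The degree is below `6γ + 4`, so the exponent `2d + 1` is below `12γ + 9`.
    12, by norm_num, fun γ hγ => ⟨truncProgram ⌈6 * γ + 3⌉₊, ?_, fun β hβ _ δ hδ _ =>
      exists_forall_measure_not_logBranchApprox_le hβ ?_ hδ⟩⟩
  · obtain ⟨N, hN⟩ := exists_ramOutputs_truncProgram ⌈6 * γ + 3⌉₊
    refine ⟨N + 1, fun n hn W z => ?_⟩
    obtain ⟨t, ht, h⟩ := hN n (by omega) W z
    refine ⟨t, ?_, h⟩
    have hd : (⌈6 * γ + 3⌉₊ : ℝ) < 6 * γ + 3 + 1 := Nat.ceil_lt_add_one (by positivity)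
    calc (t : ℝ) ≤ (n : ℝ) ^ (2 * ⌈6 * γ + 3⌉₊ + 1) := by exact_mod_cast ht
      _ = (n : ℝ) ^ ((2 * ⌈6 * γ + 3⌉₊ + 1 : ℕ) : ℝ) := (Real.rpow_natCast _ _).symm
      _ ≤ (n : ℝ) ^ (12 * (1 + γ)) := by
        refine Real.rpow_le_rpow_of_exponent_le (by exact_mod_cast (by omega : 1 ≤ n)) ?_
        push_cast
        linarith
  -- For this degree `(d + 1)/6 - 1/2` is at least `γ + 1/6`, so the tradeoff exponent exceeds `γ`
  -- for every positive `β`.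
  · have hd : 6 * γ + 3 ≤ (⌈6 * γ + 3⌉₊ : ℝ) := Nat.le_ceil _
    have : 0 < β * ((⌈6 * γ + 3⌉₊ : ℝ) + 1) := by positivity
    rw [tradeoffExponent]
    linarith
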